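/- **Setting.** Let $T>0$, $\sigma>0$, let $Z$ be a random variable with values in a measurable space $\mathcal Z$, let $\mathsf E$ be the expectation on its probability space, and let $X_0$ be a bounded $\sigma(Z)$-measurable random vector in $\mathbb R^d$. A relaxed control is a measure $\nu(dt,da)=\nu_t(da)\,dt$ on $[0,T]\times\mathbb R^m$ with $\nu_t$ a probability measure on $\mathbb R^m$ depending measurably on $t$. The coefficients $\phi(t,x,a,z)\in\mathbb R^d$, $L(t,x,a,z)\in\mathbb R$, $G(x,z)\in\mathbb R$ are measurable, continuously differentiable in $(x,a)$, and $\phi,\nabla_x\phi,\nabla_xL,\nabla_xG$ are bounded. Put $H(t,x,a,p,z)=L(t,x,a,z)+p\cdot\phi(t,x,a,z)$. For a control $\nu$ let $(X,P)$ be the solution on $[0,T]$ of $$X_t=X_0+\int_0^t\!\!\int\phi(r,X_r,a,Z)\,\nu_r(da)\,dr,\qquad P_t=\nabla_xG(X_T,Z)+\int_t^T\!\!\int\nabla_xH(r,X_r,a,P_r,Z)\,\nu_r(da)\,dr ,\tag{1}$$ and let $K_x,K_p\subset\mathbb R^d$ be compact sets such that $(X_t,P_t)\in K_x\times K_p$ for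 all controls and all $t\in[0,T]$. Put $$V(\nu)=\mathsf E\Big[\int_0^T\!\!\int L(t,X_t,a,Z)\,\nu_t(da)\,dt+G(X_T,Z)\Big],\qquad V^\sigma(\nu)=V(\nu)+\frac{\sigma^2}2\int_0^T\mathrm{Ent}(\nu_t)\,dt,$$ where $\mathrm{Ent}$ is the relative entropy with respect to Lebesgue measure on $\mathbb R^m$, integrals take values in $[-\infty,\infty]$, and an integral with infinite positive part is $+\infty$, as is $V^\sigma(\nu)$ where $V(\nu)=+\infty$. **Assumptions.** Uniformly in $t\in[0,T]$ and $z\in\mathcal Z$: 1. $\phi,\nabla_a\phi,\nabla_aL,\nabla_x\phi,\nabla_xL,\nabla_xG$ are Lipschitz in $(x,a)\in K_x\times\mathbb R^m$, and $H(t,0,0,0,z)$ and $\nabla_aH(t,0,0,0,z)$ are bounded; 2. $\phi,L$ are $C^2$ in $a$ for $x\in K_x$; there are $\varepsilon>0$ and $R$ with $a\cdot\nabla_aH(t,x,a,p,z)\ge\varepsilon|a|^2$ whenever $|a|\ge R$, $x\in K_x$, $p\in K_p$; and $a\mapsto\mathsf E[\nabla_aH(t,x,a,p,Z)]$ is $C^3$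 for all $t\in[0,T]$, $x\in K_x$, $p\in K_p$; 3. $V$ is bounded from below on the set of relaxed controls. **Proposition (necessary first order condition).** Let $\nu^*$ minimise $V^\sigma$ over all relaxed controls, with $V^\sigma(\nu^*)<\infty$. Then: * $\nu^*$ is equivalent to the Lebesgue measure on $[0,T]\times\mathbb R^m$; * the equations (1) with $\nu=\nu^*$ have a unique solution $(X^*,P^*)$, and for a.e. $t\in[0,T]$ the measure $\nu^*_t$ has a positive $C^1$ density, again denoted $\nu^*_t$, with $$\mathsf E\big[\nabla_aH(t,X^*_t,a,P^*_t,Z)\big]+\frac{\sigma^2}2\nabla_a\ln\nu^*_t(a)=0\qquad\text{for all }a\in\mathbb R^m;$$ * $\nu^*$ is an invariant measure of the mean-field Langevin system $$d\Theta^s_t=-\mathsf E\big[\nabla_aH(t,X^s_t,\Theta^s_t,P^s_t,Z)\big]\,ds+\sigma\,dW_s,\qquad s\ge0,\ \text{a.e. }t\in[0,T],$$ where $W$ is an $m$-dimensional Brownian motion and $(X^s,P^s)$ solves (1) with $\nu_t=\mathrm{Law}(\Theta^s_t)$. That is, $\int_0^T\!\int|a|^p\,\nu^*_t(da)\,dt<\infty$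 for some $p\ge1$, and for all initial variables $\Theta^0_t$ that have law $\nu^*_t$ and are independent of $W$ (for a.e. $t$), the system has a solution, and every solution satisfies $\mathrm{Law}(\Theta^s_t)=\nu^*_t$ for a.e. $t\in[0,T]$ and all $s\ge0$. -/

import Mathlib

open MeasureTheory ProbabilityTheory Set
open scoped NNReal ENNReal

universe u v w

noncomputable section

namespace RelaxedControl

/-- The Euclidean space `ℝⁿ`. -/
abbrev E (n : ℕ) : Type := EuclideanSpace ℝ (Fin n)

/-! ### Extended integrals and entropy -/

/-- The integral of an extended-real function, `∫ f⁺ - ∫ f⁻`, with values in `[-∞, ∞]`. As usual in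
minimisation it is `+∞` as soon as `∫ f⁺ = ∞`. -/
def extIntegral {α : Type*} [MeasurableSpace α] (μ : Measure α) (f : α → EReal) : EReal :=
  open Classical in
  if ∫⁻ x, (f x).toENNReal ∂μ = ⊤ then ⊤
  else ((∫⁻ x, (f x).toENNReal ∂μ : ℝ≥0∞) : EReal) - ((∫⁻ x, (-f x).toENNReal ∂μ : ℝ≥0∞) : EReal)

/-- Relative entropy with respect to the Lebesgue measure: `∫ ρ ln ρ` if `μ` has the density `ρ`,
and `+∞` if `μ` is not absolutely continuous. -/
def entropy {m : ℕ} (μ : Measure (E m)) : EReal :=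
  open Classical in
  if μ ≪ volume then
    extIntegral volume fun a =>
      (((μ.rnDeriv volume a).toReal * Real.log (μ.rnDeriv volume a).toReal : ℝ) : EReal)
  else ⊤

/-! ### The control problem -/

/-- The data of a relaxed control problem: the horizon `T`, the regularisation parameter `σ`, the
coefficients `φ, L, G`, the law `P` of the exogenous randomness, the random variable `Z` and the
initial state `X₀`. -/
structure ControlProblem (d m : ℕ) (𝒵 : Type v) (Ω₀ : Type w) [MeasurableSpace Ω₀] where
  T : ℝ
  σ : ℝ
  φ : ℝ → E d → E m → 𝒵 → E d
  L : ℝ → E d → E m → 𝒵 → ℝ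
  G : E d → 𝒵 → ℝ
  P : Measure Ω₀
  Z : Ω₀ → 𝒵
  X₀ : Ω₀ → E d

namespace ControlProblem

variable {d m : ℕ} {𝒵 : Type v} {Ω₀ : Type w} [MeasurableSpace 𝒵] [MeasurableSpace Ω₀]
  (S : ControlProblem d m 𝒵 Ω₀)

/-- The Lebesgue measure on `[0, T]`. -/
def time : Measure ℝ := volume.restrict (Icc 0 S.T)

/-- The Hamiltonian `H(t, x, a, p, z) = L(t, x, a, z) + p · φ(t, x, a, z)`. -/
def H (t : ℝ) (x : E d) (a : E m) (p : E d) (z : 𝒵) : ℝ :=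
  S.L t x a z + inner ℝ p (S.φ t x a z)

/-- `∇ₐ H`. -/
def gradaH (t : ℝ) (x : E d) (a : E m) (p : E d) (z : 𝒵) : E m :=
  gradient (fun b => S.H t x b p z) a

/-- `∇ₓ H`. -/
def gradxH (t : ℝ) (x : E d) (a : E m) (p : E d) (z : 𝒵) : E d :=
  gradient (fun y => S.H t y a p z) x

/-- The σ-algebra `𝒢 = σ(Z)`. -/
abbrev 𝒢 : MeasurableSpace Ω₀ := MeasurableSpace.comap S.Z inferInstance

/-! A relaxed control `ν(dt, da) = νₜ(da) dt` is given by a Markov kernel `t ↦ νₜ` from `ℝ` to `ℝᵐ`;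
only its values for almost every `t ∈ [0, T]` matter. -/

/-- The measure `νₜ(da) dt` on `[0, T] × ℝᵐ`. -/
def controlMeasure (ν : Kernel ℝ (E m)) : Measure (ℝ × E m) := S.time ⊗ₘ ν

/-- `X` is the controlled process
`X_t = X₀ + ∫₀ᵗ ∫ φ(r, X_r, a, Z) ν_r(da) dr`, `t ∈ [0, T]`. -/
structure IsState (ν : Kernel ℝ (E m)) (X : ℝ → Ω₀ → E d) : Prop where
  measurable : ∀ t ∈ Icc 0 S.T, Measurable[S.𝒢] (X t)
  continuousOn : ∀ ω, ContinuousOn (fun t => X t ω) (Icc 0 S.T)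
  eq : ∀ ω, ∀ t ∈ Icc 0 S.T,
    X t ω = S.X₀ ω + ∫ r in (0 : ℝ)..t, ∫ a, S.φ r (X r ω) a (S.Z ω) ∂(ν r)

/-- `P` is the adjoint process
`P_t = ∇ₓ G(X_T, Z) + ∫ₜᵀ ∫ ∇ₓ H(r, X_r, a, P_r, Z) ν_r(da) dr`, `t ∈ [0, T]`. -/
structure IsAdjoint (ν : Kernel ℝ (E m)) (X P : ℝ → Ω₀ → E d) : Prop where
  measurable : ∀ t ∈ Icc 0 S.T, Measurable[S.𝒢] (P t)
  continuousOn : ∀ ω, ContinuousOn (fun t => P t ω) (Icc 0 S.T)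
  eq : ∀ ω, ∀ t ∈ Icc 0 S.T,
    P t ω = gradient (fun x => S.G x (S.Z ω)) (X S.T ω)
      + ∫ r in t..S.T, ∫ a, S.gradxH r (X r ω) a (P r ω) (S.Z ω) ∂(ν r)

/-- The process `X` controlled by `ν` (the equation determines it on `[0, T]`). -/
def state (ν : Kernel ℝ (E m)) : ℝ → Ω₀ → E d := Classical.epsilon (S.IsState ν)

/-- The objective `V(ν) = 𝖤[∫₀ᵀ ∫ L(t, X_t, a, Z) νₜ(da) dt + G(X_T, Z)]`. -/
def V (ν : Kernel ℝ (E m)) : EReal :=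
  extIntegral S.P fun ω =>
    extIntegral (S.controlMeasure ν)
      (fun q => ((S.L q.1 (S.state ν q.1 ω) q.2 (S.Z ω) : ℝ) : EReal))
    + ((S.G (S.state ν S.T ω) (S.Z ω) : ℝ) : EReal)

/-- The regularised objective `V^σ(ν) = V(ν) + (σ² / 2) ∫₀ᵀ Ent(νₜ) dt` (equal to `+∞` where
`V(ν) = +∞`). -/
def Vreg (ν : Kernel ℝ (E m)) : EReal :=
  open Classical in
  if S.V ν = ⊤ then ⊤
  else S.V ν + ((S.σ ^ 2 / 2 : ℝ) : EReal) * extIntegral S.time (fun t => entropy (ν t))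

/-- `V` is bounded from below on the set of relaxed controls. -/
def BoundedBelow : Prop :=
  ∃ c : ℝ, ∀ (ν : Kernel ℝ (E m)) [IsMarkovKernel ν], (c : EReal) ≤ S.V ν

/-- `ν` minimises `V^σ` over all relaxed controls. -/
def IsOptimal (ν : Kernel ℝ (E m)) : Prop :=
  ∀ (ν' : Kernel ℝ (E m)) [IsMarkovKernel ν'], S.Vreg ν ≤ S.Vreg ν'

/-! ### Assumptions -/

/-- The standing assumptions. -/
structure Standing : Prop where
  T_pos : 0 < S.T
  σ_pos : 0 < S.σ
  isProb : IsProbabilityMeasure S.P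
  measurable_Z : Measurable S.Z
  measurable_X₀ : Measurable[S.𝒢] S.X₀
  bounded_X₀ : ∃ C : ℝ, ∀ ω, ‖S.X₀ ω‖ ≤ C
  measurable_φ : Measurable fun q : ℝ × E d × E m × 𝒵 => S.φ q.1 q.2.1 q.2.2.1 q.2.2.2
  measurable_L : Measurable fun q : ℝ × E d × E m × 𝒵 => S.L q.1 q.2.1 q.2.2.1 q.2.2.2
  measurable_G : Measurable fun q : E d × 𝒵 => S.G q.1 q.2
  contDiff_φ : ∀ t ∈ Icc 0 S.T, ∀ z, ContDiff ℝ 1 fun q : E d × E m => S.φ t q.1 q.2 z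
  contDiff_L : ∀ t ∈ Icc 0 S.T, ∀ z, ContDiff ℝ 1 fun q : E d × E m => S.L t q.1 q.2 z
  contDiff_G : ∀ z, ContDiff ℝ 1 fun x => S.G x z
  bounded_φ : ∃ C : ℝ, ∀ t ∈ Icc 0 S.T, ∀ x a z, ‖S.φ t x a z‖ ≤ C
  bounded_gradxφ : ∃ C : ℝ, ∀ t ∈ Icc 0 S.T, ∀ x a z, ‖fderiv ℝ (fun y => S.φ t y a z) x‖ ≤ C
  bounded_gradxL : ∃ C : ℝ, ∀ t ∈ Icc 0 S.T, ∀ x a z, ‖gradient (fun y => S.L t y a z) x‖ ≤ C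
  bounded_gradxG : ∃ C : ℝ, ∀ x z, ‖gradient (fun y => S.G y z) x‖ ≤ C

/-- `Kx × Kp` is a compact set in which the forward and adjoint processes live, for all controls.
Under the standing assumptions large closed balls have this property. -/
structure IsRange (Kx Kp : Set (E d)) : Prop where
  isCompact_x : IsCompact Kx
  isCompact_p : IsCompact Kp
  mem : ∀ (ν : Kernel ℝ (E m)) [IsMarkovKernel ν] (X P : ℝ → Ω₀ → E d),
    S.IsState ν X → S.IsAdjoint ν X P →
      ∀ t ∈ Icc 0 S.T, ∀ ω, X t ω ∈ Kx ∧ P t ω ∈ Kp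

/-- Lipschitz continuity in `(x, a)` on `Kx × ℝᵐ`, uniform in `t ∈ [0, T]` and in `z`. -/
def UniformLipschitz {F : Type*} [NormedAddCommGroup F] (Kx : Set (E d))
    (f : ℝ → E d → E m → 𝒵 → F) : Prop :=
  ∃ C : ℝ, ∀ t ∈ Icc 0 S.T, ∀ z, ∀ x ∈ Kx, ∀ x' ∈ Kx, ∀ a a',
    ‖f t x a z - f t x' a' z‖ ≤ C * (‖x - x'‖ + ‖a - a'‖)

/-- Regularity: Lipschitz continuous first derivatives, and `H(t,0,0,0,z)`, `∇ₐH(t,0,0,0,z)`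
bounded. -/
structure AssumptionWell (Kx : Set (E d)) : Prop where
  lip_gradaφ : S.UniformLipschitz Kx fun t x a z => fderiv ℝ (fun b => S.φ t x b z) a
  lip_gradaL : S.UniformLipschitz Kx fun t x a z => gradient (fun b => S.L t x b z) a
  lip_gradxφ : S.UniformLipschitz Kx fun t x a z => fderiv ℝ (fun y => S.φ t y a z) x
  lip_gradxL : S.UniformLipschitz Kx fun t x a z => gradient (fun y => S.L t y a z) x
  lip_gradxG : S.UniformLipschitz Kx fun _ x (_ : E m) z => gradient (fun y => S.G y z) x
  lip_φ : S.UniformLipschitz Kx S.φ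
  bounded_H : ∃ C : ℝ, ∀ t ∈ Icc 0 S.T, ∀ z, |S.H t 0 0 0 z| ≤ C
  bounded_gradaH : ∃ C : ℝ, ∀ t ∈ Icc 0 S.T, ∀ z, ‖S.gradaH t 0 0 0 z‖ ≤ C

/-- Second-order smoothness in `a`, dissipativity of `∇ₐH`, and smoothness of `𝖤[∇ₐH]`. -/
structure AssumptionGF (Kx Kp : Set (E d)) : Prop where
  contDiff_φ : ∀ t ∈ Icc 0 S.T, ∀ x ∈ Kx, ∀ z, ContDiff ℝ 2 fun a => S.φ t x a z
  contDiff_L : ∀ t ∈ Icc 0 S.T, ∀ x ∈ Kx, ∀ z, ContDiff ℝ 2 fun a => S.L t x a z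
  dissipative : ∃ ε > 0, ∃ R : ℝ, ∀ t ∈ Icc 0 S.T, ∀ x ∈ Kx, ∀ p ∈ Kp, ∀ z, ∀ a : E m,
    R ≤ ‖a‖ → ε * ‖a‖ ^ 2 ≤ inner ℝ a (S.gradaH t x a p z)
  contDiff_mean : ∀ t ∈ Icc 0 S.T, ∀ x ∈ Kx, ∀ p ∈ Kp,
    ContDiff ℝ 3 fun a => ∫ ω, S.gradaH t x a p (S.Z ω) ∂S.P

/-! ### The first order condition -/

/-- For a.e. `t ∈ [0, T]` the measure `νₜ` has a positive `C¹` density, again denoted `νₜ`, with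
`𝖤[∇ₐH(t, X_t, ·, P_t, Z)] + (σ² / 2) ∇ₐ ln νₜ = 0`. -/
def FirstOrderCondition (ν : Kernel ℝ (E m)) (X P : ℝ → Ω₀ → E d) : Prop :=
  ∀ᵐ t ∂S.time, ∃ ρ : E m → ℝ,
    (∀ a, 0 < ρ a) ∧ ContDiff ℝ 1 ρ ∧
    ν t = volume.withDensity (fun a => ENNReal.ofReal (ρ a)) ∧
    ∀ a, Integrable (fun ω => S.gradaH t (X t ω) a (P t ω) (S.Z ω)) S.P ∧
      (∫ ω, S.gradaH t (X t ω) a (P t ω) (S.Z ω) ∂S.P)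
        + (S.σ ^ 2 / 2) • gradient (fun b => Real.log (ρ b)) a = 0

/-! ### The mean-field Langevin system -/

/-- A standard Brownian motion in `ℝᵐ`. -/
structure IsBrownian {Ω : Type*} [MeasurableSpace Ω] (μ : Measure Ω) (W : ℝ≥0 → Ω → E m) :
    Prop where
  measurable : ∀ s, Measurable (W s)
  coord : ∀ i, IsBrownianReal (fun s ω => W s ω i) μ
  indep : iIndepFun (fun i ω s => W s ω i) μ

/-- A solution of the system of mean-field Langevin equations: for a.e. `t ∈ [0, T]`
`dΘₜˢ = - 𝖤[∇ₐH(t, Xₜˢ, Θₜˢ, Pₜˢ, Z)] ds + σ dW_s`, `s ≥ 0`, where `Xˢ` and `Pˢ` are the forward and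
adjoint processes of the control `νₜˢ = Law(Θₜˢ)`. The noise is additive, so the equation is
understood path by path. -/
structure IsLangevinSolution {Ω : Type*} [MeasurableSpace Ω] (μ : Measure Ω) (W : ℝ≥0 → Ω → E m)
    (Θ : ℝ → ℝ≥0 → Ω → E m) (ν : ℝ≥0 → Kernel ℝ (E m)) (X P : ℝ≥0 → ℝ → Ω₀ → E d) : Prop where
  markov : ∀ s, IsMarkovKernel (ν s)
  measurable : ∀ᵐ t ∂S.time, ∀ s, Measurable (Θ t s)
  law : ∀ᵐ t ∂S.time, ∀ s, μ.map (Θ t s) = ν s t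
  continuous : ∀ᵐ t ∂S.time, ∀ᵐ ω ∂μ, Continuous fun s => Θ t s ω
  sde : ∀ᵐ t ∂S.time, ∀ᵐ ω ∂μ, ∀ s : ℝ≥0,
    Θ t s ω = Θ t 0 ω
      - (∫ r in (0 : ℝ)..s, ∫ ω₀,
          S.gradaH t (X r.toNNReal t ω₀) (Θ t r.toNNReal ω) (P r.toNNReal t ω₀) (S.Z ω₀) ∂S.P)
      + S.σ • W s ω
  state : ∀ s, S.IsState (ν s) (X s)
  adjoint : ∀ s, S.IsAdjoint (ν s) (X s) (P s)

/-- `ν` is an invariant measure of the mean-field Langevin system: it is an admissible initial law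
(it has a finite `p`-moment for some `p ≥ 1`), and whenever the system is started from variables
`Θₜ⁰` with law `νₜ` that are independent of the Brownian motion, it has a solution, and the marginal
laws of every solution stay equal to `νₜ` at all times `s ≥ 0`. -/
def IsInvariant (ν : Kernel ℝ (E m)) : Prop :=
  (∃ p : ℝ, 1 ≤ p ∧ ∫⁻ t, ∫⁻ a, ENNReal.ofReal (‖a‖ ^ p) ∂(ν t) ∂S.time < ⊤) ∧
  ∀ (Ω : Type u) [MeasurableSpace Ω] (μ : Measure Ω) [IsProbabilityMeasure μ]
    (W : ℝ≥0 → Ω → E m) (Θ₀ : ℝ → Ω → E m),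
    IsBrownian μ W →
    (∀ᵐ t ∂S.time, Measurable (Θ₀ t) ∧ μ.map (Θ₀ t) = ν t ∧
      IndepFun (Θ₀ t) (fun ω s => W s ω) μ) →
    (∃ Θ ν' X P, S.IsLangevinSolution μ W Θ ν' X P ∧ ∀ᵐ t ∂S.time, Θ t 0 =ᵐ[μ] Θ₀ t) ∧
    (∀ Θ ν' X P, S.IsLangevinSolution μ W Θ ν' X P → (∀ᵐ t ∂S.time, Θ t 0 =ᵐ[μ] Θ₀ t) →
      ∀ᵐ t ∂S.time, ∀ s, ν' s t = ν t)

end ControlProblem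

end RelaxedControl

end

open RelaxedControl

open RelaxedControl

section

open Filter Topology

/-! The minimiser `ν` is compared with a single competitor: the Gibbs kernel `γ` with density
proportional to `exp (-(2/σ²) 𝖤[H(t, X_t, a, P_t, Z)])`, where `(X, P)` are the processes of `ν`
itself. The adjoint process cancels the first order effect of the moving state, so the right
derivative of `V` at `ε = 0` along `(1 - ε) ν + ε γ` is the integral of the averaged Hamiltonian
against `γ - ν` (`Bounds.exists_tendsto_V_mix`). The entropy is convex along the mixture. Minimality
therefore says that the free energy `(2/σ²) ∫ 𝖤[H] dη + ∫ η ln η` of `η = ν` does not exceed that of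
`η = γ`. But `γ` is its unique minimiser, because the excess is a relative entropy
(`HasDensity.ae_eq_gibbs`); hence `ν = γ`, and equivalence to Lebesgue measure and the first order
condition are read off from the density.

Growth comes from dissipativity: with the Lipschitz bounds it gives quadratic upper and lower bounds
on `H` and `L` (`Standing.exists_full_bounds`). They make the Gibbs density normalisable and force a
finite second moment on every control with `V < ∞`.

For invariance the processes `(X, P)` are frozen. For each `t` there remains a Langevin equation
with Lipschitz gradient drift, whose Gibbs law is `ν_t`. Its invariance is proved through the Euler
scheme: the Cameron–Martin formula turns the drift of a step into a weight, and up to an error this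
weight is the symmetric one for which detailed balance holds. A step of size `δ` costs `δ^{3/2}`,
and all steps together cost `√δ` (`abs_integral_euler_step_le`, `map_langevin_eq`). The frozen
solution thus keeps the law `ν_t`, so it solves the mean-field system.

Any other solution with the same noise and initial values has the same laws
(`IsLangevinSolution.law_unique`): the processes depend on the laws in a Lipschitz way, the paths
are coupled by their noise, and iterating gives bounds `Qⁿ sⁿ / n!`, starting from the compact range
of the processes. -/

/-! ### Integral inequalities and Carathéodory differential equations -/

/-- Grönwall's inequality in integral form. -/
theorem le_mul_exp_of_le_add_mul_integral {u : ℝ → ℝ} {A K T : ℝ} (hK : 0 ≤ K)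
    (hu : ContinuousOn u (Icc 0 T))
    (h : ∀ t ∈ Icc 0 T, u t ≤ A + K * ∫ r in (0 : ℝ)..t, u r) :
    ∀ t ∈ Icc 0 T, u t ≤ A * Real.exp (K * t) := by
  intro t₀ ht₀
  have hT : 0 ≤ T := ht₀.1.trans ht₀.2
  -- `u` is continuous only on `[0, T]`; extended by constants it has a primitive that is
  -- differentiable everywhere, so no one-sided derivatives occur.
  set w : ℝ → ℝ := IccExtend hT ((Icc 0 T).domRestrict u)
  have hw : Continuous w := (continuousOn_iff_continuous_domRestrict.1 hu).Icc_extend'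
  have hwu : ∀ t ∈ Icc 0 T, w t = u t := fun t ht => by
    simp only [w, IccExtend_of_mem hT _ ht]; rfl
  have hint : ∀ t ∈ Icc 0 T, ∫ r in (0 : ℝ)..t, u r = ∫ r in (0 : ℝ)..t, w r := by
    intro t ht
    refine intervalIntegral.integral_congr fun r hr => ?_
    rw [uIcc_of_le ht.1] at hr
    exact (hwu r ⟨hr.1, hr.2.trans ht.2⟩).symm
  -- The derivative of `F` is `K exp (-K t)` times `w t - (A + K ∫ w)`, which the hypothesis makes
  -- nonpositive on `[0, T]`.
  set F : ℝ → ℝ := fun t => Real.exp (-(K * t)) * (A + K * ∫ r in (0 : ℝ)..t, w r)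
  have hF : ∀ t, HasDerivAt F (Real.exp (-(K * t)) * (-K) * (A + K * ∫ r in (0 : ℝ)..t, w r)
      + Real.exp (-(K * t)) * (K * w t)) t := by
    intro t
    have h1 : HasDerivAt (fun t => ∫ r in (0 : ℝ)..t, w r) (w t) t :=
      intervalIntegral.integral_hasDerivAt_right (hw.intervalIntegrable _ _)
        (hw.stronglyMeasurableAtFilter _ _) hw.continuousAt
    have h2 : HasDerivAt (fun t : ℝ => Real.exp (-(K * t))) (Real.exp (-(K * t)) * (-K)) t := by
      have : HasDerivAt (fun t : ℝ => -(K * t)) (-K) t := by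
        simpa using ((hasDerivAt_id t).const_mul K).fun_neg
      exact this.exp
    exact h2.mul ((h1.const_mul K).const_add A)
  have hanti : AntitoneOn F (Icc 0 T) := by
    refine antitoneOn_of_deriv_nonpos (convex_Icc _ _)
      (fun t _ => (hF t).continuousAt.continuousWithinAt)
      (fun t _ => (hF t).differentiableAt.differentiableWithinAt) fun t ht => ?_
    rw [interior_Icc] at ht
    have ht' : t ∈ Icc 0 T := ⟨ht.1.le, ht.2.le⟩
    rw [(hF t).deriv]
    have := h t ht'
    rw [hint t ht', ← hwu t ht'] at this
    have h3 : 0 ≤ Real.exp (-(K * t)) * K := by positivity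
    nlinarith [mul_le_mul_of_nonneg_left this h3]
  have h0 := hanti ⟨le_rfl, hT⟩ ht₀ ht₀.1
  simp only [F, mul_zero, neg_zero, Real.exp_zero, intervalIntegral.integral_same, add_zero,
    one_mul] at h0
  have h1 := h t₀ ht₀
  rw [hint t₀ ht₀] at h1
  refine h1.trans ?_
  rw [Real.exp_neg, inv_mul_le_iff₀ (Real.exp_pos _)] at h0
  linarith

/-- The weight `exp (2 K t)` turns integration against the Lipschitz constant `K` into a contraction
by `1/2`, on intervals of any length. -/
theorem integral_exp_mul_real {K : ℝ} (hK : 0 < K) (t : ℝ) :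
    ∫ r in (0 : ℝ)..t, Real.exp (2 * K * r) = (Real.exp (2 * K * t) - 1) / (2 * K) := by
  have h : ∀ r ∈ uIcc 0 t, HasDerivAt (fun r => Real.exp (2 * K * r) / (2 * K))
      (Real.exp (2 * K * r)) r := by
    intro r _
    have h1 : HasDerivAt (fun r : ℝ => 2 * K * r) (2 * K) r := by
      simpa using (hasDerivAt_id r).const_mul (2 * K)
    have h2 := h1.exp.div_const (2 * K)
    rwa [mul_div_cancel_right₀ _ (by positivity)] at h2
  rw [intervalIntegral.integral_eq_sub_of_hasDerivAt h
    (Continuous.intervalIntegrable (by fun_prop) _ _)]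
  simp [sub_div]

section Caratheodory

variable {Ω F : Type*} [MeasurableSpace Ω] [NormedAddCommGroup F] [NormedSpace ℝ F]
  [MeasurableSpace F]

/-- The Picard iterates of `Y' = f(t, ω, Y)`, `Y_0 = y₀`. -/
noncomputable def picardIter (f : ℝ → Ω → F → F) (y₀ : Ω → F) : ℕ → ℝ → Ω → F
  | 0 => fun _ ω => y₀ ω
  -- The truncation `max t 0` freezes the iterates at negative times, so their paths are continuous
  -- on all of `ℝ` although the coefficient is controlled only for `t ≥ 0`.
  | n + 1 => fun t ω => y₀ ω + ∫ r in (0 : ℝ)..max t 0, f r ω (picardIter f y₀ n r ω)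

variable [BorelSpace F] [SecondCountableTopology F] {f : ℝ → Ω → F → F} {y₀ : Ω → F}

theorem intervalIntegrable_comp_of_lipschitz {K : ℝ}
    (hf : Measurable fun q : ℝ × Ω × F => f q.1 q.2.1 q.2.2)
    (hL : ∀ t ω x y, ‖f t ω x - f t ω y‖ ≤ K * ‖x - y‖)
    (hb : ∀ ω T, ∃ M, ∀ t ∈ Icc 0 T, ‖f t ω 0‖ ≤ M) {y : ℝ → F} (hy : Continuous y) (ω : Ω)
    {s t : ℝ} (hs : 0 ≤ s) (ht : 0 ≤ t) : IntervalIntegrable (fun r => f r ω (y r)) volume s t := by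
  have key : ∀ T, 0 ≤ T → IntervalIntegrable (fun r => f r ω (y r)) volume 0 T := by
    intro T hT
    obtain ⟨M, hM⟩ := hb ω T
    obtain ⟨M', hM'⟩ := (isCompact_Icc (a := (0 : ℝ)) (b := T)).exists_bound_of_continuousOn
      hy.continuousOn
    rw [intervalIntegrable_iff_integrableOn_Icc_of_le hT]
    refine Measure.integrableOn_of_bounded (M := M + |K| * M') (by simp) ?_ ?_
    · have : Measurable fun r => f r ω (y r) :=
        hf.comp (measurable_id.prodMk (measurable_const.prodMk hy.measurable))
      exact this.aestronglyMeasurable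
    · refine (ae_restrict_iff' measurableSet_Icc).2 (Eventually.of_forall fun r hr => ?_)
      have h1 : ‖f r ω (y r)‖ ≤ ‖f r ω 0‖ + ‖f r ω (y r) - f r ω 0‖ := by
        simpa using norm_add_le (f r ω 0) (f r ω (y r) - f r ω 0)
      have h2 := hL r ω (y r) 0
      rw [sub_zero] at h2
      have h3 : K * ‖y r‖ ≤ |K| * M' :=
        mul_le_mul (le_abs_self K) (hM' r hr) (norm_nonneg _) (abs_nonneg _)
      linarith [hM r hr]
  exact (key s hs).symm.trans (key t ht)

theorem picardIter_continuous_measurable {K : ℝ}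
    (hf : Measurable fun q : ℝ × Ω × F => f q.1 q.2.1 q.2.2)
    (hL : ∀ t ω x y, ‖f t ω x - f t ω y‖ ≤ K * ‖x - y‖)
    (hb : ∀ ω T, ∃ M, ∀ t ∈ Icc 0 T, ‖f t ω 0‖ ≤ M) (hy₀ : Measurable y₀) (n : ℕ) :
    (∀ ω, Continuous fun t => picardIter f y₀ n t ω) ∧ ∀ t, Measurable (picardIter f y₀ n t) := by
  induction n with
  | zero => exact ⟨fun ω => continuous_const, fun t => hy₀⟩
  | succ n ih =>
    have hm : Measurable (Function.uncurry (picardIter f y₀ n)) :=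
      measurable_uncurry_of_continuous_of_measurable ih.1 ih.2
    constructor
    · intro ω
      have hc : ContinuousOn (fun t => ∫ r in (0 : ℝ)..t, f r ω (picardIter f y₀ n r ω))
          (Ici 0) := by
        intro t ht
        have h1 := intervalIntegral.continuousOn_primitive_interval (μ := volume)
          (f := fun r => f r ω (picardIter f y₀ n r ω)) (a := 0) (b := t + 1) (by
            have := intervalIntegrable_comp_of_lipschitz hf hL hb (ih.1 ω) ω le_rfl
              (add_nonneg (mem_Ici.1 ht) zero_le_one)
            rwa [uIcc_of_le (add_nonneg (mem_Ici.1 ht) zero_le_one),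
              ← intervalIntegrable_iff_integrableOn_Icc_of_le
                (add_nonneg (mem_Ici.1 ht) zero_le_one)])
        rw [uIcc_of_le (add_nonneg (mem_Ici.1 ht) zero_le_one)] at h1
        refine (h1 t ⟨ht, by linarith⟩).mono_of_mem_nhdsWithin ?_
        rw [mem_nhdsWithin]
        exact ⟨Iio (t + 1), isOpen_Iio, by simp, fun x hx => ⟨hx.2, hx.1.le⟩⟩
      refine continuous_const.add ?_
      exact hc.comp_continuous (continuous_id.max continuous_const) fun t => mem_Ici.2 (le_max_right _ _)
    · intro t
      refine hy₀.add ?_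
      have h2 : Measurable fun q : Ω × ℝ => f q.2 q.1 (picardIter f y₀ n q.2 q.1) :=
        hf.comp (measurable_snd.prodMk (measurable_fst.prodMk (hm.comp measurable_swap)))
      have h3 := (h2.stronglyMeasurable.integral_prod_right'
        (ν := volume.restrict (Ioc 0 (max t 0)))).measurable
      simpa only [intervalIntegral.integral_of_le (le_max_right t 0)] using h3

/-- Existence for Carathéodory differential equations with a measurable parameter. -/
theorem exists_caratheodory_solution [CompleteSpace F] {K : ℝ} (hK : 0 < K)
    (hf : Measurable fun q : ℝ × Ω × F => f q.1 q.2.1 q.2.2)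
    (hL : ∀ t ω x y, ‖f t ω x - f t ω y‖ ≤ K * ‖x - y‖)
    (hb : ∀ ω T, ∃ M, ∀ t ∈ Icc 0 T, ‖f t ω 0‖ ≤ M) (hy₀ : Measurable y₀) :
    ∃ Y : ℝ → Ω → F, (∀ t, Measurable (Y t)) ∧ (∀ ω, Continuous fun t => Y t ω) ∧
      ∀ ω, ∀ t, 0 ≤ t → Y t ω = y₀ ω + ∫ r in (0 : ℝ)..t, f r ω (Y r ω) := by
  have hcm := picardIter_continuous_measurable hf hL hb hy₀
  set y := picardIter f y₀
  have hmax : ∀ n t ω, y n t ω = y n (max t 0) ω := by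
    intro n t ω
    cases n with
    | zero => rfl
    | succ n => simp [y, picardIter]
  have hii : ∀ n ω {s t : ℝ}, 0 ≤ s → 0 ≤ t →
      IntervalIntegrable (fun r => f r ω (y n r ω)) volume s t := fun n ω _ _ hs ht =>
    intervalIntegrable_comp_of_lipschitz hf hL hb ((hcm n).1 ω) ω hs ht
  have hstep : ∀ ω T, ∃ A, 0 ≤ A ∧ ∀ n, ∀ t ≤ T,
      dist (y n t ω) (y (n + 1) t ω) ≤ A * (1 / 2) ^ n := by
    intro ω T
    obtain ⟨M, hM⟩ := hb ω (max T 0)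
    have hM0 : 0 ≤ M := (norm_nonneg _).trans (hM 0 ⟨le_rfl, le_max_right _ _⟩)
    set B := max T 0 * (M + K * ‖y₀ ω‖)
    have hB : 0 ≤ B := by positivity
    -- Geometric decay in the norm weighted by `exp (2 K t)`: each iteration gains the factor `K /
    -- (2 K)`. The constant `B` bounds the first increment.
    have hI : ∀ n, ∀ t ∈ Icc 0 (max T 0),
        ‖y (n + 1) t ω - y n t ω‖ ≤ B * (1 / 2) ^ n * Real.exp (2 * K * t) := by
      intro n
      induction n with
      | zero =>
        intro t ht
        have h1 : y 1 t ω - y 0 t ω = ∫ r in (0 : ℝ)..t, f r ω (y₀ ω) := by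
          simp [y, picardIter, max_eq_left ht.1]
        rw [h1]
        have h2 : ‖∫ r in (0 : ℝ)..t, f r ω (y₀ ω)‖ ≤ (M + K * ‖y₀ ω‖) * |t - 0| := by
          refine intervalIntegral.norm_integral_le_of_norm_le_const fun r hr => ?_
          rw [uIoc_of_le ht.1] at hr
          have h4 : ‖f r ω (y₀ ω)‖ ≤ ‖f r ω 0‖ + ‖f r ω (y₀ ω) - f r ω 0‖ := by
            simpa using norm_add_le (f r ω 0) (f r ω (y₀ ω) - f r ω 0)
          have h5 := hL r ω (y₀ ω) 0
          rw [sub_zero] at h5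
          linarith [hM r ⟨hr.1.le, hr.2.trans ht.2⟩]
        rw [sub_zero, abs_of_nonneg ht.1] at h2
        have h3 : (M + K * ‖y₀ ω‖) * t ≤ B := by
          rw [mul_comm]
          exact mul_le_mul_of_nonneg_right ht.2 (by positivity)
        have h6 : 1 ≤ Real.exp (2 * K * t) := Real.one_le_exp (by have := ht.1; positivity)
        simp only [pow_zero, mul_one]
        nlinarith
      | succ n ih =>
        intro t ht
        have h1 : y (n + 2) t ω - y (n + 1) t ω
            = ∫ r in (0 : ℝ)..t, (f r ω (y (n + 1) r ω) - f r ω (y n r ω)) := by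
          rw [intervalIntegral.integral_sub (hii _ ω le_rfl ht.1) (hii _ ω le_rfl ht.1)]
          simp [y, picardIter, max_eq_left ht.1]
        rw [h1]
        have h2 : ‖∫ r in (0 : ℝ)..t, (f r ω (y (n + 1) r ω) - f r ω (y n r ω))‖
            ≤ ∫ r in (0 : ℝ)..t, B * (1 / 2) ^ n * K * Real.exp (2 * K * r) := by
          refine intervalIntegral.norm_integral_le_of_norm_le ht.1
            (Eventually.of_forall fun r hr => ?_) (Continuous.intervalIntegrable (by fun_prop) _ _)
          refine (hL _ _ _ _).trans ?_
          have := mul_le_mul_of_nonneg_left (ih r ⟨hr.1.le, hr.2.trans ht.2⟩) hK.le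
          linarith
        refine h2.trans ?_
        rw [intervalIntegral.integral_const_mul, integral_exp_mul_real hK t]
        have : B * (1 / 2) ^ n * K * ((Real.exp (2 * K * t) - 1) / (2 * K))
            = B * (1 / 2) ^ (n + 1) * (Real.exp (2 * K * t) - 1) := by
          rw [pow_succ]
          field_simp
        rw [this]
        have : 0 ≤ B * (1 / 2) ^ (n + 1) := by positivity
        nlinarith
    refine ⟨B * Real.exp (2 * K * max T 0), by positivity, fun n t ht => ?_⟩
    rw [hmax n t, hmax (n + 1) t, dist_comm, dist_eq_norm]
    have hm : max t 0 ∈ Icc 0 (max T 0) := ⟨le_max_right _ _, max_le_max_right _ ht⟩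
    refine (hI n _ hm).trans ?_
    rw [mul_right_comm]
    gcongr
  have hlim : ∀ t ω, ∃ l, Tendsto (fun n => y n t ω) atTop (𝓝 l) := by
    intro t ω
    obtain ⟨A, hA, h⟩ := hstep ω t
    exact cauchySeq_tendsto_of_complete
      (cauchySeq_of_le_geometric (1 / 2) A (by norm_num) fun n => h n t le_rfl)
  choose Y hY using hlim
  have hunif : ∀ ω T, ∃ A, 0 ≤ A ∧ ∀ n, ∀ t ≤ T, dist (y n t ω) (Y t ω) ≤ A * (1 / 2) ^ n := by
    intro ω T
    obtain ⟨A, hA, h⟩ := hstep ω T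
    refine ⟨2 * A, by positivity, fun n t ht => ?_⟩
    have := dist_le_of_le_geometric_of_tendsto (1 / 2) A (by norm_num)
      (fun n => h n t ht) (hY t ω) n
    refine this.trans (le_of_eq ?_)
    ring
  have hcont : ∀ ω, Continuous fun t => Y t ω := by
    intro ω
    rw [continuous_iff_continuousAt]
    intro t
    obtain ⟨A, hA, h⟩ := hunif ω (t + 1)
    have hpow : Tendsto (fun n : ℕ => A * (1 / 2 : ℝ) ^ n) atTop (𝓝 0) := by
      simpa using (tendsto_pow_atTop_nhds_zero_of_lt_one (by norm_num : (0 : ℝ) ≤ 1 / 2)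
        (by norm_num)).const_mul A
    have hU : TendstoUniformlyOn (fun n t => y n t ω) (fun t => Y t ω) atTop (Iic (t + 1)) := by
      rw [Metric.tendstoUniformlyOn_iff]
      intro ε hε
      filter_upwards [hpow.eventually (gt_mem_nhds hε)] with n hn s hs
      rw [dist_comm]
      exact (h n s hs).trans_lt hn
    exact (hU.continuousOn (Frequently.of_forall fun n => ((hcm n).1 ω).continuousOn)).continuousAt
      (Iic_mem_nhds (by linarith))
  refine ⟨Y, fun t => ?_, hcont, fun ω t ht => ?_⟩
  · exact measurable_of_tendsto_metrizable (fun n => (hcm n).2 t)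
      (tendsto_pi_nhds.2 fun ω => hY t ω)
  · obtain ⟨A, hA, h⟩ := hunif ω t
    have h1 : Tendsto (fun n => y (n + 1) t ω) atTop (𝓝 (Y t ω)) :=
      (hY t ω).comp (tendsto_add_atTop_nat 1)
    have h2 : Tendsto (fun n => y (n + 1) t ω) atTop
        (𝓝 (y₀ ω + ∫ r in (0 : ℝ)..t, f r ω (Y r ω))) := by
      rw [tendsto_iff_norm_sub_tendsto_zero]
      have hle : ∀ n, ‖y (n + 1) t ω - (y₀ ω + ∫ r in (0 : ℝ)..t, f r ω (Y r ω))‖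
          ≤ K * (A * (1 / 2) ^ n) * |t - 0| := by
        intro n
        have h3 : y (n + 1) t ω - (y₀ ω + ∫ r in (0 : ℝ)..t, f r ω (Y r ω))
            = ∫ r in (0 : ℝ)..t, (f r ω (y n r ω) - f r ω (Y r ω)) := by
          rw [intervalIntegral.integral_sub (hii _ ω le_rfl ht)
            (intervalIntegrable_comp_of_lipschitz hf hL hb (hcont ω) ω le_rfl ht)]
          simp [y, picardIter, max_eq_left ht]
        rw [h3]
        refine intervalIntegral.norm_integral_le_of_norm_le_const fun r hr => ?_
        rw [uIoc_of_le ht] at hr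
        refine (hL _ _ _ _).trans ?_
        rw [← dist_eq_norm]
        exact mul_le_mul_of_nonneg_left (h n r hr.2) hK.le
      refine squeeze_zero (fun n => norm_nonneg _) hle ?_
      have := ((tendsto_pow_atTop_nhds_zero_of_lt_one (by norm_num : (0 : ℝ) ≤ 1 / 2)
        (by norm_num)).const_mul A).const_mul K |>.mul_const |t - 0|
      simpa using this
    exact tendsto_nhds_unique h1 h2

end Caratheodory

/-! ### The standard Gaussian measure -/

/-- The density of the standard Gaussian measure. -/
noncomputable def gaussianDensity (m : ℕ) (z : E m) : ℝ :=
  (∫ y : E m, Real.exp (-(1 / 2) * ‖y‖ ^ 2))⁻¹ * Real.exp (-(1 / 2) * ‖z‖ ^ 2)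

theorem integrable_exp_neg_mul_norm_sq {m : ℕ} {c : ℝ} (hc : 0 < c) :
    Integrable fun z : E m => Real.exp (-c * ‖z‖ ^ 2) := by
  have h := GaussianFourier.integrable_cexp_neg_mul_sq_norm_add (b := (c : ℂ)) (V := E m)
    (by simpa using hc) 0 0
  refine h.norm.congr (Eventually.of_forall fun z => ?_)
  simp only [zero_mul, add_zero, Complex.norm_exp]
  congr 1
  rw [← Complex.ofReal_neg, ← Complex.ofReal_pow, ← Complex.ofReal_mul, Complex.ofReal_re]

theorem gaussianDensity_pos {m : ℕ} (z : E m) : 0 < gaussianDensity m z := by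
  have : 0 < ∫ y : E m, Real.exp (-(1 / 2) * ‖y‖ ^ 2) := by
    rw [GaussianFourier.integral_rexp_neg_mul_sq_norm (by norm_num)]
    positivity
  unfold gaussianDensity
  positivity

theorem measurable_gaussianDensity {m : ℕ} : Measurable (gaussianDensity m) := by
  unfold gaussianDensity
  fun_prop

/-- Both measures are finite, so it suffices to compare characteristic functions, and the Fourier
integral of a Gaussian is explicit. The density is what makes translations, and thus the
Cameron–Martin formula, accessible. -/
theorem stdGaussian_eq_withDensity (m : ℕ) :
    stdGaussian (E m) = volume.withDensity fun z => ENNReal.ofReal (gaussianDensity m z) := by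
  have hint : Integrable (gaussianDensity m) :=
    (integrable_exp_neg_mul_norm_sq (by norm_num)).const_mul _
  have : IsFiniteMeasure (volume.withDensity fun z => ENNReal.ofReal (gaussianDensity m z)) :=
    isFiniteMeasure_withDensity_ofReal hint.2
  refine Measure.ext_of_charFun ?_
  ext t
  rw [charFun_stdGaussian, charFun_apply, integral_withDensity_eq_integral_toReal_smul
    measurable_gaussianDensity.ennreal_ofReal (Eventually.of_forall fun _ => ENNReal.ofReal_lt_top)]
  have h1 : ∀ z : E m, (ENNReal.ofReal (gaussianDensity m z)).toReal •
      Complex.exp (inner ℝ z t * Complex.I)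
      = ((∫ y : E m, Real.exp (-(1 / 2) * ‖y‖ ^ 2) : ℝ) : ℂ)⁻¹ *
        Complex.exp (-((1 / 2 : ℝ) : ℂ) * ‖z‖ ^ 2 + Complex.I * inner ℝ t z) := by
    intro z
    rw [ENNReal.toReal_ofReal (gaussianDensity_pos z).le, gaussianDensity, Complex.exp_add,
      Complex.real_smul, real_inner_comm]
    push_cast
    ring_nf
  simp_rw [h1]
  rw [integral_const_mul, GaussianFourier.integral_cexp_neg_mul_sq_norm_add (by norm_num)]
  have h2 := GaussianFourier.integral_cexp_neg_mul_sq_norm (b := ((1 / 2 : ℝ) : ℂ)) (V := E m)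
    (by norm_num)
  have h3 : ((∫ y : E m, Real.exp (-(1 / 2) * ‖y‖ ^ 2) : ℝ) : ℂ)
      = ∫ y : E m, Complex.exp (-((1 / 2 : ℝ) : ℂ) * ‖y‖ ^ 2) := by
    rw [← integral_complex_ofReal]
    congr 1 with y
    push_cast
    rfl
  rw [← h2, ← h3, ← mul_assoc, inv_mul_cancel₀, one_mul]
  · congr 1
    rw [Complex.I_sq]
    push_cast
    ring
  · rw [GaussianFourier.integral_rexp_neg_mul_sq_norm (by norm_num)]
    exact Complex.ofReal_ne_zero.2 (by positivity)

theorem integral_stdGaussian {m : ℕ} (f : E m → ℝ) :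
    ∫ z, f z ∂(stdGaussian (E m)) = ∫ z, gaussianDensity m z * f z := by
  rw [stdGaussian_eq_withDensity, integral_withDensity_eq_integral_toReal_smul
    measurable_gaussianDensity.ennreal_ofReal (Eventually.of_forall fun _ => ENNReal.ofReal_lt_top)]
  simp_rw [ENNReal.toReal_ofReal (gaussianDensity_pos _).le, smul_eq_mul]

theorem integrable_stdGaussian_iff {m : ℕ} (f : E m → ℝ) :
    Integrable f (stdGaussian (E m)) ↔ Integrable fun z => gaussianDensity m z * f z := by
  rw [stdGaussian_eq_withDensity, integrable_withDensity_iff_integrable_smul'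
    measurable_gaussianDensity.ennreal_ofReal (Eventually.of_forall fun _ => ENNReal.ofReal_lt_top)]
  simp_rw [ENNReal.toReal_ofReal (gaussianDensity_pos _).le, smul_eq_mul]

theorem gaussianDensity_add {m : ℕ} (z w : E m) :
    gaussianDensity m (z + w)
      = gaussianDensity m z * Real.exp (-inner ℝ w z - ‖w‖ ^ 2 / 2) := by
  rw [gaussianDensity, gaussianDensity, mul_assoc, ← Real.exp_add, norm_add_sq_real,
    real_inner_comm]
  ring_nf

/-- The Cameron–Martin formula for the standard Gaussian measure. -/
theorem integral_stdGaussian_sub {m : ℕ} (f : E m → ℝ) (w : E m) :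
    ∫ z, f (z - w) ∂(stdGaussian (E m))
      = ∫ z, f z * Real.exp (-inner ℝ w z - ‖w‖ ^ 2 / 2) ∂(stdGaussian (E m)) := by
  rw [integral_stdGaussian, integral_stdGaussian,
    ← integral_add_right_eq_self (fun z => gaussianDensity m z * f (z - w)) w]
  congr 1 with z
  rw [gaussianDensity_add, add_sub_cancel_right]
  ring

theorem integrable_stdGaussian_sub {m : ℕ} {f : E m → ℝ} {w : E m}
    (h : Integrable (fun z => f (z - w)) (stdGaussian (E m))) :
    Integrable (fun z => f z * Real.exp (-inner ℝ w z - ‖w‖ ^ 2 / 2)) (stdGaussian (E m)) := by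
  rw [integrable_stdGaussian_iff] at h ⊢
  refine (h.comp_add_right w).congr (Eventually.of_forall fun z => ?_)
  simp only [gaussianDensity_add, add_sub_cancel_right]
  ring

theorem integral_stdGaussian_neg {m : ℕ} (f : E m → ℝ) :
    ∫ z, f (-z) ∂(stdGaussian (E m)) = ∫ z, f z ∂(stdGaussian (E m)) := by
  rw [integral_stdGaussian, integral_stdGaussian,
    ← integral_neg_eq_self (fun z => gaussianDensity m z * f z)]
  simp [gaussianDensity]

theorem integrable_one_add_norm_pow_stdGaussian (m k : ℕ) :
    Integrable (fun z : E m => (1 + ‖z‖) ^ k) (stdGaussian (E m)) := by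
  have h0 : MemLp (fun z : E m => ‖z‖) k (stdGaussian (E m)) :=
    (IsGaussian.memLp_id (stdGaussian (E m)) k (by simp)).norm
  have h1 : MemLp (fun _ : E m => (1 : ℝ)) k (stdGaussian (E m)) := memLp_const 1
  have h : MemLp (fun z : E m => 1 + ‖z‖) k (stdGaussian (E m)) := h1.add h0
  rcases Nat.eq_zero_or_pos k with rfl | hk
  · simp
  · have := h.integrable_norm_rpow (by simpa using hk.ne') (by simp)
    refine this.congr (Eventually.of_forall fun z => ?_)
    simp only [ENNReal.toReal_natCast, Real.rpow_natCast]
    rw [Real.norm_of_nonneg (by positivity)]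

/-- A mean value bound with the sum of the exponentials instead of their maximum: in the Euler step
each summand gets its own estimate. -/
theorem abs_exp_sub_exp_le (a b : ℝ) :
    |Real.exp a - Real.exp b| ≤ |a - b| * (Real.exp a + Real.exp b) := by
  wlog h : b ≤ a generalizing a b
  · rw [abs_sub_comm, abs_sub_comm a, add_comm]
    exact this b a (le_of_not_ge h)
  rw [abs_of_nonneg (sub_nonneg.2 (Real.exp_le_exp.2 h)), abs_of_nonneg (sub_nonneg.2 h)]
  have h1 : 1 - (a - b) ≤ Real.exp (-(a - b)) := by linarith [Real.add_one_le_exp (-(a - b))]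
  have h2 : Real.exp b = Real.exp a * Real.exp (-(a - b)) := by
    rw [← Real.exp_add]
    congr 1
    ring
  have h3 : Real.exp a * (1 - (a - b)) ≤ Real.exp b := by
    rw [h2]
    exact mul_le_mul_of_nonneg_left h1 (Real.exp_pos a).le
  nlinarith [Real.exp_pos b]

/-! ### One Euler step of the Langevin equation -/

section EulerStep

variable {m : ℕ} {b : E m → E m} {U : E m → ℝ} {K σ R : ℝ}

/-- The quadratic Taylor bound is the form in which a Lipschitz gradient `b` of `U` is used
throughout: it contains differentiability and survives averaging. -/
theorem hasGradientAt_of_abs_sub_le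
    (hU : ∀ x y, |U y - U x - inner ℝ (b x) (y - x)| ≤ K * ‖y - x‖ ^ 2) (x : E m) :
    HasGradientAt U (b x) x := by
  rw [hasGradientAt_iff_isLittleO]
  have h : (fun y => U y - U x - inner ℝ (b x) (y - x)) =O[𝓝 x] fun y => ‖y - x‖ ^ 2 := by
    refine Asymptotics.IsBigO.of_bound |K| (Eventually.of_forall fun y => ?_)
    rw [Real.norm_eq_abs, Real.norm_of_nonneg (by positivity)]
    exact (hU x y).trans (mul_le_mul_of_nonneg_right (le_abs_self K) (by positivity))
  refine h.trans_isLittleO ?_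
  have h2 : Tendsto (fun y : E m => y - x) (𝓝 x) (𝓝 0) := by
    have : Continuous fun y : E m => y - x := by fun_prop
    simpa using this.tendsto x
  exact (Asymptotics.isLittleO_norm_pow_id one_lt_two).comp_tendsto h2

theorem continuous_of_abs_sub_le
    (hU : ∀ x y, |U y - U x - inner ℝ (b x) (y - x)| ≤ K * ‖y - x‖ ^ 2) : Continuous U :=
  continuous_iff_continuousAt.2 fun x =>
    (hasGradientAt_of_abs_sub_le hU x).hasFDerivAt.continuousAt

/-- The detailed balance identity for a symmetric proposal. -/
theorem integral_antisymm_eq_zero {r u : E m → ℝ} (hr : Continuous r) (hr0 : ∀ x, 0 ≤ r x)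
    (hrR : ∀ x, r x ≤ R) (hri : Integrable r) {ℓ : ℝ} (hu : ∀ x y, |u x - u y| ≤ ℓ * ‖x - y‖)
    (huc : Continuous u) (s : ℝ) :
    Integrable (fun q : E m × E m => (u (q.1 + s • q.2) - u q.1) * (r q.1 * r (q.1 + s • q.2)))
      (volume.prod (stdGaussian (E m))) ∧
    ∫ x, ∫ z, (u (x + s • z) - u x) * (r x * r (x + s • z)) ∂(stdGaussian (E m)) = 0 := by
  have hint : Integrable (fun q : E m × E m =>
      (u (q.1 + s • q.2) - u q.1) * (r q.1 * r (q.1 + s • q.2)))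
      (volume.prod (stdGaussian (E m))) := by
    have h1 : Integrable (fun q : E m × E m => r q.1 * ((1 + ‖q.2‖) ^ 1 * (|ℓ| * |s| * R)))
        (volume.prod (stdGaussian (E m))) :=
      hri.mul_prod ((integrable_one_add_norm_pow_stdGaussian m 1).mul_const _)
    refine h1.mono' (Continuous.aestronglyMeasurable (by fun_prop))
      (Eventually.of_forall fun q => ?_)
    rw [Real.norm_eq_abs, abs_mul, abs_of_nonneg (mul_nonneg (hr0 _) (hr0 _))]
    have h2 : |u (q.1 + s • q.2) - u q.1| ≤ |ℓ| * |s| * (1 + ‖q.2‖) := by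
      refine (hu _ _).trans ?_
      rw [add_sub_cancel_left, norm_smul, Real.norm_eq_abs, ← mul_assoc]
      have : ℓ * |s| ≤ |ℓ| * |s| := mul_le_mul_of_nonneg_right (le_abs_self _) (abs_nonneg _)
      have h0 : 0 ≤ |ℓ| * |s| := by positivity
      nlinarith [norm_nonneg q.2]
    have h3 : r q.1 * r (q.1 + s • q.2) ≤ r q.1 * R := mul_le_mul_of_nonneg_left (hrR _) (hr0 _)
    calc _ ≤ |ℓ| * |s| * (1 + ‖q.2‖) * (r q.1 * R) :=
          mul_le_mul h2 h3 (mul_nonneg (hr0 _) (hr0 _)) (by positivity)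
      _ = _ := by ring
  refine ⟨hint, ?_⟩
  rw [integral_integral_swap hint]
  -- Translating `x` by `s • z` shows that the inner integral is odd in `z`, and the Gaussian
  -- measure is symmetric.
  set A : E m → ℝ := fun z => ∫ x, (u (x + s • z) - u x) * (r x * r (x + s • z))
  have hA : ∀ z, A (-z) = -A z := by
    intro z
    simp only [A]
    rw [← integral_neg, ← integral_add_right_eq_self _ (s • z)]
    congr 1 with x
    rw [smul_neg, ← sub_eq_add_neg, add_sub_cancel_right]
    ring
  have h1 := integral_stdGaussian_neg A
  simp_rw [hA, integral_neg] at h1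
  change ∫ z, A z ∂(stdGaussian (E m)) = 0
  linarith

/-- The error of one Euler step in the invariance of the density `exp (-2 U / σ²)`. -/
theorem abs_integral_euler_step_le (hσ : 0 < σ)
    (hU : ∀ x y, |U y - U x - inner ℝ (b x) (y - x)| ≤ K * ‖y - x‖ ^ 2)
    (hbc : Continuous b) (hR : ∀ x, Real.exp (-U x / σ ^ 2) ≤ R)
    (hG : Integrable fun x => (1 + ‖b x‖) ^ 3 * Real.exp (-U x / σ ^ 2)) :
    ∃ C, 0 ≤ C ∧ ∀ κ, 0 < κ → κ ≤ 1 → ∀ (u : E m → ℝ) (ℓ : ℝ), Continuous u → 0 ≤ ℓ →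
      (∀ x y, |u x - u y| ≤ ℓ * ‖x - y‖) →
      |∫ x, (∫ z, (u (x - (σ ^ 2 * κ ^ 2) • b x + (σ ^ 2 * κ) • z) - u x) ∂(stdGaussian (E m)))
        * Real.exp (-U x / σ ^ 2) ^ 2| ≤ ℓ * (C * κ ^ 3) := by
  have hUc := continuous_of_abs_sub_le hU
  -- `r` is the square root of the Gibbs weight, so `r x * r y` is a symmetric weight to which
  -- detailed balance applies. The Euler step carries instead `r x ^ 2` times a Cameron–Martin
  -- factor; the two agree up to order `κ²`.
  set r : E m → ℝ := fun x => Real.exp (-U x / σ ^ 2) with hr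
  have hrc : Continuous r := by fun_prop
  have hr0 : ∀ x, 0 < r x := fun x => Real.exp_pos _
  have hR0 : 0 ≤ R := (hr0 0).le.trans (hR 0)
  have hri : Integrable r := by
    refine hG.mono' hrc.aestronglyMeasurable (Eventually.of_forall fun x => ?_)
    rw [Real.norm_of_nonneg (hr0 x).le]
    have : 1 ≤ (1 + ‖b x‖) ^ 3 := one_le_pow₀ (by linarith [norm_nonneg (b x)])
    have := mul_le_mul_of_nonneg_right this (hr0 x).le
    simpa using this
  set M := ∫ z : E m, (1 + ‖z‖) ^ 3 ∂(stdGaussian (E m))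
  have hM : 0 ≤ M := integral_nonneg fun z => by positivity
  set I₀ := ∫ x, (1 + ‖b x‖) ^ 3 * r x
  have hI₀ : 0 ≤ I₀ := integral_nonneg fun x => mul_nonneg (by positivity) (hr0 x).le
  set C₁ := |K| * σ ^ 2 + 1
  -- In `κ ^ 3` one power comes from the increment of `u` and two from the comparison of the
  -- weights. The factor 3 is `2 + 1`, from `hb3'` and `hb3`.
  refine ⟨σ ^ 2 * C₁ * (3 * R * M) * I₀, by positivity,
    fun κ hκ hκ1 u ℓ huc hℓ hu => ?_⟩
  obtain ⟨hJint, hJ⟩ := integral_antisymm_eq_zero hrc (fun x => (hr0 x).le) hR hri hu huc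
    (σ ^ 2 * κ)
  set g : E m → E m → ℝ := fun x z => Real.exp (-inner ℝ (κ • b x) z - ‖κ • b x‖ ^ 2 / 2)
  -- the shifted integrals
  have hshift : ∀ x, ∫ z, (u (x - (σ ^ 2 * κ ^ 2) • b x + (σ ^ 2 * κ) • z) - u x)
      ∂(stdGaussian (E m)) = ∫ z, (u (x + (σ ^ 2 * κ) • z) - u x) * g x z
        ∂(stdGaussian (E m)) := by
    intro x
    -- Since `-σ²κ² b + σ²κ z = σ²κ (z - κ b)`, the drift is a shift of the noise by `κ b`.
    rw [← integral_stdGaussian_sub (fun z => u (x + (σ ^ 2 * κ) • z) - u x) (κ • b x)]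
    congr 1 with z
    congr 2
    rw [smul_sub, smul_smul]
    rw [show σ ^ 2 * κ * κ = σ ^ 2 * κ ^ 2 by ring]
    abel
  have hulip : ∀ x z, |u (x + (σ ^ 2 * κ) • z) - u x| ≤ ℓ * (σ ^ 2 * κ) * ‖z‖ := by
    intro x z
    refine (hu _ _).trans (le_of_eq ?_)
    rw [add_sub_cancel_left, norm_smul, Real.norm_of_nonneg (by positivity)]
    ring
  have hgi : ∀ x, Integrable (fun z => (1 + ‖z + κ • b x‖) ^ 3 * g x z)
      (stdGaussian (E m)) := fun x => by
    refine integrable_stdGaussian_sub (f := fun z => (1 + ‖z + κ • b x‖) ^ 3) ?_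
    simpa using integrable_one_add_norm_pow_stdGaussian m 3
  -- Cameron–Martin backwards: a moment of `z + κ b` under the tilted measure is a plain Gaussian
  -- moment, independent of `x` and `κ`.
  have hgval : ∀ x, ∫ z, (1 + ‖z + κ • b x‖) ^ 3 * g x z ∂(stdGaussian (E m)) = M := fun x => by
    rw [← integral_stdGaussian_sub (fun z => (1 + ‖z + κ • b x‖) ^ 3)]
    simp [M]
  have hgi1 : ∀ x, Integrable (fun z => (u (x + (σ ^ 2 * κ) • z) - u x) * g x z)
      (stdGaussian (E m)) := by
    intro x
    refine (((hgi x).const_mul (ℓ * (σ ^ 2 * κ) * (1 + ‖b x‖)))).mono'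
      (Continuous.aestronglyMeasurable (by fun_prop)) (Eventually.of_forall fun z => ?_)
    rw [Real.norm_eq_abs, abs_mul, abs_of_pos (Real.exp_pos _), ← mul_assoc]
    refine mul_le_mul_of_nonneg_right ?_ (Real.exp_pos _).le
    refine (hulip x z).trans ?_
    rw [mul_assoc _ (1 + ‖b x‖)]
    refine mul_le_mul_of_nonneg_left ?_ (by positivity)
    have h1 : ‖z‖ ≤ ‖z + κ • b x‖ + ‖b x‖ := by
      have h2 : ‖z‖ ≤ ‖z + κ • b x‖ + ‖κ • b x‖ := by
        simpa using norm_sub_le (z + κ • b x) (κ • b x)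
      have h3 : ‖κ • b x‖ ≤ ‖b x‖ := by
        rw [norm_smul, Real.norm_of_nonneg hκ.le]
        exact mul_le_of_le_one_left (norm_nonneg _) hκ1
      linarith
    have h4 : 1 + ‖z + κ • b x‖ ≤ (1 + ‖z + κ • b x‖) ^ 3 :=
      le_self_pow₀ (by linarith [norm_nonneg (z + κ • b x)]) (by norm_num)
    nlinarith [norm_nonneg (b x), norm_nonneg (z + κ • b x)]
  have hJx : ∀ x, Integrable (fun z => (u (x + (σ ^ 2 * κ) • z) - u x) *
      (r x * r (x + (σ ^ 2 * κ) • z))) (stdGaussian (E m)) := by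
    intro x
    refine (((integrable_one_add_norm_pow_stdGaussian m 1).const_mul
      (ℓ * (σ ^ 2 * κ) * (R * R)))).mono'
      (Continuous.aestronglyMeasurable (by fun_prop)) (Eventually.of_forall fun z => ?_)
    rw [Real.norm_eq_abs, abs_mul, abs_of_nonneg (mul_nonneg (hr0 _).le (hr0 _).le)]
    calc _ ≤ ℓ * (σ ^ 2 * κ) * ‖z‖ * (R * R) := mul_le_mul (hulip x z)
          (mul_le_mul (hR _) (hR _) (hr0 _).le hR0) (mul_nonneg (hr0 _).le (hr0 _).le)
          (by positivity)
      _ = ℓ * (σ ^ 2 * κ) * (R * R) * ‖z‖ := by ring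
      _ ≤ _ := mul_le_mul_of_nonneg_left (by simp) (by positivity)
  -- comparison of the two weights
  have hexp : ∀ x z, |r x ^ 2 * g x z - r x * r (x + (σ ^ 2 * κ) • z)|
      ≤ κ ^ 2 * C₁ * (‖z‖ ^ 2 + ‖b x‖ ^ 2) * (r x * R * g x z + r x * R) := by
    intro x z
    set α := -(U (x + (σ ^ 2 * κ) • z) - U x) / σ ^ 2 with hα
    set β := -inner ℝ (κ • b x) z - ‖κ • b x‖ ^ 2 / 2 with hβ
    have h1 : r x * r (x + (σ ^ 2 * κ) • z) = r x ^ 2 * Real.exp α := by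
      simp only [hr, hα, sq, ← Real.exp_add]
      congr 1
      field_simp
      ring
    have h2 : |β - α| ≤ κ ^ 2 * C₁ * (‖z‖ ^ 2 + ‖b x‖ ^ 2) := by
      have h3 := hU x (x + (σ ^ 2 * κ) • z)
      rw [add_sub_cancel_left, norm_smul, Real.norm_of_nonneg (by positivity),
        real_inner_smul_right] at h3
      -- The terms linear in `κ` cancel. What is left is the Taylor error of `U` and `κ²‖b‖²/2`,
      -- both of order `κ²`.
      have h4 : β - α = (U (x + (σ ^ 2 * κ) • z) - U x - σ ^ 2 * κ * inner ℝ (b x) z) / σ ^ 2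
          - κ ^ 2 * ‖b x‖ ^ 2 / 2 := by
        rw [hα, hβ, real_inner_smul_left, norm_smul, Real.norm_of_nonneg hκ.le]
        field_simp
        ring
      rw [h4]
      refine (abs_sub _ _).trans ?_
      rw [abs_div, abs_of_pos (by positivity : 0 < σ ^ 2),
        abs_of_nonneg (by positivity : 0 ≤ κ ^ 2 * ‖b x‖ ^ 2 / 2)]
      have h5 : |U (x + (σ ^ 2 * κ) • z) - U x - σ ^ 2 * κ * inner ℝ (b x) z| / σ ^ 2
          ≤ |K| * σ ^ 2 * κ ^ 2 * ‖z‖ ^ 2 := by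
        rw [div_le_iff₀ (by positivity)]
        refine h3.trans ?_
        have := mul_le_mul_of_nonneg_right (le_abs_self K)
          (by positivity : 0 ≤ (σ ^ 2 * κ * ‖z‖) ^ 2)
        refine this.trans (le_of_eq ?_)
        ring
      have h6 : 0 ≤ |K| * σ ^ 2 * κ ^ 2 * ‖b x‖ ^ 2 := by positivity
      have h7 : 0 ≤ κ ^ 2 * ‖z‖ ^ 2 := by positivity
      have h8 : 0 ≤ κ ^ 2 * ‖b x‖ ^ 2 := by positivity
      simp only [C₁]
      linarith
    rw [h1, ← mul_sub, abs_mul, abs_of_nonneg (by positivity : 0 ≤ r x ^ 2)]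
    have h3 := abs_exp_sub_exp_le β α
    have h4 : r x ^ 2 * (Real.exp β + Real.exp α) ≤ r x * R * g x z + r x * R := by
      rw [mul_add, ← h1]
      refine add_le_add ?_ (mul_le_mul_of_nonneg_left (hR _) (hr0 x).le)
      refine mul_le_mul_of_nonneg_right ?_ (Real.exp_pos _).le
      rw [sq]
      exact mul_le_mul_of_nonneg_left (hR _) (hr0 x).le
    calc _ ≤ r x ^ 2 * (|β - α| * (Real.exp β + Real.exp α)) :=
          mul_le_mul_of_nonneg_left h3 (by positivity)
      _ = |β - α| * (r x ^ 2 * (Real.exp β + Real.exp α)) := by ring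
      _ ≤ _ := mul_le_mul h2 h4 (by positivity) (by positivity)
  have hb3 : ∀ x z : E m, ‖z‖ * (‖z‖ ^ 2 + ‖b x‖ ^ 2) ≤ (1 + ‖b x‖) ^ 3 * (1 + ‖z‖) ^ 3 := by
    intro x z
    have hz := norm_nonneg z
    have hb := norm_nonneg (b x)
    nlinarith [mul_nonneg hz hb, pow_nonneg hz 2, pow_nonneg hb 2, pow_nonneg hz 3,
      pow_nonneg hb 3, mul_nonneg (pow_nonneg hz 2) hb, mul_nonneg (pow_nonneg hb 2) hz,
      mul_nonneg (pow_nonneg hb 2) (pow_nonneg hz 2), mul_nonneg (pow_nonneg hb 3) hz,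
      mul_nonneg (pow_nonneg hb 3) (pow_nonneg hz 2), mul_nonneg (pow_nonneg hb 3) (pow_nonneg hz 3),
      mul_nonneg (pow_nonneg hb 2) (pow_nonneg hz 3), mul_nonneg hb (pow_nonneg hz 3)]
  -- The analogue of `hb3` for the tilted measure, in the variable `z + κ b` whose moment is given
  -- by `hgval`. It needs `κ ≤ 1`.
  have hb3' : ∀ x z : E m, ‖z‖ * (‖z‖ ^ 2 + ‖b x‖ ^ 2)
      ≤ 2 * ((1 + ‖b x‖) ^ 3 * (1 + ‖z + κ • b x‖) ^ 3) := by
    intro x z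
    have hz := norm_nonneg z
    have hb := norm_nonneg (b x)
    set y := ‖z + κ • b x‖
    have hy : 0 ≤ y := norm_nonneg _
    have h1 : ‖z‖ ≤ y + ‖b x‖ := by
      have h2 : ‖z‖ ≤ y + ‖κ • b x‖ := by
        simpa using norm_sub_le (z + κ • b x) (κ • b x)
      have h3 : ‖κ • b x‖ ≤ ‖b x‖ := by
        rw [norm_smul, Real.norm_of_nonneg hκ.le]
        exact mul_le_of_le_one_left (norm_nonneg _) hκ1
      linarith
    have h2 : ‖z‖ ≤ (1 + ‖b x‖) * (1 + y) := by nlinarith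
    have h3 : ‖b x‖ ≤ (1 + ‖b x‖) * (1 + y) := by nlinarith
    have h4 : ‖z‖ ^ 2 ≤ ((1 + ‖b x‖) * (1 + y)) ^ 2 := pow_le_pow_left₀ hz h2 2
    have h5 : ‖b x‖ ^ 2 ≤ ((1 + ‖b x‖) * (1 + y)) ^ 2 := pow_le_pow_left₀ hb h3 2
    calc _ ≤ ((1 + ‖b x‖) * (1 + y)) * (2 * ((1 + ‖b x‖) * (1 + y)) ^ 2) :=
          mul_le_mul h2 (by linarith) (by positivity) (by positivity)
      _ = _ := by ring
  have hbound : ∀ x, |(∫ z, (u (x + (σ ^ 2 * κ) • z) - u x) * g x z ∂(stdGaussian (E m)))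
        * r x ^ 2 - ∫ z, (u (x + (σ ^ 2 * κ) • z) - u x) * (r x * r (x + (σ ^ 2 * κ) • z))
          ∂(stdGaussian (E m))|
      ≤ ℓ * (σ ^ 2 * C₁ * (3 * R * M) * κ ^ 3) * ((1 + ‖b x‖) ^ 3 * r x) := by
    intro x
    rw [← integral_mul_const, ← integral_sub ((hgi1 x).mul_const _) (hJx x)]
    have hmaj : Integrable (fun z => ℓ * (σ ^ 2 * κ) * (κ ^ 2 * C₁) * (r x * R) * (1 + ‖b x‖) ^ 3 *
        (2 * ((1 + ‖z + κ • b x‖) ^ 3 * g x z) + (1 + ‖z‖) ^ 3)) (stdGaussian (E m)) :=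
      (((hgi x).const_mul 2).add (integrable_one_add_norm_pow_stdGaussian m 3)).const_mul _
    rw [← Real.norm_eq_abs]
    refine (norm_integral_le_of_norm_le hmaj (Eventually.of_forall fun z => ?_)).trans ?_
    · rw [Real.norm_eq_abs, show (u (x + (σ ^ 2 * κ) • z) - u x) * g x z * r x ^ 2
          - (u (x + (σ ^ 2 * κ) • z) - u x) * (r x * r (x + (σ ^ 2 * κ) • z))
          = (u (x + (σ ^ 2 * κ) • z) - u x) *
            (r x ^ 2 * g x z - r x * r (x + (σ ^ 2 * κ) • z)) by ring, abs_mul]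
      have hg0 : 0 < g x z := Real.exp_pos _
      have hrR0 : 0 ≤ r x * R := mul_nonneg (hr0 x).le hR0
      calc _ ≤ ℓ * (σ ^ 2 * κ) * ‖z‖ *
            (κ ^ 2 * C₁ * (‖z‖ ^ 2 + ‖b x‖ ^ 2) * (r x * R * g x z + r x * R)) :=
            mul_le_mul (hulip x z) (hexp x z) (abs_nonneg _) (by positivity)
        _ = ℓ * (σ ^ 2 * κ) * (κ ^ 2 * C₁) * (r x * R) *
            ((‖z‖ * (‖z‖ ^ 2 + ‖b x‖ ^ 2)) * g x z + ‖z‖ * (‖z‖ ^ 2 + ‖b x‖ ^ 2)) := by ring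
        _ ≤ ℓ * (σ ^ 2 * κ) * (κ ^ 2 * C₁) * (r x * R) *
            ((2 * ((1 + ‖b x‖) ^ 3 * (1 + ‖z + κ • b x‖) ^ 3)) * g x z
              + (1 + ‖b x‖) ^ 3 * (1 + ‖z‖) ^ 3) := by
            refine mul_le_mul_of_nonneg_left (add_le_add ?_ (hb3 x z)) (by positivity)
            exact mul_le_mul_of_nonneg_right (hb3' x z) hg0.le
        _ = _ := by ring
    · rw [integral_const_mul, integral_add ((hgi x).const_mul 2)
        (integrable_one_add_norm_pow_stdGaussian m 3), integral_const_mul, hgval]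
      refine le_of_eq ?_
      simp only [M]
      ring
  simp_rw [hshift]
  set N : E m → ℝ := fun x => ∫ z, (u (x + (σ ^ 2 * κ) • z) - u x) *
    (r x * r (x + (σ ^ 2 * κ) • z)) ∂(stdGaussian (E m))
  set L : E m → ℝ := fun x => (∫ z, (u (x + (σ ^ 2 * κ) • z) - u x) * g x z ∂(stdGaussian (E m)))
    * r x ^ 2
  have hNi : Integrable N := hJint.integral_prod_left
  have hLm : AEStronglyMeasurable L volume := by
    have h1 : StronglyMeasurable (fun q : E m × E m =>
        (u (q.1 + (σ ^ 2 * κ) • q.2) - u q.1) * g q.1 q.2) :=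
      Continuous.stronglyMeasurable (by fun_prop)
    exact (h1.integral_prod_right'.mul (hrc.pow 2).stronglyMeasurable).aestronglyMeasurable
  have hLi : Integrable L := by
    have h1 : Integrable (fun x => L x - N x) :=
      (hG.const_mul (ℓ * (σ ^ 2 * C₁ * (3 * R * M) * κ ^ 3))).mono'
        (hLm.sub hNi.aestronglyMeasurable) (Eventually.of_forall fun x => hbound x)
    exact (h1.add hNi).congr (Eventually.of_forall fun x => by simp)
  -- Detailed balance removes the symmetric part `N`, so only the difference of the weights
  -- contributes.
  have h0 : ∫ x, L x = ∫ x, (L x - N x) := by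
    rw [integral_sub hLi hNi, hJ, sub_zero]
  change |∫ x, L x| ≤ _
  rw [h0, ← Real.norm_eq_abs]
  refine (norm_integral_le_of_norm_le
    (hG.const_mul (ℓ * (σ ^ 2 * C₁ * (3 * R * M) * κ ^ 3)))
    (Eventually.of_forall fun x => hbound x)).trans (le_of_eq ?_)
  rw [integral_const_mul]
  simp only [I₀, hr]
  ring

end EulerStep

/-! ### Increments of Brownian motion -/

section Brownian

variable {m : ℕ} {Ω : Type*} [MeasurableSpace Ω] {μ : Measure Ω} [IsProbabilityMeasure μ]
  {W : ℝ≥0 → Ω → E m}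

theorem brownian_increment_law (hW : ControlProblem.IsBrownian μ W) (s : ℝ≥0) {δ : ℝ≥0}
    (hδ : 0 < δ) :
    μ.map (fun ω => (√(δ : ℝ))⁻¹ • (W (s + δ) ω - W s ω)) = stdGaussian (E m) := by
  have hm : ∀ r i, Measurable fun ω => W r ω i := fun r i =>
    (EuclideanSpace.proj (𝕜 := ℝ) i).continuous.measurable.comp (hW.measurable r)
  have hlaw : ∀ i, μ.map (fun ω => (√(δ : ℝ))⁻¹ * (W (s + δ) ω i - W s ω i))
      = gaussianReal 0 1 := by
    intro i
    have h1 := ((hW.coord i).toIsPreBrownianReal.hasLaw_sub (s + δ) s).map_eq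
    have h2 : Measurable ((fun ω => W (s + δ) ω i) - fun ω => W s ω i) := (hm _ i).sub (hm _ i)
    have h3 : (fun ω => (√(δ : ℝ))⁻¹ * (W (s + δ) ω i - W s ω i))
        = (fun x => (√(δ : ℝ))⁻¹ * x) ∘ ((fun ω => W (s + δ) ω i) - fun ω => W s ω i) := rfl
    rw [h3, ← Measure.map_map (by fun_prop) h2, h1, gaussianReal_map_const_mul, mul_zero]
    congr 1
    ext
    have h4 : ((nndist (s + δ).1 s.1 : ℝ≥0) : ℝ) = δ := by
      rw [coe_nndist, Real.dist_eq]
      have : (s + δ).1 - s.1 = (δ : ℝ) := by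
        change ((s + δ : ℝ≥0) : ℝ) - (s : ℝ) = δ
        push_cast
        ring
      rw [this, abs_of_nonneg δ.coe_nonneg]
    have hδ' : (0 : ℝ) < δ := hδ
    change ((√(δ : ℝ))⁻¹) ^ 2 * ((nndist (s + δ).1 s.1 : ℝ≥0) : ℝ) = 1
    rw [h4, inv_pow, Real.sq_sqrt hδ'.le, inv_mul_cancel₀ hδ'.ne']
  have hind : iIndepFun (fun i ω => (√(δ : ℝ))⁻¹ * (W (s + δ) ω i - W s ω i)) μ :=
    hW.indep.comp (fun _ w => (√(δ : ℝ))⁻¹ * (w (s + δ) - w s)) fun _ => by fun_prop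
  have hmm : ∀ i, Measurable fun ω => (√(δ : ℝ))⁻¹ * (W (s + δ) ω i - W s ω i) := fun i =>
    ((hm _ i).sub (hm _ i)).const_mul _
  have hpi : μ.map (fun ω i => (√(δ : ℝ))⁻¹ * (W (s + δ) ω i - W s ω i))
      = Measure.pi fun _ => gaussianReal 0 1 := by
    rw [hind.map_fun_eq_pi_map fun i => (hmm i).aemeasurable]
    congr 1
    funext i
    exact hlaw i
  rw [← map_pi_eq_stdGaussian, ← hpi, Measure.map_map (by fun_prop)
    (measurable_pi_lambda _ hmm)]
  rfl

/-- In each coordinate the increment is independent of the past, and the coordinates are independent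
of each other. All these variables are then jointly independent and can be regrouped into increments
on one side and pasts on the other. -/
theorem brownian_indep_increment_past (hW : ControlProblem.IsBrownian μ W) (s δ : ℝ≥0) :
    IndepFun (fun ω => W (s + δ) ω - W s ω) (fun ω (r : Iic s) => W r ω) μ := by
  have hm : ∀ r i, Measurable fun ω => W r ω i := fun r i =>
    (EuclideanSpace.proj (𝕜 := ℝ) i).continuous.measurable.comp (hW.measurable r)
  -- Increment and past get the same value space: the increment is stored as a constant path on `Iic
  -- s` and read off at the point `s` at the end.
  let X : Fin m → Bool → Ω → (Iic s → ℝ) := fun i j ω =>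
    cond j (fun _ => W (s + δ) ω i - W s ω i) fun r => W r ω i
  have hX : ∀ i j, Measurable (X i j) := by
    intro i j
    cases j
    · exact measurable_pi_lambda _ fun r => hm r i
    · exact measurable_pi_lambda _ fun r => (hm _ i).sub (hm _ i)
  have h1 : iIndepFun (fun i ω => (X i · ω)) μ := by
    refine hW.indep.comp (fun _ w j => cond j (fun _ : Iic s => w (s + δ) - w s) fun r : Iic s => w r)
      fun _ => measurable_pi_lambda _ fun j => ?_
    cases j
    · exact measurable_pi_lambda _ fun r => measurable_pi_apply _
    · exact measurable_pi_lambda _ fun r => (measurable_pi_apply _).sub (measurable_pi_apply _)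
  have h2 : ∀ i, iIndepFun (X i) μ := by
    intro i
    have h3 := (hW.coord i).toIsPreBrownianReal.indepFun_shift s
    have h4 : IndepFun (X i true) (X i false) μ :=
      h3.comp (φ := fun (w : ℝ≥0 → ℝ) (_ : Iic s) => w δ) (ψ := id) (by fun_prop) measurable_id
    rw [iIndepFun_iff_map_fun_eq_pi_map fun j => (hX i j).aemeasurable]
    have h5 := (indepFun_iff_map_prod_eq_prod_map_map (hX i true).aemeasurable
      (hX i false).aemeasurable).1 h4
    have : ∀ j, IsProbabilityMeasure (μ.map (X i j)) := fun j =>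
      Measure.isProbabilityMeasure_map (hX i j).aemeasurable
    refine (Measure.pi_eq fun t ht => ?_).symm
    rw [Measure.map_apply (measurable_pi_lambda _ fun j => hX i j)
      (MeasurableSet.univ_pi ht), Fintype.prod_bool,
      ← Measure.prod_prod, ← h5, Measure.map_apply ((hX i true).prodMk (hX i false))
        ((ht true).prod (ht false))]
    congr 1
    ext ω
    simp only [mem_preimage, Set.mem_pi, mem_univ, forall_const, Bool.forall_bool, mem_prod]
    exact and_comm
  have h3 := iIndepFun_uncurry' hX h1 h2
  have h4 := h3.indepFun_finset (Finset.univ.image fun i : Fin m => (i, true))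
    (Finset.univ.image fun i : Fin m => (i, false))
    (by
      rw [Finset.disjoint_left]
      simp) fun p => hX p.1 p.2
  refine h4.comp (φ := fun x => WithLp.toLp 2 fun i => x ⟨(i, true), by simp⟩ ⟨s, mem_Iic.2 le_rfl⟩)
    (ψ := fun x r => WithLp.toLp 2 fun i => x ⟨(i, false), by simp⟩ r) ?_ ?_
  · fun_prop
  · fun_prop

/-- The triple of initial value, increment and past has a product law; reordering its factors gives
the independence. -/
theorem brownian_indep_increment_past_initial (hW : ControlProblem.IsBrownian μ W) (s δ : ℝ≥0)
    {θ₀ : Ω → E m} (hθ : Measurable θ₀) (hind : IndepFun θ₀ (fun ω s => W s ω) μ) :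
    IndepFun (fun ω => W (s + δ) ω - W s ω) (fun ω => (θ₀ ω, fun r : Iic s => W r ω)) μ := by
  have hi : Measurable fun ω => W (s + δ) ω - W s ω := (hW.measurable _).sub (hW.measurable _)
  have hp : Measurable fun ω (r : Iic s) => W r ω :=
    measurable_pi_lambda _ fun r => hW.measurable _
  have h1 := brownian_indep_increment_past hW s δ
  have h2 : IndepFun θ₀ (fun ω => (W (s + δ) ω - W s ω, fun r : Iic s => W r ω)) μ :=
    hind.comp (φ := id) (ψ := fun w : ℝ≥0 → E m => (w (s + δ) - w s, fun r : Iic s => w r))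
      measurable_id (by fun_prop)
  have e1 := (indepFun_iff_map_prod_eq_prod_map_map hi.aemeasurable hp.aemeasurable).1 h1
  have e2 := (indepFun_iff_map_prod_eq_prod_map_map hθ.aemeasurable
    (hi.prodMk hp).aemeasurable).1 h2
  have e3 : μ.map (fun ω => (θ₀ ω, fun r : Iic s => W r ω))
      = (μ.map θ₀).prod (μ.map fun ω (r : Iic s) => W r ω) :=
    (indepFun_iff_map_prod_eq_prod_map_map hθ.aemeasurable hp.aemeasurable).1
      (h2.comp measurable_id measurable_snd)
  rw [indepFun_iff_map_prod_eq_prod_map_map hi.aemeasurable (hθ.prodMk hp).aemeasurable, e3]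
  have : IsProbabilityMeasure (μ.map θ₀) := Measure.isProbabilityMeasure_map hθ.aemeasurable
  have : IsProbabilityMeasure (μ.map fun ω => W (s + δ) ω - W s ω) :=
    Measure.isProbabilityMeasure_map hi.aemeasurable
  have : IsProbabilityMeasure (μ.map fun ω (r : Iic s) => W r ω) :=
    Measure.isProbabilityMeasure_map hp.aemeasurable
  have hmp : MeasurePreserving
      (fun q : E m × (E m × (Iic s → E m)) => (q.2.1, (q.1, q.2.2)))
      ((μ.map θ₀).prod ((μ.map fun ω => W (s + δ) ω - W s ω).prod
        (μ.map fun ω (r : Iic s) => W r ω)))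
      ((μ.map fun ω => W (s + δ) ω - W s ω).prod ((μ.map θ₀).prod
        (μ.map fun ω (r : Iic s) => W r ω))) :=
    (measurePreserving_prodAssoc _ _ _).comp
      ((Measure.measurePreserving_swap.prod (MeasurePreserving.id _)).comp
        (measurePreserving_prodAssoc _ _ _).symm)
  rw [← hmp.map_eq, ← e1, ← e2, Measure.map_map hmp.measurable (hθ.prodMk (hi.prodMk hp))]
  rfl

end Brownian

/-! ### The Euler scheme -/

/-- The Euler scheme with step `δ` for `dθ = -b(θ) ds + σ dW`. -/
noncomputable def eulerScheme {m : ℕ} {Ω : Type*} (b : E m → E m) (σ : ℝ) (δ : ℝ≥0)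
    (W : ℝ≥0 → Ω → E m) (θ₀ : Ω → E m) : ℕ → Ω → E m
  | 0 => θ₀
  | k + 1 => fun ω => eulerScheme b σ δ W θ₀ k ω - (δ : ℝ) • b (eulerScheme b σ δ W θ₀ k ω)
      + σ • (W (k * δ + δ) ω - W (k * δ) ω)

section Euler

variable {m : ℕ} {Ω : Type*} {b : E m → E m} {σ : ℝ} {δ : ℝ≥0} {W : ℝ≥0 → Ω → E m}
  {θ₀ : Ω → E m} {K : ℝ}

/-- The Euler scheme converges along every continuous path. -/
theorem tendsto_eulerScheme (hK : 0 ≤ K) (hb : ∀ x y, ‖b x - b y‖ ≤ K * ‖x - y‖)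
    {θ : ℝ≥0 → E m} (hθ : Continuous θ) {ω : Ω} (h0 : θ 0 = θ₀ ω)
    (heq : ∀ s : ℝ≥0, θ s = θ₀ ω - (∫ r in (0 : ℝ)..s, b (θ r.toNNReal)) + σ • W s ω)
    (s : ℝ≥0) :
    Tendsto (fun n : ℕ => eulerScheme b σ (s / (n + 1)) W θ₀ (n + 1) ω) atTop (𝓝 (θ s)) := by
  have hbc : Continuous b := by
    have : LipschitzWith K.toNNReal b := LipschitzWith.of_dist_le_mul fun x y => by
      rw [dist_eq_norm, dist_eq_norm, Real.coe_toNNReal _ hK]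
      exact hb x y
    exact this.continuous
  set f : ℝ → E m := fun r => b (θ r.toNNReal)
  have hf : Continuous f := by fun_prop
  have hu : UniformContinuousOn (fun r : ℝ => θ r.toNNReal) (Icc 0 s) :=
    isCompact_Icc.uniformContinuousOn_of_continuous (by fun_prop)
  rw [Metric.tendsto_atTop]
  intro ε hε
  -- The path varies by less than `η'` over times shorter than `η`. The tolerance is chosen so that
  -- the final error bound `K s exp (K s) η'` stays below `ε`.
  obtain ⟨η, hη, hηθ⟩ := Metric.uniformContinuousOn_iff.1 hu
    (ε / (K * s * Real.exp (K * s) + 1)) (by positivity)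
  set η' := ε / (K * s * Real.exp (K * s) + 1)
  obtain ⟨N, hN⟩ := exists_nat_gt ((s : ℝ) / η)
  refine ⟨N, fun n hn => ?_⟩
  set δ : ℝ≥0 := s / (n + 1)
  have hδ : (δ : ℝ) = s / (n + 1) := by simp [δ]
  have hδη : (δ : ℝ) < η := by
    rw [hδ, div_lt_iff₀ (by positivity)]
    rw [div_lt_iff₀ hη] at hN
    have : (N : ℝ) ≤ n := by exact_mod_cast hn
    nlinarith
  -- A discrete Grönwall argument: scheme and path share the noise, so in each step the error is
  -- multiplied by `1 + K δ` and receives `K δ η'` from the variation of the path within the step.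
  have hstep : ∀ k : ℕ, k ≤ n + 1 →
      ‖eulerScheme b σ δ W θ₀ k ω - θ (k * δ)‖ ≤ k * (K * δ * η') * (1 + K * δ) ^ k := by
    intro k
    induction k with
    | zero => intro _; simp [eulerScheme, h0]
    | succ k ih =>
      intro hk
      have ih := ih (by omega)
      set e := eulerScheme b σ δ W θ₀ k ω
      have ht : ((k : ℝ≥0) * δ + δ : ℝ≥0) = ((k + 1 : ℕ) : ℝ≥0) * δ := by push_cast; ring
      have h1 : eulerScheme b σ δ W θ₀ (k + 1) ω - θ ((k + 1 : ℕ) * δ)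
          = (e - θ (k * δ)) + ∫ r in ((k * δ : ℝ≥0) : ℝ)..((k * δ + δ : ℝ≥0) : ℝ),
              (f r - b e) := by
        rw [intervalIntegral.integral_sub (hf.intervalIntegrable _ _) (by simp),
          intervalIntegral.integral_const,
          ← intervalIntegral.integral_interval_sub_left (hf.intervalIntegrable 0 _)
            (hf.intervalIntegrable 0 _), ← ht, heq (k * δ + δ), heq (k * δ)]
        simp only [eulerScheme]
        push_cast
        rw [add_sub_cancel_left]
        module
      have hkδ : ((k * δ + δ : ℝ≥0) : ℝ) ≤ s := by
        push_cast
        rw [hδ]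
        have : (k : ℝ) + 1 ≤ n + 1 := by exact_mod_cast hk
        have hs : (0 : ℝ) ≤ s := s.2
        rw [← add_one_mul, mul_div_assoc', div_le_iff₀ (by positivity)]
        nlinarith
      have h2 : ‖∫ r in ((k * δ : ℝ≥0) : ℝ)..((k * δ + δ : ℝ≥0) : ℝ), (f r - b e)‖
          ≤ K * (η' + ‖e - θ (k * δ)‖) * |((k * δ + δ : ℝ≥0) : ℝ) - ((k * δ : ℝ≥0) : ℝ)| := by
        refine intervalIntegral.norm_integral_le_of_norm_le_const fun r hr => ?_
        rw [uIoc_of_le (by exact_mod_cast le_self_add)] at hr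
        refine (hb _ _).trans (mul_le_mul_of_nonneg_left ?_ hK)
        have h3 := hηθ r ⟨(NNReal.coe_nonneg _).trans hr.1.le, hr.2.trans hkδ⟩
          ((k * δ : ℝ≥0) : ℝ) ⟨NNReal.coe_nonneg _, le_trans (by exact_mod_cast le_self_add) hkδ⟩
          (by
            rw [Real.dist_eq, abs_of_pos (sub_pos.2 hr.1)]
            have := hr.2
            push_cast at this ⊢
            linarith)
        rw [Real.toNNReal_coe, dist_eq_norm] at h3
        calc ‖θ r.toNNReal - e‖ = ‖(θ r.toNNReal - θ (k * δ)) - (e - θ (k * δ))‖ := by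
              congr 1; abel
          _ ≤ _ := (norm_sub_le _ _).trans (by linarith)
      have h4 : |((k * δ + δ : ℝ≥0) : ℝ) - ((k * δ : ℝ≥0) : ℝ)| = δ := by
        push_cast
        rw [add_sub_cancel_left, abs_of_nonneg δ.coe_nonneg]
      rw [h4] at h2
      rw [h1]
      have hδ0 : (0 : ℝ) ≤ δ := δ.2
      have hη0 : 0 < η' := by positivity
      have hp : (1 : ℝ) ≤ (1 + K * δ) ^ (k + 1) := one_le_pow₀ (by nlinarith)
      calc _ ≤ ‖e - θ (k * δ)‖ + K * (η' + ‖e - θ (k * δ)‖) * δ :=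
            (norm_add_le _ _).trans (by linarith)
        _ = ‖e - θ (k * δ)‖ * (1 + K * δ) + K * δ * η' := by ring
        _ ≤ k * (K * δ * η') * (1 + K * δ) ^ k * (1 + K * δ)
            + (K * δ * η') * (1 + K * δ) ^ (k + 1) := by
            refine add_le_add (mul_le_mul_of_nonneg_right ih (by positivity)) ?_
            exact le_mul_of_one_le_right (by positivity) hp
        _ = _ := by push_cast; ring
  have hfin := hstep (n + 1) le_rfl
  have hns : ((n + 1 : ℕ) : ℝ≥0) * δ = s := by
    simp only [δ]
    push_cast
    field_simp
  have hns' : ((n + 1 : ℕ) : ℝ) * δ = s := by exact_mod_cast congrArg NNReal.toReal hns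
  rw [hns] at hfin
  rw [dist_eq_norm]
  refine hfin.trans_lt ?_
  have hpow : (1 + K * δ) ^ (n + 1) ≤ Real.exp (K * s) := by
    calc (1 + K * (δ : ℝ)) ^ (n + 1) ≤ (Real.exp (K * δ)) ^ (n + 1) := by
          refine pow_le_pow_left₀ (by positivity) ?_ _
          linarith [Real.add_one_le_exp (K * (δ : ℝ))]
      _ = Real.exp (K * s) := by
          rw [← Real.exp_nat_mul, ← hns']
          congr 1
          ring
  have hη0 : 0 < η' := by positivity
  calc _ = K * s * η' * (1 + K * δ) ^ (n + 1) := by rw [← hns']; ring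
    _ ≤ K * s * η' * Real.exp (K * s) := mul_le_mul_of_nonneg_left hpow (by positivity)
    _ < (K * s * Real.exp (K * s) + 1) * η' := by nlinarith
    _ = ε := by
        simp only [η']
        field_simp

variable [MeasurableSpace Ω] {μ : Measure Ω} [IsProbabilityMeasure μ]

theorem measurable_eulerScheme (hb : Continuous b) (hW : ∀ s, Measurable (W s))
    (hθ : Measurable θ₀) (k : ℕ) : Measurable (eulerScheme b σ δ W θ₀ k) := by
  induction k with
  | zero => exact hθ
  | succ k ih =>
    have hb := hb.measurable
    have h1 := hW (k * δ + δ)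
    have h2 := hW (k * δ)
    simp only [eulerScheme]
    generalize eulerScheme b σ δ W θ₀ k = e at ih
    fun_prop

/-- The `k`-th iterate is a measurable function of `θ₀` and of the noise up to time `k δ`, and the
next increment is independent of both jointly. -/
theorem indepFun_eulerScheme_increment (hb : Continuous b) (hW : ControlProblem.IsBrownian μ W)
    (hθ : Measurable θ₀) (hind : IndepFun θ₀ (fun ω s => W s ω) μ) (k : ℕ) :
    IndepFun (eulerScheme b σ δ W θ₀ k) (fun ω => W (k * δ + δ) ω - W (k * δ) ω) μ := by
  have h1 := brownian_indep_increment_past_initial hW (k * δ) δ hθ hind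
  have h2 : ∀ j ≤ k, Measurable[MeasurableSpace.comap
      (fun ω => (θ₀ ω, fun r : Iic ((k : ℝ≥0) * δ) => W r ω)) inferInstance]
      (eulerScheme b σ δ W θ₀ j) := by
    have hw : ∀ r ≤ (k : ℝ≥0) * δ, Measurable[MeasurableSpace.comap
        (fun ω => (θ₀ ω, fun r : Iic ((k : ℝ≥0) * δ) => W r ω)) inferInstance] (W r) := by
      intro r hr
      have : Measurable fun q : E m × (Iic ((k : ℝ≥0) * δ) → E m) => q.2 ⟨r, hr⟩ := by fun_prop
      exact this.comp (comap_measurable _)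
    intro j
    induction j with
    | zero => intro _; exact measurable_fst.comp (comap_measurable _)
    | succ j ih =>
      intro hj
      have ih := ih (by omega)
      have hjk : (j : ℝ≥0) * δ + δ ≤ k * δ := by
        rw [← add_one_mul]
        exact mul_le_mul_left (by exact_mod_cast hj) _
      have h3 := hw _ hjk
      have h4 := hw _ (le_self_add.trans hjk)
      have h5 := hb.measurable
      simp only [eulerScheme]
      generalize eulerScheme b σ δ W θ₀ j = e at ih
      fun_prop
  rw [IndepFun_iff_Indep] at h1 ⊢
  exact (indep_of_indep_of_le_right h1 (h2 k le_rfl).comap_le).symm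

/-- One step of the Euler scheme in law. -/
theorem integral_eulerScheme_succ (hb : Continuous b) (hW : ControlProblem.IsBrownian μ W)
    (hθ : Measurable θ₀) (hind : IndepFun θ₀ (fun ω s => W s ω) μ) (hδ : 0 < δ) (k : ℕ)
    {u : E m → ℝ} (hu : Continuous u) {B : ℝ} (huB : ∀ x, |u x| ≤ B) :
    ∫ ω, u (eulerScheme b σ δ W θ₀ (k + 1) ω) ∂μ
      = ∫ ω, (∫ z, u (eulerScheme b σ δ W θ₀ k ω - (δ : ℝ) • b (eulerScheme b σ δ W θ₀ k ω)
          + (σ * √(δ : ℝ)) • z) ∂(stdGaussian (E m))) ∂μ := by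
  set e := eulerScheme b σ δ W θ₀ k
  set ξ : Ω → E m := fun ω => (√(δ : ℝ))⁻¹ • (W (k * δ + δ) ω - W (k * δ) ω)
  have he : Measurable e := measurable_eulerScheme hb hW.measurable hθ k
  have hξ : Measurable ξ := by
    have h1 := hW.measurable (k * δ + δ)
    have h2 := hW.measurable (k * δ)
    fun_prop
  have hi : IndepFun e ξ μ := (indepFun_eulerScheme_increment hb hW hθ hind k).comp
    (φ := id) (ψ := fun x => (√(δ : ℝ))⁻¹ • x) measurable_id (by fun_prop)
  have hmap := (indepFun_iff_map_prod_eq_prod_map_map he.aemeasurable hξ.aemeasurable).1 hi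
  rw [brownian_increment_law hW (k * δ) hδ] at hmap
  have hs : √(δ : ℝ) ≠ 0 := (Real.sqrt_pos.2 hδ).ne'
  have h1 : ∀ ω, eulerScheme b σ δ W θ₀ (k + 1) ω
      = e ω - (δ : ℝ) • b (e ω) + (σ * √(δ : ℝ)) • ξ ω := by
    intro ω
    simp only [eulerScheme, ξ, smul_smul]
    rw [mul_assoc, mul_inv_cancel₀ hs, mul_one]
  simp_rw [h1]
  set g : E m × E m → ℝ := fun q => u (q.1 - (δ : ℝ) • b q.1 + (σ * √(δ : ℝ)) • q.2)
  have hg : Continuous g := by fun_prop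
  have h2 : ∫ ω, g (e ω, ξ ω) ∂μ = ∫ q, g q ∂(μ.map fun ω => (e ω, ξ ω)) :=
    (integral_map (he.prodMk hξ).aemeasurable hg.aestronglyMeasurable).symm
  have : IsProbabilityMeasure (μ.map e) := Measure.isProbabilityMeasure_map he.aemeasurable
  change ∫ ω, g (e ω, ξ ω) ∂μ = _
  rw [h2, hmap, integral_prod]
  · rw [integral_map he.aemeasurable]
    exact (hg.stronglyMeasurable.integral_prod_right').aestronglyMeasurable
  · exact Integrable.of_bound hg.aestronglyMeasurable B (Eventually.of_forall fun q => huB _)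

end Euler

/-! ### Invariance of the Gibbs measure under the Langevin dynamics -/

section Invariance

variable {m : ℕ} {Ω : Type*} [MeasurableSpace Ω] {μ : Measure Ω} [IsProbabilityMeasure μ]
  {b : E m → E m} {U : E m → ℝ} {K σ R c : ℝ} {W : ℝ≥0 → Ω → E m} {θ₀ : Ω → E m}

/-- Equal integrals make the constant sequence `P` converge weakly to `Q`, and weak limits are
unique. -/
theorem eq_of_forall_lipschitz_integral_eq {m : ℕ} {P Q : Measure (E m)} [IsProbabilityMeasure P]
    [IsProbabilityMeasure Q]
    (h : ∀ (u : E m → ℝ) (ℓ B : ℝ), 0 ≤ ℓ → Continuous u → (∀ x, |u x| ≤ B) →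
      (∀ x y, |u x - u y| ≤ ℓ * ‖x - y‖) → ∫ x, u x ∂P = ∫ x, u x ∂Q) : P = Q := by
  set P' : ProbabilityMeasure (E m) := ⟨P, inferInstance⟩
  set Q' : ProbabilityMeasure (E m) := ⟨Q, inferInstance⟩
  have h1 : Tendsto (fun _ : ℕ => P') atTop (𝓝 Q') := by
    rw [tendsto_iff_forall_lipschitz_integral_tendsto]
    rintro f ⟨C, hC⟩ ⟨L, hL⟩
    have : ∫ x, f x ∂P = ∫ x, f x ∂Q := by
      refine h f L (|f 0| + C) L.2 hL.continuous (fun x => ?_) fun x y => ?_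
      · have := hC x 0
        rw [Real.dist_eq] at this
        have h2 := abs_add_le (f 0) (f x - f 0)
        rw [add_sub_cancel] at h2
        linarith
      · rw [← Real.dist_eq, ← dist_eq_norm]
        exact hL.dist_le_mul x y
    simp only [P', Q', ProbabilityMeasure.coe_mk, this]
    exact tendsto_const_nhds
  have h2 : P' = Q' := tendsto_nhds_unique tendsto_const_nhds h1
  exact congrArg Subtype.val h2

/-- An Euler step of size `δ` changes the `π`-integral of a Lipschitz function by order `δ^{3/2}`
and increases its Lipschitz constant by a factor of at most `1 + K δ`. Over the `s / δ` steps up to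
time `s` the error is of order `√δ`, while the scheme converges to the solution along almost every
path. No Fokker–Planck equation is involved. -/
theorem map_langevin_eq (hσ : 0 < σ) (hK : 0 ≤ K) (hb : ∀ x y, ‖b x - b y‖ ≤ K * ‖x - y‖)
    (hU : ∀ x y, |U y - U x - inner ℝ (b x) (y - x)| ≤ K * ‖y - x‖ ^ 2)
    (hR : ∀ x, Real.exp (-U x / σ ^ 2) ≤ R)
    (hG : Integrable fun x => (1 + ‖b x‖) ^ 3 * Real.exp (-U x / σ ^ 2)) (hc : 0 ≤ c)
    {π : Measure (E m)} [IsProbabilityMeasure π]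
    (hπ : π = volume.withDensity fun x => ENNReal.ofReal (c * Real.exp (-U x / σ ^ 2) ^ 2))
    (hW : ControlProblem.IsBrownian μ W) (hθ : Measurable θ₀) (hlaw : μ.map θ₀ = π)
    (hind : IndepFun θ₀ (fun ω s => W s ω) μ) {θ : ℝ≥0 → Ω → E m} (hθm : ∀ s, Measurable (θ s))
    (hθc : ∀ᵐ ω ∂μ, Continuous fun s => θ s ω)
    (heq : ∀ᵐ ω ∂μ, ∀ s : ℝ≥0,
      θ s ω = θ₀ ω - (∫ r in (0 : ℝ)..s, b (θ r.toNNReal ω)) + σ • W s ω) (s : ℝ≥0) :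
    μ.map (θ s) = π := by
  have hbc : Continuous b := by
    have : LipschitzWith K.toNNReal b := LipschitzWith.of_dist_le_mul fun x y => by
      rw [dist_eq_norm, dist_eq_norm, Real.coe_toNNReal _ hK]
      exact hb x y
    exact this.continuous
  have hUc := continuous_of_abs_sub_le hU
  have hW0 : ∀ᵐ ω ∂μ, W 0 ω = 0 := by
    have h1 : ∀ᵐ ω ∂μ, ∀ i, W 0 ω i = 0 :=
      ae_all_iff.2 fun i => (hW.coord i).toIsPreBrownianReal.eval_zero_ae_eq_zero
    filter_upwards [h1] with ω hω
    ext i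
    simpa using hω i
  have h0 : ∀ᵐ ω ∂μ, θ 0 ω = θ₀ ω := by
    filter_upwards [heq, hW0] with ω h1 h2
    simpa [h2] using h1 0
  have : IsProbabilityMeasure (μ.map (θ s)) :=
    Measure.isProbabilityMeasure_map (hθm s).aemeasurable
  rcases eq_or_ne s 0 with rfl | hs
  · rw [Measure.map_congr h0, hlaw]
  have hs0 : 0 < s := pos_iff_ne_zero.2 hs
  obtain ⟨C, hC0, hC⟩ := abs_integral_euler_step_le hσ hU hbc hR hG
  -- the error of `k` steps
  have hsteps : ∀ (δ : ℝ≥0), 0 < δ → (√(δ : ℝ)) ≤ σ → ∀ (k : ℕ) (u : E m → ℝ) (ℓ B : ℝ),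
      0 ≤ ℓ → Continuous u → (∀ x, |u x| ≤ B) → (∀ x y, |u x - u y| ≤ ℓ * ‖x - y‖) →
      |∫ ω, u (eulerScheme b σ δ W θ₀ k ω) ∂μ - ∫ x, u x ∂π|
        ≤ k * (ℓ * (1 + K * δ) ^ k * (c * C * (√(δ : ℝ) / σ) ^ 3)) := by
    intro δ hδ hδσ k
    induction k with
    | zero =>
      intro u ℓ B hℓ huc huB hu
      have h1 : ∫ x, u x ∂π = ∫ ω, u (θ₀ ω) ∂μ := by
        rw [← hlaw, integral_map hθ.aemeasurable huc.aestronglyMeasurable]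
      simp [eulerScheme, h1]
    | succ k ih =>
      intro u ℓ B hℓ huc huB hu
      have hδ0 : (0 : ℝ) ≤ δ := δ.2
      -- The parameter of the one-step estimate: `σ²κ²` is the step size and `σ²κ` the amplitude of
      -- the noise. The condition `√δ ≤ σ` is `κ ≤ 1`.
      set κ := √(δ : ℝ) / σ
      have hκ : 0 < κ := div_pos (Real.sqrt_pos.2 hδ) hσ
      have hκ1 : κ ≤ 1 := (div_le_one hσ).2 hδσ
      have e1 : σ ^ 2 * κ ^ 2 = δ := by
        simp only [κ, div_pow]
        rw [Real.sq_sqrt hδ0]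
        field_simp
      have e2 : σ ^ 2 * κ = σ * √(δ : ℝ) := by
        simp only [κ]
        field_simp
      -- The transition operator applied to `u`. A step of the scheme replaces the test function by
      -- `Q`, which is why the induction ranges over all `u` and `ℓ`.
      set Q : E m → ℝ := fun x => ∫ z, u (x - (δ : ℝ) • b x + (σ * √(δ : ℝ)) • z)
        ∂(stdGaussian (E m))
      have hint : ∀ x, Integrable (fun z => u (x - (δ : ℝ) • b x + (σ * √(δ : ℝ)) • z))
          (stdGaussian (E m)) := fun x =>
        Integrable.of_bound (Continuous.aestronglyMeasurable (by fun_prop)) B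
          (Eventually.of_forall fun z => huB _)
      have hQl : ∀ x y, |Q x - Q y| ≤ (ℓ * (1 + K * δ)) * ‖x - y‖ := by
        intro x y
        simp only [Q]
        rw [← integral_sub (hint x) (hint y), ← Real.norm_eq_abs]
        refine (norm_integral_le_of_norm_le_const (Eventually.of_forall fun z => ?_)).trans
          (le_of_eq (by rw [probReal_univ, mul_one]))
        refine (hu _ _).trans ?_
        rw [mul_assoc]
        refine mul_le_mul_of_nonneg_left ?_ hℓ
        have h1 : x - (δ : ℝ) • b x + (σ * √(δ : ℝ)) • z - (y - (δ : ℝ) • b y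
            + (σ * √(δ : ℝ)) • z) = (x - y) - (δ : ℝ) • (b x - b y) := by module
        rw [h1]
        refine (norm_sub_le _ _).trans ?_
        rw [norm_smul, Real.norm_of_nonneg hδ0]
        nlinarith [hb x y]
      have hQc : Continuous Q := by
        have : LipschitzWith (ℓ * (1 + K * δ)).toNNReal Q :=
          LipschitzWith.of_dist_le_mul fun x y => by
            rw [dist_eq_norm, dist_eq_norm, Real.coe_toNNReal _ (by positivity)]
            exact hQl x y
        exact this.continuous
      have hQB : ∀ x, |Q x| ≤ B := by
        intro x
        rw [← Real.norm_eq_abs]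
        refine (norm_integral_le_of_norm_le_const (Eventually.of_forall fun z => ?_)).trans
          (le_of_eq (by rw [probReal_univ, mul_one]))
        exact huB _
      have hih := ih Q (ℓ * (1 + K * δ)) B (by positivity) hQc hQB hQl
      rw [integral_eulerScheme_succ hbc hW hθ hind hδ k huc huB]
      have hdiff : |∫ x, Q x ∂π - ∫ x, u x ∂π| ≤ c * (ℓ * (C * κ ^ 3)) := by
        have h1 := hC κ hκ hκ1 u ℓ huc hℓ hu
        rw [e1, e2] at h1
        have hQi : Integrable Q π := Integrable.of_bound hQc.aestronglyMeasurable B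
          (Eventually.of_forall hQB)
        have hui : Integrable u π := Integrable.of_bound huc.aestronglyMeasurable B
          (Eventually.of_forall huB)
        rw [← integral_sub hQi hui, hπ, integral_withDensity_eq_integral_toReal_smul
          (by fun_prop) (Eventually.of_forall fun _ => ENNReal.ofReal_lt_top)]
        have h2 : ∀ x, (ENNReal.ofReal (c * Real.exp (-U x / σ ^ 2) ^ 2)).toReal • (Q x - u x)
            = c * ((∫ z, (u (x - (δ : ℝ) • b x + (σ * √(δ : ℝ)) • z) - u x)
                ∂(stdGaussian (E m))) * Real.exp (-U x / σ ^ 2) ^ 2) := by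
          intro x
          rw [ENNReal.toReal_ofReal (by positivity), integral_sub (hint x) (integrable_const _)]
          simp only [Q, smul_eq_mul, integral_const, probReal_univ, one_mul]
          ring
        simp_rw [h2]
        rw [integral_const_mul, abs_mul, abs_of_nonneg hc]
        exact mul_le_mul_of_nonneg_left h1 hc
      have hp : (1 : ℝ) ≤ (1 + K * δ) ^ (k + 1) := one_le_pow₀ (by nlinarith)
      calc _ ≤ |∫ ω, Q (eulerScheme b σ δ W θ₀ k ω) ∂μ - ∫ x, Q x ∂π|
            + |∫ x, Q x ∂π - ∫ x, u x ∂π| := abs_sub_le _ _ _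
        _ ≤ k * (ℓ * (1 + K * δ) * (1 + K * δ) ^ k * (c * C * κ ^ 3))
            + c * (ℓ * (C * κ ^ 3)) * (1 + K * δ) ^ (k + 1) := by
            refine add_le_add hih (hdiff.trans ?_)
            exact le_mul_of_one_le_right (by positivity) hp
        _ = _ := by push_cast; ring
  refine eq_of_forall_lipschitz_integral_eq fun u ℓ B hℓ huc huB hu => ?_
  rw [integral_map (hθm s).aemeasurable huc.aestronglyMeasurable]
  -- convergence of the Euler scheme in law
  have hlim1 : Tendsto (fun n : ℕ => ∫ ω, u (eulerScheme b σ (s / (n + 1)) W θ₀ (n + 1) ω) ∂μ)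
      atTop (𝓝 (∫ ω, u (θ s ω) ∂μ)) := by
    refine tendsto_integral_of_dominated_convergence (fun _ => B)
      (fun n => (huc.measurable.comp
        (measurable_eulerScheme hbc hW.measurable hθ _)).aestronglyMeasurable)
      (integrable_const _) (fun n => Eventually.of_forall fun ω => huB _) ?_
    filter_upwards [hθc, heq, h0] with ω h1 h2 h3
    exact (huc.tendsto _).comp (tendsto_eulerScheme hK hb h1 h3 h2 s)
  have hlim2 : Tendsto (fun n : ℕ => ∫ ω, u (eulerScheme b σ (s / (n + 1)) W θ₀ (n + 1) ω) ∂μ)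
      atTop (𝓝 (∫ x, u x ∂π)) := by
    rw [tendsto_iff_norm_sub_tendsto_zero]
    have hδlim : Tendsto (fun n : ℕ => √((s / (n + 1) : ℝ≥0) : ℝ)) atTop (𝓝 0) := by
      have h1 : Tendsto (fun n : ℕ => (s : ℝ) / (n + 1)) atTop (𝓝 0) :=
        tendsto_const_div_atTop_nhds_zero_nat (s : ℝ) |>.comp (tendsto_add_atTop_nat 1) |>.congr
          fun n => by simp
      have h2 := h1.sqrt
      simpa using h2
    have hub : Tendsto (fun n : ℕ => (s : ℝ) * ℓ * Real.exp (K * s) * (c * C / σ ^ 3)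
        * √((s / (n + 1) : ℝ≥0) : ℝ)) atTop (𝓝 0) := by
      simpa using hδlim.const_mul ((s : ℝ) * ℓ * Real.exp (K * s) * (c * C / σ ^ 3))
    refine squeeze_zero' (Eventually.of_forall fun _ => norm_nonneg _) ?_ hub
    filter_upwards [hδlim.eventually (gt_mem_nhds hσ)] with n hn
    set δ : ℝ≥0 := s / (n + 1)
    have hδ : 0 < δ := div_pos hs0 (by positivity)
    have hns : ((n + 1 : ℕ) : ℝ) * δ = s := by
      simp only [δ]
      push_cast
      field_simp
    have hpow : (1 + K * δ) ^ (n + 1) ≤ Real.exp (K * s) := by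
      calc (1 + K * (δ : ℝ)) ^ (n + 1) ≤ (Real.exp (K * δ)) ^ (n + 1) := by
            refine pow_le_pow_left₀ (by positivity) ?_ _
            linarith [Real.add_one_le_exp (K * (δ : ℝ))]
        _ = Real.exp (K * s) := by
            rw [← Real.exp_nat_mul, ← hns]
            congr 1
            ring
    rw [Real.norm_eq_abs]
    refine (hsteps δ hδ hn.le (n + 1) u ℓ B hℓ huc huB hu).trans ?_
    -- One factor `δ` is used up by the `n + 1` steps of total length `s`; the remaining `√δ` tends
    -- to zero.
    have hsq : (√(δ : ℝ)) ^ 3 = δ * √(δ : ℝ) := by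
      rw [pow_succ, Real.sq_sqrt δ.coe_nonneg]
    calc _ = (((n + 1 : ℕ) : ℝ) * δ) * ℓ * (1 + K * δ) ^ (n + 1) * (c * C / σ ^ 3) * √(δ : ℝ) := by
          rw [div_pow, hsq]
          ring
      _ ≤ _ := by
          rw [hns]
          gcongr
  exact tendsto_nhds_unique hlim1 hlim2

end Invariance

/-! ### Measurability of gradients -/

/-- Difference quotients along the coordinate vectors, with step `1 / (k + 1)`, are measurable and
converge to the gradient. The indicator is there because differentiability is known only for
parameters in `s`, later the times in `[0, T]`. -/
theorem measurable_indicator_gradient {α : Type*} [MeasurableSpace α] {n : ℕ} {s : Set α}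
    (hs : MeasurableSet s) {F : α → E n → ℝ} (hF : Measurable fun q : α × E n => F q.1 q.2)
    (hd : ∀ a ∈ s, Differentiable ℝ (F a)) :
    Measurable fun q : α × E n => s.indicator (fun a => gradient (F a) q.2) q.1 := by
  set e : Fin n → E n := fun i => EuclideanSpace.single i 1
  let g : ℕ → α × E n → E n := fun k q => s.indicator (fun a => WithLp.toLp 2 fun i =>
    ((k : ℝ) + 1) * (F a (q.2 + ((k : ℝ) + 1)⁻¹ • e i) - F a q.2)) q.1
  have hg : ∀ k, Measurable (g k) := by
    intro k
    have h1 : Measurable fun q : α × E n => (WithLp.toLp 2 fun i =>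
        ((k : ℝ) + 1) * (F q.1 (q.2 + ((k : ℝ) + 1)⁻¹ • e i) - F q.1 q.2) : E n) := by
      refine (WithLp.measurable_toLp 2 _).comp (measurable_pi_lambda _ fun i => ?_)
      have h2 : Measurable fun q : α × E n => F q.1 (q.2 + ((k : ℝ) + 1)⁻¹ • e i) :=
        hF.comp (measurable_fst.prodMk (measurable_snd.add_const _))
      exact (h2.sub hF).const_mul _
    exact h1.indicator (measurable_fst hs)
  refine measurable_of_tendsto_metrizable hg (tendsto_pi_nhds.2 fun q => ?_)
  by_cases hq : q.1 ∈ s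
  · simp only [g, indicator_of_mem hq]
    have h1 : gradient (F q.1) q.2
        = WithLp.toLp 2 fun i => fderiv ℝ (F q.1) q.2 (e i) := by
      ext i
      have h2 : inner ℝ (gradient (F q.1) q.2) (e i) = fderiv ℝ (F q.1) q.2 (e i) := by
        simp [gradient]
      have h3 : ∀ y : E n, inner ℝ y (e i) = y i := fun y => by
        simp [e, EuclideanSpace.inner_single_right]
      rw [h3] at h2
      exact h2
    rw [h1]
    refine ((PiLp.continuous_toLp 2 _).tendsto _).comp (tendsto_pi_nhds.2 fun i => ?_)
    have h3 := ((hd _ hq q.2).hasFDerivAt.hasLineDerivAt (e i)).tendsto_slope_zero_right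
    have h4 : Tendsto (fun k : ℕ => ((k : ℝ) + 1)⁻¹) atTop (𝓝[>] 0) := by
      refine tendsto_nhdsWithin_iff.2 ⟨?_, Eventually.of_forall fun k => ?_⟩
      · simpa [one_div] using tendsto_one_div_add_atTop_nhds_zero_nat (𝕜 := ℝ)
      · exact mem_Ioi.2 (by positivity)
    refine (h3.comp h4).congr fun k => ?_
    simp
  · simp only [g, indicator_of_notMem hq]
    exact tendsto_const_nhds

/-! ### Stability of Carathéodory equations -/

/-- The difference of the two drifts is split at `f' (y)`: the Lipschitz bound concerns `f'` only,
the coefficients are compared along `y` only, and Grönwall's inequality closes the estimate. -/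
theorem caratheodory_stability {n : ℕ} {T K : ℝ} (hK : 0 ≤ K) {y y' : ℝ → E n}
    {f f' : ℝ → E n → E n} {c c' : E n} (hy : ContinuousOn y (Icc 0 T))
    (hy' : ContinuousOn y' (Icc 0 T))
    (hi : IntegrableOn (fun r => f r (y r)) (Icc 0 T))
    (hi' : IntegrableOn (fun r => f' r (y' r)) (Icc 0 T))
    (hi'' : IntegrableOn (fun r => f' r (y r)) (Icc 0 T))
    (hL : ∀ r ∈ Icc 0 T, ‖f' r (y r) - f' r (y' r)‖ ≤ K * ‖y r - y' r‖)
    (he : ∀ t ∈ Icc 0 T, y t = c + ∫ r in (0 : ℝ)..t, f r (y r))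
    (he' : ∀ t ∈ Icc 0 T, y' t = c' + ∫ r in (0 : ℝ)..t, f' r (y' r)) {A : ℝ}
    (hA : ‖c - c'‖ + ∫ r in Icc 0 T, ‖f r (y r) - f' r (y r)‖ ≤ A) :
    ∀ t ∈ Icc 0 T, ‖y t - y' t‖ ≤ A * Real.exp (K * t) := by
  have hii : ∀ {g : ℝ → E n}, IntegrableOn g (Icc 0 T) → ∀ t ∈ Icc 0 T,
      IntervalIntegrable g volume 0 t := fun hg t ht =>
    (intervalIntegrable_iff_integrableOn_Icc_of_le ht.1).2
      (hg.mono_set (Icc_subset_Icc_right ht.2))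
  refine le_mul_exp_of_le_add_mul_integral hK (hy.sub hy').norm fun t ht => ?_
  have h1 : y t - y' t = (c - c') + (∫ r in (0 : ℝ)..t, (f r (y r) - f' r (y r)))
      + ∫ r in (0 : ℝ)..t, (f' r (y r) - f' r (y' r)) := by
    rw [intervalIntegral.integral_sub (hii hi t ht) (hii hi'' t ht),
      intervalIntegral.integral_sub (hii hi'' t ht) (hii hi' t ht), he t ht, he' t ht]
    abel
  rw [h1]
  have h2 : ‖∫ r in (0 : ℝ)..t, (f r (y r) - f' r (y r))‖
      ≤ ∫ r in Icc 0 T, ‖f r (y r) - f' r (y r)‖ := by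
    rw [intervalIntegral.integral_of_le ht.1]
    refine (norm_integral_le_integral_norm _).trans ?_
    refine setIntegral_mono_set (hi.sub hi'').norm (Eventually.of_forall fun r => norm_nonneg _)
      (HasSubset.Subset.eventuallyLE fun r hr => ⟨hr.1.le, hr.2.trans ht.2⟩)
  have h3 : ‖∫ r in (0 : ℝ)..t, (f' r (y r) - f' r (y' r))‖
      ≤ K * ∫ r in (0 : ℝ)..t, ‖y r - y' r‖ := by
    rw [← intervalIntegral.integral_const_mul]
    refine intervalIntegral.norm_integral_le_of_norm_le ht.1
      (Eventually.of_forall fun r hr => hL r ⟨hr.1.le, hr.2.trans ht.2⟩) ?_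
    refine ContinuousOn.intervalIntegrable ?_
    rw [uIcc_of_le ht.1]
    exact (continuousOn_const.mul (hy.sub hy').norm).mono (Icc_subset_Icc_right ht.2)
  calc _ ≤ ‖c - c'‖ + ‖∫ r in (0 : ℝ)..t, (f r (y r) - f' r (y r))‖
        + ‖∫ r in (0 : ℝ)..t, (f' r (y r) - f' r (y' r))‖ := norm_add₃_le
    _ ≤ _ := by linarith

namespace RelaxedControl.ControlProblem

variable {d m : ℕ} {𝒵 : Type v} {Ω₀ : Type w} [MeasurableSpace 𝒵] [MeasurableSpace Ω₀]
  {S : ControlProblem d m 𝒵 Ω₀} {Kx Kp : Set (E d)}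

/-! ### Consequences of the standing assumptions -/

namespace Standing

variable (hS : S.Standing)
include hS

theorem contDiff_φ_x {t : ℝ} (ht : t ∈ Icc 0 S.T) (a : E m) (z : 𝒵) :
    ContDiff ℝ 1 fun x => S.φ t x a z :=
  (hS.contDiff_φ t ht z).comp (contDiff_id.prodMk contDiff_const)

theorem contDiff_φ_a {t : ℝ} (ht : t ∈ Icc 0 S.T) (x : E d) (z : 𝒵) :
    ContDiff ℝ 1 fun a => S.φ t x a z :=
  (hS.contDiff_φ t ht z).comp (contDiff_const.prodMk contDiff_id)

theorem contDiff_L_x {t : ℝ} (ht : t ∈ Icc 0 S.T) (a : E m) (z : 𝒵) :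
    ContDiff ℝ 1 fun x => S.L t x a z :=
  (hS.contDiff_L t ht z).comp (contDiff_id.prodMk contDiff_const)

theorem contDiff_L_a {t : ℝ} (ht : t ∈ Icc 0 S.T) (x : E d) (z : 𝒵) :
    ContDiff ℝ 1 fun a => S.L t x a z :=
  (hS.contDiff_L t ht z).comp (contDiff_const.prodMk contDiff_id)

theorem contDiff_H_x {t : ℝ} (ht : t ∈ Icc 0 S.T) (a : E m) (p : E d) (z : 𝒵) :
    ContDiff ℝ 1 fun x => S.H t x a p z :=
  (hS.contDiff_L_x ht a z).add (contDiff_const.inner ℝ (hS.contDiff_φ_x ht a z))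

theorem contDiff_H_a {t : ℝ} (ht : t ∈ Icc 0 S.T) (x : E d) (p : E d) (z : 𝒵) :
    ContDiff ℝ 1 fun a => S.H t x a p z :=
  (hS.contDiff_L_a ht x z).add (contDiff_const.inner ℝ (hS.contDiff_φ_a ht x z))

theorem measurable_H : Measurable fun q : ℝ × E d × E m × E d × 𝒵 =>
    S.H q.1 q.2.1 q.2.2.1 q.2.2.2.1 q.2.2.2.2 := by
  have h1 : Measurable fun q : ℝ × E d × E m × E d × 𝒵 => (q.1, q.2.1, q.2.2.1, q.2.2.2.2) := by
    fun_prop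
  have h2 := hS.measurable_L.comp h1
  have h3 := hS.measurable_φ.comp h1
  have h4 : Measurable fun q : ℝ × E d × E m × E d × 𝒵 => q.2.2.2.1 := by fun_prop
  exact h2.add (h4.inner h3)

/-- In this form the gradient is visibly affine in `p`, so bounds on `∇ₓL` and on the derivative of
`φ` yield linear growth and a Lipschitz bound in `p`. -/
theorem gradxH_eq {t : ℝ} (ht : t ∈ Icc 0 S.T) (x : E d) (a : E m) (p : E d) (z : 𝒵) :
    S.gradxH t x a p z = gradient (fun y => S.L t y a z) x
      + (fderiv ℝ (fun y => S.φ t y a z) x).adjoint p := by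
  have h1 := ((hS.contDiff_L_x ht a z).differentiable one_ne_zero x).hasGradientAt
  have h2 := ((hS.contDiff_φ_x ht a z).differentiable one_ne_zero x).hasFDerivAt
  refine HasGradientAt.gradient ?_
  rw [hasGradientAt_iff_hasFDerivAt] at h1 ⊢
  have h3 : HasFDerivAt (fun y => inner ℝ p (S.φ t y a z))
      ((innerSL ℝ p).comp (fderiv ℝ (fun y => S.φ t y a z) x)) x :=
    (innerSL ℝ p).hasFDerivAt.comp x h2
  refine (h1.add h3).congr_fderiv ?_
  ext v
  simp [ContinuousLinearMap.adjoint_inner_left, inner_add_left]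

theorem gradaH_eq {t : ℝ} (ht : t ∈ Icc 0 S.T) (x : E d) (a : E m) (p : E d) (z : 𝒵) :
    S.gradaH t x a p z = gradient (fun b => S.L t x b z) a
      + (fderiv ℝ (fun b => S.φ t x b z) a).adjoint p := by
  have h1 := ((hS.contDiff_L_a ht x z).differentiable one_ne_zero a).hasGradientAt
  have h2 := ((hS.contDiff_φ_a ht x z).differentiable one_ne_zero a).hasFDerivAt
  refine HasGradientAt.gradient ?_
  rw [hasGradientAt_iff_hasFDerivAt] at h1 ⊢
  have h3 : HasFDerivAt (fun b => inner ℝ p (S.φ t x b z))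
      ((innerSL ℝ p).comp (fderiv ℝ (fun b => S.φ t x b z) a)) a :=
    (innerSL ℝ p).hasFDerivAt.comp a h2
  refine (h1.add h3).congr_fderiv ?_
  ext v
  simp [ContinuousLinearMap.adjoint_inner_left, inner_add_left]

theorem measurable_gradxH : Measurable fun q : ℝ × E d × E m × E d × 𝒵 =>
    (Icc 0 S.T).indicator (fun t => S.gradxH t q.2.1 q.2.2.1 q.2.2.2.1 q.2.2.2.2) q.1 := by
  have h1 : Measurable fun q : (ℝ × E m × E d × 𝒵) × E d =>
      S.H q.1.1 q.2 q.1.2.1 q.1.2.2.1 q.1.2.2.2 := by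
    have : Measurable fun q : (ℝ × E m × E d × 𝒵) × E d =>
      (q.1.1, q.2, q.1.2.1, q.1.2.2.1, q.1.2.2.2) := by fun_prop
    exact hS.measurable_H.comp this
  have h2 := measurable_indicator_gradient (s := {q : ℝ × E m × E d × 𝒵 | q.1 ∈ Icc 0 S.T})
    (F := fun q x => S.H q.1 x q.2.1 q.2.2.1 q.2.2.2) (measurable_fst measurableSet_Icc) h1
    fun q hq => (hS.contDiff_H_x hq _ _ _).differentiable one_ne_zero
  have h3 : Measurable fun q : ℝ × E d × E m × E d × 𝒵 =>
    ((q.1, q.2.2.1, q.2.2.2.1, q.2.2.2.2), q.2.1) := by fun_prop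
  refine Eq.subst (motive := fun f => Measurable f) (funext fun q => ?_) (h2.comp h3)
  simp only [Function.comp, indicator, mem_ofPred_eq, gradxH]
  split_ifs <;> rfl

theorem measurable_gradaH : Measurable fun q : ℝ × E d × E m × E d × 𝒵 =>
    (Icc 0 S.T).indicator (fun t => S.gradaH t q.2.1 q.2.2.1 q.2.2.2.1 q.2.2.2.2) q.1 := by
  have h1 : Measurable fun q : (ℝ × E d × E d × 𝒵) × E m =>
      S.H q.1.1 q.1.2.1 q.2 q.1.2.2.1 q.1.2.2.2 := by
    have : Measurable fun q : (ℝ × E d × E d × 𝒵) × E m =>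
      (q.1.1, q.1.2.1, q.2, q.1.2.2.1, q.1.2.2.2) := by fun_prop
    exact hS.measurable_H.comp this
  have h2 := measurable_indicator_gradient (s := {q : ℝ × E d × E d × 𝒵 | q.1 ∈ Icc 0 S.T})
    (F := fun q a => S.H q.1 q.2.1 a q.2.2.1 q.2.2.2) (measurable_fst measurableSet_Icc) h1
    fun q hq => (hS.contDiff_H_a hq _ _ _).differentiable one_ne_zero
  have h3 : Measurable fun q : ℝ × E d × E m × E d × 𝒵 =>
    ((q.1, q.2.1, q.2.2.2.1, q.2.2.2.2), q.2.2.1) := by fun_prop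
  refine Eq.subst (motive := fun f => Measurable f) (funext fun q => ?_) (h2.comp h3)
  simp only [Function.comp, indicator, mem_ofPred_eq, gradaH]
  split_ifs <;> rfl

theorem measurable_gradG : Measurable fun q : E d × 𝒵 =>
    gradient (fun x => S.G x q.2) q.1 := by
  have h1 : Measurable fun q : 𝒵 × E d => S.G q.2 q.1 := hS.measurable_G.comp measurable_swap
  have h2 := measurable_indicator_gradient (s := (univ : Set 𝒵)) (F := fun z x => S.G x z)
    MeasurableSet.univ h1 fun z _ => (hS.contDiff_G z).differentiable one_ne_zero
  simp only [indicator_univ] at h2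
  exact h2.comp measurable_swap

end Standing

/-- The bounds that follow from the standing assumptions, with a common constant. -/
structure StandingBounds (S : ControlProblem d m 𝒵 Ω₀) (C : ℝ) : Prop where
  one_le : 1 ≤ C
  φ_le : ∀ t ∈ Icc 0 S.T, ∀ x a z, ‖S.φ t x a z‖ ≤ C
  φ_lip : ∀ t ∈ Icc 0 S.T, ∀ x x' a z, ‖S.φ t x a z - S.φ t x' a z‖ ≤ C * ‖x - x'‖
  L_lip : ∀ t ∈ Icc 0 S.T, ∀ x x' a z, |S.L t x a z - S.L t x' a z| ≤ C * ‖x - x'‖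
  G_lip : ∀ x x' z, |S.G x z - S.G x' z| ≤ C * ‖x - x'‖
  gradxH_le : ∀ t ∈ Icc 0 S.T, ∀ x a p z, ‖S.gradxH t x a p z‖ ≤ C * (1 + ‖p‖)
  gradxH_lip_p : ∀ t ∈ Icc 0 S.T, ∀ x a p p' z,
    ‖S.gradxH t x a p z - S.gradxH t x a p' z‖ ≤ C * ‖p - p'‖
  gradxG_le : ∀ x z, ‖gradient (fun y => S.G y z) x‖ ≤ C

/-- Stated for all large `C`, so that further lower bounds on the common constant can be imposed
later. -/
theorem Standing.exists_bounds (hS : S.Standing) : ∀ᶠ C in atTop, S.StandingBounds C := by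
  obtain ⟨C₁, h₁⟩ := hS.bounded_φ
  obtain ⟨C₂, h₂⟩ := hS.bounded_gradxφ
  obtain ⟨C₃, h₃⟩ := hS.bounded_gradxL
  obtain ⟨C₄, h₄⟩ := hS.bounded_gradxG
  filter_upwards [eventually_ge_atTop 1, eventually_ge_atTop C₁, eventually_ge_atTop C₂,
    eventually_ge_atTop C₃, eventually_ge_atTop C₄] with C hC hC₁ hC₂ hC₃ hC₄
  have hgrad : ∀ (f : E d → ℝ) x, ‖fderiv ℝ f x‖ = ‖gradient f x‖ := fun f x => by
    simp [gradient]
  refine ⟨hC, fun t ht x a z => (h₁ t ht x a z).trans hC₁, fun t ht x x' a z => ?_,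
    fun t ht x x' a z => ?_, fun x x' z => ?_, fun t ht x a p z => ?_, fun t ht x a p p' z => ?_,
    fun x z => (h₄ x z).trans hC₄⟩
  · exact convex_univ.norm_image_sub_le_of_norm_fderiv_le
      (fun y _ => (hS.contDiff_φ_x ht a z).differentiable one_ne_zero y)
      (fun y _ => (h₂ t ht y a z).trans hC₂) (mem_univ _) (mem_univ _)
  · exact convex_univ.norm_image_sub_le_of_norm_fderiv_le
      (fun y _ => (hS.contDiff_L_x ht a z).differentiable one_ne_zero y)
      (fun y _ => (hgrad _ _).le.trans ((h₃ t ht y a z).trans hC₃)) (mem_univ _) (mem_univ _)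
  · exact convex_univ.norm_image_sub_le_of_norm_fderiv_le (f := fun y => S.G y z)
      (fun y _ => (hS.contDiff_G z).differentiable one_ne_zero y)
      (fun y _ => (hgrad _ _).le.trans ((h₄ y z).trans hC₄)) (mem_univ _) (mem_univ _)
  · rw [hS.gradxH_eq ht, mul_add, mul_one]
    refine (norm_add_le _ _).trans (add_le_add ((h₃ t ht x a z).trans hC₃) ?_)
    refine (ContinuousLinearMap.le_opNorm _ _).trans ?_
    rw [LinearIsometryEquiv.norm_map]
    exact mul_le_mul_of_nonneg_right ((h₂ t ht x a z).trans hC₂) (norm_nonneg _)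
  · rw [hS.gradxH_eq ht, hS.gradxH_eq ht, add_sub_add_left_eq_sub, ← map_sub]
    refine (ContinuousLinearMap.le_opNorm _ _).trans ?_
    rw [LinearIsometryEquiv.norm_map]
    exact mul_le_mul_of_nonneg_right ((h₂ t ht x a z).trans hC₂) (norm_nonneg _)

/-! ### The forward and adjoint drifts -/

/-- The drift `∫ φ(t, x, a, z) ν_t(da)` of the forward equation. -/
noncomputable def fdrift (S : ControlProblem d m 𝒵 Ω₀) (ν : Kernel ℝ (E m)) (t : ℝ) (x : E d) (z : 𝒵) : E d :=
  ∫ a, S.φ t x a z ∂(ν t)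

/-- The drift `∫ ∇ₓH(t, x, a, p, z) ν_t(da)` of the adjoint equation. -/
noncomputable def bdrift (S : ControlProblem d m 𝒵 Ω₀) (ν : Kernel ℝ (E m)) (t : ℝ) (x p : E d) (z : 𝒵) :
    E d :=
  ∫ a, S.gradxH t x a p z ∂(ν t)

section Drift

variable (hS : S.Standing) {C : ℝ} (hC : S.StandingBounds C) (ν : Kernel ℝ (E m))
  [IsMarkovKernel ν]
include hS

theorem Standing.measurable_φ_a (t : ℝ) (x : E d) (z : 𝒵) : Measurable fun a => S.φ t x a z :=
  hS.measurable_φ.comp (measurable_const.prodMk (measurable_const.prodMk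
    (measurable_id.prodMk measurable_const)))

theorem Standing.measurable_gradxH_a {t : ℝ} (ht : t ∈ Icc 0 S.T) (x p : E d) (z : 𝒵) :
    Measurable fun a => S.gradxH t x a p z := by
  have h : Measurable fun a : E m => (t, x, a, p, z) := by fun_prop
  refine Eq.subst (motive := fun f => Measurable f) (funext fun a => ?_) (hS.measurable_gradxH.comp h)
  simp [indicator_of_mem ht]

theorem Standing.measurable_fdrift :
    Measurable fun q : ℝ × E d × 𝒵 => S.fdrift ν q.1 q.2.1 q.2.2 := by
  have h : Measurable fun q : (ℝ × E d × 𝒵) × E m => S.φ q.1.1 q.1.2.1 q.2 q.1.2.2 := by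
    have : Measurable fun q : (ℝ × E d × 𝒵) × E m => (q.1.1, q.1.2.1, q.2, q.1.2.2) := by
      fun_prop
    exact hS.measurable_φ.comp this
  exact (h.stronglyMeasurable.integral_kernel_prod_right'
    (κ := ν.comap (fun q : ℝ × E d × 𝒵 => q.1) measurable_fst)).measurable

theorem Standing.measurable_bdrift :
    Measurable fun q : ℝ × E d × E d × 𝒵 =>
      (Icc 0 S.T).indicator (fun t => S.bdrift ν t q.2.1 q.2.2.1 q.2.2.2) q.1 := by
  have h : Measurable fun q : (ℝ × E d × E d × 𝒵) × E m =>
      (Icc 0 S.T).indicator (fun t => S.gradxH t q.1.2.1 q.2 q.1.2.2.1 q.1.2.2.2) q.1.1 := by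
    have : Measurable fun q : (ℝ × E d × E d × 𝒵) × E m =>
        (q.1.1, q.1.2.1, q.2, q.1.2.2.1, q.1.2.2.2) := by fun_prop
    exact hS.measurable_gradxH.comp this
  refine Eq.subst (motive := fun f => Measurable f) (funext fun q => ?_)
    (h.stronglyMeasurable.integral_kernel_prod_right'
      (κ := ν.comap (fun q : ℝ × E d × E d × 𝒵 => q.1) measurable_fst)).measurable
  by_cases hq : q.1 ∈ Icc 0 S.T
  · simp [indicator_of_mem hq, bdrift]
  · simp [indicator_of_notMem hq]

include hC

theorem StandingBounds.integrable_φ {t : ℝ} (ht : t ∈ Icc 0 S.T) (x : E d) (z : 𝒵)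
    (μ : Measure (E m)) [IsFiniteMeasure μ] : Integrable (fun a => S.φ t x a z) μ :=
  Integrable.of_bound (hS.measurable_φ_a t x z).aestronglyMeasurable C
    (Eventually.of_forall fun a => hC.φ_le t ht x a z)

theorem StandingBounds.integrable_gradxH {t : ℝ} (ht : t ∈ Icc 0 S.T) (x p : E d) (z : 𝒵)
    (μ : Measure (E m)) [IsFiniteMeasure μ] : Integrable (fun a => S.gradxH t x a p z) μ :=
  Integrable.of_bound (hS.measurable_gradxH_a ht x p z).aestronglyMeasurable (C * (1 + ‖p‖))
    (Eventually.of_forall fun a => hC.gradxH_le t ht x a p z)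

omit hS in
theorem StandingBounds.norm_fdrift_le {t : ℝ} (ht : t ∈ Icc 0 S.T) (x : E d) (z : 𝒵) :
    ‖S.fdrift ν t x z‖ ≤ C :=
  (norm_integral_le_of_norm_le_const (Eventually.of_forall fun a => hC.φ_le t ht x a z)).trans
    (by simp)

omit hS in
theorem StandingBounds.norm_bdrift_le {t : ℝ} (ht : t ∈ Icc 0 S.T) (x p : E d) (z : 𝒵) :
    ‖S.bdrift ν t x p z‖ ≤ C * (1 + ‖p‖) :=
  (norm_integral_le_of_norm_le_const
    (Eventually.of_forall fun a => hC.gradxH_le t ht x a p z)).trans (by simp)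

theorem StandingBounds.fdrift_lip {t : ℝ} (ht : t ∈ Icc 0 S.T) (x x' : E d) (z : 𝒵) :
    ‖S.fdrift ν t x z - S.fdrift ν t x' z‖ ≤ C * ‖x - x'‖ := by
  rw [fdrift, fdrift, ← integral_sub (hC.integrable_φ hS ht x z _) (hC.integrable_φ hS ht x' z _)]
  exact (norm_integral_le_of_norm_le_const
    (Eventually.of_forall fun a => hC.φ_lip t ht x x' a z)).trans (by simp)

theorem StandingBounds.bdrift_lip {t : ℝ} (ht : t ∈ Icc 0 S.T) (x p p' : E d) (z : 𝒵) :
    ‖S.bdrift ν t x p z - S.bdrift ν t x p' z‖ ≤ C * ‖p - p'‖ := by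
  rw [bdrift, bdrift, ← integral_sub (hC.integrable_gradxH hS ht x p z _)
    (hC.integrable_gradxH hS ht x p' z _)]
  exact (norm_integral_le_of_norm_le_const
    (Eventually.of_forall fun a => hC.gradxH_lip_p t ht x a p p' z)).trans (by simp)

theorem StandingBounds.integrableOn_fdrift {x : ℝ → E d} (hx : ContinuousOn x (Icc 0 S.T))
    (z : 𝒵) : IntegrableOn (fun r => S.fdrift ν r (x r) z) (Icc 0 S.T) := by
  refine Integrable.of_bound (C := C) ?_
    ((ae_restrict_iff' measurableSet_Icc).2
      (Eventually.of_forall fun r hr => hC.norm_fdrift_le ν hr _ _))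
  have h1 : AEMeasurable x (volume.restrict (Icc 0 S.T)) := hx.aemeasurable measurableSet_Icc
  exact ((hS.measurable_fdrift ν).comp_aemeasurable
    (aemeasurable_id.prodMk (h1.prodMk aemeasurable_const))).aestronglyMeasurable

theorem StandingBounds.integrableOn_bdrift {x p : ℝ → E d} (hx : ContinuousOn x (Icc 0 S.T))
    (hp : ContinuousOn p (Icc 0 S.T)) (z : 𝒵) :
    IntegrableOn (fun r => S.bdrift ν r (x r) (p r) z) (Icc 0 S.T) := by
  obtain ⟨M, hM⟩ := isCompact_Icc.exists_bound_of_continuousOn hp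
  have hC0 : 0 ≤ C := zero_le_one.trans hC.one_le
  refine Integrable.of_bound (C := C * (1 + M)) ?_
    ((ae_restrict_iff' measurableSet_Icc).2 (Eventually.of_forall fun r hr =>
      (hC.norm_bdrift_le ν hr _ _ _).trans
        (mul_le_mul_of_nonneg_left (by linarith [hM r hr]) hC0)))
  have h1 : AEMeasurable x (volume.restrict (Icc 0 S.T)) := hx.aemeasurable measurableSet_Icc
  have h2 : AEMeasurable p (volume.restrict (Icc 0 S.T)) := hp.aemeasurable measurableSet_Icc
  have h3 := (hS.measurable_bdrift ν).comp_aemeasurable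
    (aemeasurable_id.prodMk (h1.prodMk (h2.prodMk (aemeasurable_const (b := z)))))
  refine (h3.congr ?_).aestronglyMeasurable
  refine (ae_restrict_iff' measurableSet_Icc).2 (Eventually.of_forall fun r hr => ?_)
  simp only [Function.comp, id]
  rw [indicator_of_mem hr]

/-! ### Existence and stability of the forward and adjoint processes -/

/-- The sample space is arbitrary so that its σ-algebra can be taken to be `σ(Z)`; the measurability
of the solution is then exactly the one that `IsState` and `IsAdjoint` ask for. -/
theorem StandingBounds.exists_processes {Ω₁ : Type*} [MeasurableSpace Ω₁] {Z : Ω₁ → 𝒵}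
    (hZ : Measurable Z) {X₀ : Ω₁ → E d} (hX₀ : Measurable X₀) :
    ∃ X P : ℝ → Ω₁ → E d, (∀ t, Measurable (X t)) ∧ (∀ ω, Continuous fun t => X t ω) ∧
      (∀ ω, ∀ t ∈ Icc 0 S.T, X t ω = X₀ ω + ∫ r in (0 : ℝ)..t, S.fdrift ν r (X r ω) (Z ω)) ∧
      (∀ t, Measurable (P t)) ∧ (∀ ω, Continuous fun t => P t ω) ∧
      (∀ ω, ∀ t ∈ Icc 0 S.T, P t ω = gradient (fun x => S.G x (Z ω)) (X S.T ω)
        + ∫ r in t..S.T, S.bdrift ν r (X r ω) (P r ω) (Z ω)) := by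
  have hC0 : 0 < C := zero_lt_one.trans_le hC.one_le
  -- The drift is set to zero outside `[0, T]`, where nothing is assumed about the coefficients.
  obtain ⟨X, hXm, hXc, hXe⟩ := exists_caratheodory_solution (Ω := Ω₁) (F := E d) (y₀ := X₀)
    (f := fun t ω x => (Icc 0 S.T).indicator (fun t => S.fdrift ν t x (Z ω)) t) hC0 (by
      have h : Measurable fun q : ℝ × Ω₁ × E d => (q.1, q.2.2, Z q.2.1) := by fun_prop
      exact (((hS.measurable_fdrift ν).comp h).indicator (measurable_fst measurableSet_Icc)))
    (fun t ω x y => by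
      by_cases ht : t ∈ Icc 0 S.T
      · simpa only [indicator_of_mem ht] using hC.fdrift_lip hS ν ht x y (Z ω)
      · simp only [indicator_of_notMem ht, sub_self, norm_zero]
        positivity)
    (fun ω T => ⟨C, fun t _ => by
      by_cases ht : t ∈ Icc 0 S.T
      · simpa only [indicator_of_mem ht] using hC.norm_fdrift_le ν ht 0 (Z ω)
      · simp only [indicator_of_notMem ht, norm_zero]
        exact hC0.le⟩) hX₀
  have hXu : Measurable (Function.uncurry X) :=
    measurable_uncurry_of_continuous_of_measurable hXc hXm
  have hsub : ∀ t, t ∈ Icc 0 S.T → S.T - t ∈ Icc 0 S.T := fun t ht =>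
    ⟨sub_nonneg.2 ht.2, sub_le_self _ ht.1⟩
  have hsub' : ∀ t, t ∉ Icc 0 S.T → S.T - t ∉ Icc 0 S.T := fun t ht h =>
    ht (by simpa using hsub _ h)
  -- In the reversed time `S.T - t` the adjoint equation is a forward equation. Its coefficient
  -- contains `X`, whence the need for joint measurability.
  obtain ⟨Y, hYm, hYc, hYe⟩ := exists_caratheodory_solution (Ω := Ω₁) (F := E d)
    (y₀ := fun ω => gradient (fun x => S.G x (Z ω)) (X S.T ω))
    (f := fun t ω p => (Icc 0 S.T).indicator
      (fun t => S.bdrift ν t (X t ω) p (Z ω)) (S.T - t)) hC0 (by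
      have h : Measurable fun q : ℝ × Ω₁ × E d =>
          (S.T - q.1, Function.uncurry X (S.T - q.1, q.2.1), q.2.2, Z q.2.1) := by fun_prop
      exact (hS.measurable_bdrift ν).comp h)
    (fun t ω x y => by
      by_cases ht : S.T - t ∈ Icc 0 S.T
      · simpa only [indicator_of_mem ht] using hC.bdrift_lip hS ν ht _ x y (Z ω)
      · simp only [indicator_of_notMem ht, sub_self, norm_zero]
        positivity)
    (fun ω T => ⟨C, fun t _ => by
      by_cases ht : S.T - t ∈ Icc 0 S.T
      · simpa only [indicator_of_mem ht, norm_zero, add_zero, mul_one] using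
          hC.norm_bdrift_le ν ht (X (S.T - t) ω) 0 (Z ω)
      · simp only [indicator_of_notMem ht, norm_zero]
        exact hC0.le⟩) (by
      have h : Measurable fun ω => (X S.T ω, Z ω) := (hXm _).prodMk hZ
      exact hS.measurable_gradG.comp h)
  refine ⟨X, fun t ω => Y (S.T - t) ω, hXm, hXc, fun ω t ht => ?_, fun t => hYm _,
    fun ω => (hYc ω).comp (continuous_const.sub continuous_id), fun ω t ht => ?_⟩
  · rw [hXe ω t ht.1]
    congr 1
    refine intervalIntegral.integral_congr fun r hr => ?_
    rw [uIcc_of_le ht.1] at hr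
    exact indicator_of_mem (show r ∈ Icc 0 S.T from ⟨hr.1, hr.2.trans ht.2⟩) _
  · change Y (S.T - t) ω = _
    rw [hYe ω _ (hsub t ht).1]
    congr 1
    have h1 := intervalIntegral.integral_comp_sub_left (a := t) (b := S.T)
      (fun r => (Icc 0 S.T).indicator (fun t => S.bdrift ν t (X t ω) (Y r ω) (Z ω)) (S.T - r)) S.T
    rw [sub_self] at h1
    rw [← h1]
    refine intervalIntegral.integral_congr fun r hr => ?_
    rw [uIcc_of_le ht.2] at hr
    simp only [sub_sub_cancel]
    exact indicator_of_mem (show r ∈ Icc 0 S.T from ⟨ht.1.trans hr.1, hr.2⟩) _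

theorem StandingBounds.exists_isState_isAdjoint :
    ∃ X P : ℝ → Ω₀ → E d, S.IsState ν X ∧ S.IsAdjoint ν X P := by
  obtain ⟨X, P, h1, h2, h3, h4, h5, h6⟩ := @StandingBounds.exists_processes d m 𝒵 Ω₀ _ _ S hS C hC
    ν _ Ω₀ S.𝒢 S.Z (comap_measurable _) S.X₀ hS.measurable_X₀
  exact ⟨X, P, ⟨fun t _ => h1 t, fun ω => (h2 ω).continuousOn, h3⟩,
    ⟨fun t _ => h4 t, fun ω => (h5 ω).continuousOn, h6⟩⟩

/-- Dependence of the forward process on the control. -/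
theorem StandingBounds.norm_state_sub_le (ν' : Kernel ℝ (E m)) [IsMarkovKernel ν']
    {X X' : ℝ → Ω₀ → E d} (hX : S.IsState ν X) (hX' : S.IsState ν' X') (ω : Ω₀) {A : ℝ}
    (hA : ∫ r in Icc 0 S.T, ‖S.fdrift ν r (X r ω) (S.Z ω) - S.fdrift ν' r (X r ω) (S.Z ω)‖ ≤ A) :
    ∀ t ∈ Icc 0 S.T, ‖X t ω - X' t ω‖ ≤ A * Real.exp (C * S.T) := by
  intro t ht
  have hC0 : 0 ≤ C := zero_le_one.trans hC.one_le
  refine (caratheodory_stability hC0 (f := fun r x => S.fdrift ν r x (S.Z ω))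
    (f' := fun r x => S.fdrift ν' r x (S.Z ω)) (hX.continuousOn ω) (hX'.continuousOn ω)
    (hC.integrableOn_fdrift hS ν (hX.continuousOn ω) _)
    (hC.integrableOn_fdrift hS ν' (hX'.continuousOn ω) _)
    (hC.integrableOn_fdrift hS ν' (hX.continuousOn ω) _)
    (fun r hr => hC.fdrift_lip hS ν' hr _ _ _) (hX.eq ω) (hX'.eq ω)
    (A := A) (by simpa using hA) t ht).trans ?_
  refine mul_le_mul_of_nonneg_left (Real.exp_le_exp.2 (mul_le_mul_of_nonneg_left ht.2 hC0)) ?_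
  exact (integral_nonneg fun r => norm_nonneg _).trans hA

/-- Dependence of the adjoint process on the control. -/
theorem StandingBounds.norm_adjoint_sub_le (ν' : Kernel ℝ (E m)) [IsMarkovKernel ν']
    {X X' P P' : ℝ → Ω₀ → E d} (hX : S.IsState ν X) (hX' : S.IsState ν' X')
    (hP : S.IsAdjoint ν X P) (hP' : S.IsAdjoint ν' X' P') (ω : Ω₀) {A : ℝ}
    (hA : ‖gradient (fun x => S.G x (S.Z ω)) (X S.T ω)
        - gradient (fun x => S.G x (S.Z ω)) (X' S.T ω)‖
      + ∫ r in Icc 0 S.T, ‖S.bdrift ν r (X r ω) (P r ω) (S.Z ω)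
        - S.bdrift ν' r (X' r ω) (P r ω) (S.Z ω)‖ ≤ A) :
    ∀ t ∈ Icc 0 S.T, ‖P t ω - P' t ω‖ ≤ A * Real.exp (C * S.T) := by
  intro t ht
  have hC0 : 0 ≤ C := zero_le_one.trans hC.one_le
  -- Time reversal preserves Lebesgue measure on `[0, T]` and turns the adjoint equations into
  -- forward ones, for which stability is already known.
  have hmaps : MapsTo (fun t => S.T - t) (Icc 0 S.T) (Icc 0 S.T) := fun t ht =>
    ⟨sub_nonneg.2 ht.2, sub_le_self _ ht.1⟩
  have hcr : ∀ {g : ℝ → E d}, ContinuousOn g (Icc 0 S.T) →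
      ContinuousOn (fun t => g (S.T - t)) (Icc 0 S.T) := fun hg =>
    hg.comp (continuousOn_const.sub continuousOn_id) hmaps
  have hmp : MeasurePreserving (fun r => S.T - r) (volume.restrict (Icc 0 S.T))
      (volume.restrict (Icc 0 S.T)) := by
    have h := (Measure.measurePreserving_sub_left (volume : Measure ℝ) S.T).restrict_preimage
      (measurableSet_Icc (a := 0) (b := S.T))
    simpa using h
  have hme : MeasurableEmbedding fun r : ℝ => S.T - r :=
    (MeasurableEquiv.subLeft S.T).measurableEmbedding
  have hir : ∀ {g : ℝ → E d}, IntegrableOn g (Icc 0 S.T) →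
      IntegrableOn (fun t => g (S.T - t)) (Icc 0 S.T) := fun hg =>
    (hmp.integrable_comp_emb hme).2 hg
  have heq : ∀ {ν : Kernel ℝ (E m)} {X P : ℝ → Ω₀ → E d}, S.IsAdjoint ν X P →
      ∀ t ∈ Icc 0 S.T, P (S.T - t) ω = gradient (fun x => S.G x (S.Z ω)) (X S.T ω)
        + ∫ r in (0 : ℝ)..t, S.bdrift ν (S.T - r) (X (S.T - r) ω) (P (S.T - r) ω) (S.Z ω) := by
    intro ν X P hP t ht
    rw [hP.eq ω _ (hmaps ht)]
    have h1 := intervalIntegral.integral_comp_sub_left (a := 0) (b := t)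
      (fun r => S.bdrift ν r (X r ω) (P r ω) (S.Z ω)) S.T
    rw [sub_zero] at h1
    rw [h1]
    rfl
  have h := caratheodory_stability hC0 (y := fun t => P (S.T - t) ω)
    (y' := fun t => P' (S.T - t) ω)
    (f := fun r p => S.bdrift ν (S.T - r) (X (S.T - r) ω) p (S.Z ω))
    (f' := fun r p => S.bdrift ν' (S.T - r) (X' (S.T - r) ω) p (S.Z ω))
    (hcr (hP.continuousOn ω)) (hcr (hP'.continuousOn ω))
    (hir (hC.integrableOn_bdrift hS ν (hX.continuousOn ω) (hP.continuousOn ω) _))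
    (hir (hC.integrableOn_bdrift hS ν' (hX'.continuousOn ω) (hP'.continuousOn ω) _))
    (hir (hC.integrableOn_bdrift hS ν' (hX'.continuousOn ω) (hP.continuousOn ω) _))
    (fun r hr => hC.bdrift_lip hS ν' (hmaps hr) _ _ _ _) (heq hP) (heq hP') (A := A) (by
      have h1 := hmp.integral_comp hme (fun r => ‖S.bdrift ν r (X r ω) (P r ω) (S.Z ω)
        - S.bdrift ν' r (X' r ω) (P r ω) (S.Z ω)‖)
      rw [← h1] at hA
      exact hA) (S.T - t) (hmaps ht)
  simp only [sub_sub_cancel] at h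
  refine h.trans ?_
  refine mul_le_mul_of_nonneg_left
    (Real.exp_le_exp.2 (mul_le_mul_of_nonneg_left (hmaps ht).2 hC0)) ?_
  exact (add_nonneg (norm_nonneg _) (integral_nonneg fun r => norm_nonneg _)).trans hA

/-- The stability estimate for two equal controls, where its source term vanishes. -/
theorem StandingBounds.state_unique {X X' : ℝ → Ω₀ → E d} (hX : S.IsState ν X)
    (hX' : S.IsState ν X') : ∀ t ∈ Icc 0 S.T, ∀ ω, X t ω = X' t ω := by
  intro t ht ω
  have := hC.norm_state_sub_le hS ν ν hX hX' ω (A := 0) (by simp) t ht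
  rw [zero_mul] at this
  exact sub_eq_zero.1 (norm_le_zero_iff.1 this)

theorem StandingBounds.adjoint_unique {X X' P P' : ℝ → Ω₀ → E d} (hX : S.IsState ν X)
    (hX' : S.IsState ν X') (hP : S.IsAdjoint ν X P) (hP' : S.IsAdjoint ν X' P') :
    ∀ t ∈ Icc 0 S.T, ∀ ω, P t ω = P' t ω := by
  intro t ht ω
  have hXX := hC.state_unique hS ν hX hX'
  have hT : S.T ∈ Icc 0 S.T := ⟨hS.T_pos.le, le_rfl⟩
  have := hC.norm_adjoint_sub_le hS ν ν hX hX' hP hP' ω (A := 0) (by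
    rw [hXX _ hT, sub_self, norm_zero, zero_add]
    refine (setIntegral_eq_zero_of_forall_eq_zero fun r hr => ?_).le
    rw [hXX r hr, sub_self, norm_zero]) t ht
  rw [zero_mul] at this
  exact sub_eq_zero.1 (norm_le_zero_iff.1 this)

end Drift

end RelaxedControl.ControlProblem

/-! ### Functions with Lipschitz gradient -/

/-- The mean value inequality for `f` minus its linear part at `x`, on the ball of radius `‖y - x‖`,
where the gradient of this difference is at most `|M| ‖y - x‖`. -/
theorem abs_sub_sub_inner_gradient_le {n : ℕ} {f : E n → ℝ} (hf : Differentiable ℝ f) {M : ℝ}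
    (hM : ∀ x y, ‖gradient f x - gradient f y‖ ≤ M * ‖x - y‖) (x y : E n) :
    |f y - f x - inner ℝ (gradient f x) (y - x)| ≤ M * ‖y - x‖ ^ 2 := by
  have hd : ∀ w, HasFDerivAt (fun w => f w - inner ℝ (gradient f x) w)
      (innerSL ℝ (gradient f w - gradient f x)) w := by
    intro w
    have h1 := (hf w).hasGradientAt.hasFDerivAt
    have h2 := (innerSL ℝ (gradient f x)).hasFDerivAt (x := w)
    refine (h1.sub h2).congr_fderiv ?_
    ext v
    simp [inner_sub_left]
  have h := (convex_closedBall x ‖y - x‖).norm_image_sub_le_of_norm_hasFDerivWithin_le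
    (C := |M| * ‖y - x‖) (fun w _ => (hd w).hasFDerivWithinAt) (fun w hw => by
      rw [innerSL_apply_norm]
      refine (hM w x).trans ?_
      rw [mem_closedBall_iff_norm] at hw
      exact mul_le_mul (le_abs_self M) hw (norm_nonneg _) (abs_nonneg _))
    (Metric.mem_closedBall_self (norm_nonneg _))
    (mem_closedBall_iff_norm.2 le_rfl)
  -- A negative `M` forces `y = x`.
  have hM0 : |M| * ‖y - x‖ ^ 2 = M * ‖y - x‖ ^ 2 := by
    rcases le_or_gt 0 M with h0 | h0
    · rw [abs_of_nonneg h0]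
    · have h1 := (norm_nonneg _).trans (hM y x)
      have : ‖y - x‖ = 0 := le_antisymm (by nlinarith [norm_nonneg (y - x)]) (norm_nonneg _)
      simp [this]
  rw [← hM0]
  rw [Real.norm_eq_abs] at h
  refine le_trans (le_of_eq ?_) (h.trans (le_of_eq (by ring)))
  congr 1
  rw [inner_sub_right]
  ring

/-- A dissipative gradient forces quadratic growth. -/
theorem le_of_dissipative {n : ℕ} {f : E n → ℝ} (hf : Differentiable ℝ f) {ε r D : ℝ}
    (hr : 0 < r) (hε : 0 < ε)
    (hdis : ∀ a, r ≤ ‖a‖ → ε * ‖a‖ ^ 2 ≤ inner ℝ a (gradient f a))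
    (hD : ∀ a, ‖a‖ ≤ r → -D ≤ f a) (a : E n) :
    ε / 2 * ‖a‖ ^ 2 ≤ f a + (D + ε / 2 * r ^ 2) := by
  rcases le_or_gt ‖a‖ r with h | h
  · have := hD a h
    have : ‖a‖ ^ 2 ≤ r ^ 2 := pow_le_pow_left₀ (norm_nonneg _) h 2
    nlinarith
  · have ha : 0 < ‖a‖ := hr.trans h
    set v : E n := ‖a‖⁻¹ • a
    have hv : ‖v‖ = 1 := by
      simp only [v]
      rw [norm_smul, norm_inv, norm_norm, inv_mul_cancel₀ ha.ne']
    have hav : a = ‖a‖ • v := by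
      simp only [v]
      rw [smul_smul, mul_inv_cancel₀ ha.ne', one_smul]
    -- Dissipativity along the ray through `a` says that `f` minus the parabola is nondecreasing
    -- beyond radius `r`.
    set g : ℝ → ℝ := fun s => f (s • v) - ε / 2 * s ^ 2
    have hg : ∀ s, HasDerivAt g (inner ℝ (gradient f (s • v)) v - ε * s) s := by
      intro s
      have h1 : HasDerivAt (fun s : ℝ => s • v) v s := by
        simpa using (hasDerivAt_id s).smul_const v
      have h2 := (hf (s • v)).hasGradientAt.hasFDerivAt.comp_hasDerivAt s h1
      have h3 : HasDerivAt (fun s : ℝ => ε / 2 * s ^ 2) (ε * s) s := by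
        have := (hasDerivAt_pow 2 s).const_mul (ε / 2)
        refine this.congr_deriv ?_
        push_cast
        ring
      refine (h2.sub h3).congr_deriv ?_
      simp
    have hmono : MonotoneOn g (Ici r) := by
      refine monotoneOn_of_deriv_nonneg (convex_Ici r)
        (fun s _ => (hg s).continuousAt.continuousWithinAt)
        (fun s _ => (hg s).differentiableAt.differentiableWithinAt) fun s hs => ?_
      rw [interior_Ici, mem_Ioi] at hs
      have hs0 : 0 < s := hr.trans hs
      have hns : ‖s • v‖ = s := by rw [norm_smul, hv, mul_one, Real.norm_of_nonneg hs0.le]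
      have h1 := hdis (s • v) (by rw [hns]; exact hs.le)
      rw [hns, real_inner_smul_left, real_inner_comm] at h1
      rw [(hg s).deriv]
      have h2 : s * (ε * s) ≤ s * inner ℝ (gradient f (s • v)) v := by nlinarith
      linarith [le_of_mul_le_mul_left h2 hs0]
    have h1 := hmono (mem_Ici.2 le_rfl) (mem_Ici.2 h.le) h.le
    have h2 := hD (r • v) (by rw [norm_smul, hv, mul_one, Real.norm_of_nonneg hr.le])
    simp only [g] at h1
    rw [← hav] at h1
    linarith

/-! ### Growth and Lipschitz bounds from all the assumptions -/

namespace RelaxedControl.ControlProblem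

variable {d m : ℕ} {𝒵 : Type v} {Ω₀ : Type w} [MeasurableSpace 𝒵] [MeasurableSpace Ω₀]
  {S : ControlProblem d m 𝒵 Ω₀} {Kx Kp : Set (E d)}

/-- The bounds that follow from all the assumptions, with a common constant. -/
structure Bounds (S : ControlProblem d m 𝒵 Ω₀) (Kx Kp : Set (E d)) (C : ℝ) : Prop
    extends S.StandingBounds C where
  p_le : ∀ p ∈ Kp, ‖p‖ ≤ C
  x_le : ∀ x ∈ Kx, ‖x‖ ≤ C
  φ_lip_a : ∀ t ∈ Icc 0 S.T, ∀ x ∈ Kx, ∀ a a' z, ‖S.φ t x a z - S.φ t x a' z‖ ≤ C * ‖a - a'‖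
  gradxH_lip : ∀ t ∈ Icc 0 S.T, ∀ x ∈ Kx, ∀ x' ∈ Kx, ∀ p ∈ Kp, ∀ a a' z,
    ‖S.gradxH t x a p z - S.gradxH t x' a' p z‖ ≤ C * (‖x - x'‖ + ‖a - a'‖)
  gradG_lip : ∀ x ∈ Kx, ∀ x' ∈ Kx, ∀ z,
    ‖gradient (fun y => S.G y z) x - gradient (fun y => S.G y z) x'‖ ≤ C * ‖x - x'‖
  gradaH_lip : ∀ t ∈ Icc 0 S.T, ∀ x ∈ Kx, ∀ x' ∈ Kx, ∀ p ∈ Kp, ∀ p' ∈ Kp, ∀ a a' z,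
    ‖S.gradaH t x a p z - S.gradaH t x' a' p' z‖ ≤ C * (‖x - x'‖ + ‖a - a'‖ + ‖p - p'‖)
  gradaH_zero : ∀ t ∈ Icc 0 S.T, ∀ x ∈ Kx, ∀ p ∈ Kp, ∀ z, ‖S.gradaH t x 0 p z‖ ≤ C
  H_taylor : ∀ t ∈ Icc 0 S.T, ∀ x ∈ Kx, ∀ p ∈ Kp, ∀ z a a',
    |S.H t x a' p z - S.H t x a p z - inner ℝ (S.gradaH t x a p z) (a' - a)| ≤ C * ‖a' - a‖ ^ 2
  H_le : ∀ t ∈ Icc 0 S.T, ∀ x ∈ Kx, ∀ p ∈ Kp, ∀ z a, |S.H t x a p z| ≤ C * (1 + ‖a‖ ^ 2)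
  H_ge : ∀ t ∈ Icc 0 S.T, ∀ x ∈ Kx, ∀ p ∈ Kp, ∀ z a, ‖a‖ ^ 2 ≤ C * (S.H t x a p z + C)
  L_le : ∀ t ∈ Icc 0 S.T, ∀ x ∈ Kx, ∀ z a, |S.L t x a z| ≤ C * (1 + ‖a‖ ^ 2)
  L_ge : ∀ t ∈ Icc 0 S.T, ∀ x ∈ Kx, ∀ z a, ‖a‖ ^ 2 ≤ C * (S.L t x a z + C)

/-- With the Lipschitz bound on `∇ₐH`, dissipativity controls `∇ₐH` at `a = 0`, and a Taylor
expansion then bounds `|H|` quadratically. Integrated along rays, dissipativity gives quadratic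
growth from below. `L` inherits both bounds, since it differs from `H` at a fixed `p₀ ∈ Kp` by the
bounded term `p₀ · φ`; this is what `Kp.Nonempty` is for. -/
theorem Standing.exists_full_bounds (hS : S.Standing) (hWell : S.AssumptionWell Kx)
    (hGF : S.AssumptionGF Kx Kp) (hKx : IsCompact Kx) (hKp : IsCompact Kp)
    (hKp' : Kp.Nonempty) : ∃ C, S.Bounds Kx Kp C := by
  obtain ⟨C₀, hC₀⟩ := hS.exists_bounds.exists
  obtain ⟨C₁, h₁⟩ := hWell.lip_gradaφ
  obtain ⟨C₂, h₂⟩ := hWell.lip_gradaL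
  obtain ⟨C₃, h₃⟩ := hWell.lip_gradxφ
  obtain ⟨C₄, h₄⟩ := hWell.lip_gradxL
  obtain ⟨C₅, h₅⟩ := hWell.lip_gradxG
  obtain ⟨C₆, h₆⟩ := hWell.lip_φ
  obtain ⟨C₇, h₇⟩ := hWell.bounded_H
  obtain ⟨B', hB'⟩ := hKp.exists_bound_of_continuousOn continuousOn_id
  obtain ⟨Bx', hBx'⟩ := hKx.exists_bound_of_continuousOn continuousOn_id
  obtain ⟨ε, hε, R, hR⟩ := hGF.dissipative
  obtain ⟨p₀, hp₀⟩ := hKp'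
  set B := max B' 0
  set Bx := max Bx' 0
  have hB0 : 0 ≤ B := le_max_right _ _
  have hBx0 : 0 ≤ Bx := le_max_right _ _
  have hB : ∀ p ∈ Kp, ‖p‖ ≤ B := fun p hp => (hB' p hp).trans (le_max_left _ _)
  have hBx : ∀ x ∈ Kx, ‖x‖ ≤ Bx := fun p hp => (hBx' p hp).trans (le_max_left _ _)
  set r := max R 1
  have hr : 0 < r := zero_lt_one.trans_le (le_max_right _ _)
  have hC₀0 : 0 ≤ C₀ := zero_le_one.trans hC₀.one_le
  set M := |C₂| + |C₁| * B + |C₆|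
  have hM0 : 0 ≤ M := by positivity
  have hDφ : ∀ t ∈ Icc 0 S.T, ∀ x ∈ Kx, ∀ a z, ‖fderiv ℝ (fun b => S.φ t x b z) a‖ ≤ |C₆| := by
    intro t ht x hx a z
    refine norm_fderiv_le_of_lip' ℝ (abs_nonneg _) (Eventually.of_forall fun b => ?_)
    refine (h₆ t ht z x hx x hx b a).trans ?_
    simp only [sub_self, norm_zero, zero_add]
    exact mul_le_mul_of_nonneg_right (le_abs_self _) (norm_nonneg _)
  have hgradaH : ∀ t ∈ Icc 0 S.T, ∀ x ∈ Kx, ∀ x' ∈ Kx, ∀ p ∈ Kp, ∀ p', ∀ a a' z,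
      ‖S.gradaH t x a p z - S.gradaH t x' a' p' z‖ ≤ M * (‖x - x'‖ + ‖a - a'‖ + ‖p - p'‖) := by
    intro t ht x hx x' hx' p hp p' a a' z
    rw [hS.gradaH_eq ht, hS.gradaH_eq ht]
    set D := fderiv ℝ (fun b => S.φ t x b z) a
    set D' := fderiv ℝ (fun b => S.φ t x' b z) a'
    set g := gradient (fun b => S.L t x b z) a
    set g' := gradient (fun b => S.L t x' b z) a'
    have e : g + D.adjoint p - (g' + D'.adjoint p')
        = (g - g') + (D - D').adjoint p + D'.adjoint (p - p') := by
      rw [map_sub, map_sub, sub_apply]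
      abel
    rw [e]
    have e1 : ‖g - g'‖ ≤ |C₂| * (‖x - x'‖ + ‖a - a'‖) := (h₂ t ht z x hx x' hx' a a').trans
      (mul_le_mul_of_nonneg_right (le_abs_self _) (by positivity))
    have e2 : ‖(D - D').adjoint p‖ ≤ |C₁| * (‖x - x'‖ + ‖a - a'‖) * B := by
      refine (ContinuousLinearMap.le_opNorm _ _).trans ?_
      rw [LinearIsometryEquiv.norm_map]
      refine mul_le_mul ((h₁ t ht z x hx x' hx' a a').trans
        (mul_le_mul_of_nonneg_right (le_abs_self _) (by positivity))) (hB p hp) (norm_nonneg _)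
        (by positivity)
    have e3 : ‖D'.adjoint (p - p')‖ ≤ |C₆| * ‖p - p'‖ := by
      refine (ContinuousLinearMap.le_opNorm _ _).trans ?_
      rw [LinearIsometryEquiv.norm_map]
      exact mul_le_mul_of_nonneg_right (hDφ t ht x' hx' a' z) (norm_nonneg _)
    have e4 : 0 ≤ |C₆| * (‖x - x'‖ + ‖a - a'‖) := by positivity
    have e5 : 0 ≤ (|C₂| + |C₁| * B) * ‖p - p'‖ := by positivity
    calc _ ≤ ‖g - g'‖ + ‖(D - D').adjoint p‖ + ‖D'.adjoint (p - p')‖ := norm_add₃_le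
      _ ≤ _ := by
        simp only [M]
        nlinarith
  have hzero : ∀ t ∈ Icc 0 S.T, ∀ x ∈ Kx, ∀ p ∈ Kp, ∀ z, ‖S.gradaH t x 0 p z‖ ≤ M * r := by
    intro t ht x hx p hp z
    set v := S.gradaH t x 0 p z
    rcases eq_or_ne v 0 with hv | hv
    · rw [hv, norm_zero]
      positivity
    · have hv0 : 0 < ‖v‖ := norm_pos_iff.2 hv
      -- The point at distance `r` in the direction opposite to `v`: there `⟨a, ∇ₐH⟩` is nonnegative
      -- by dissipativity, but at most `-r ‖v‖ + r · M r` by the Lipschitz bound.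
      set a : E m := -((r / ‖v‖) • v)
      have ha : ‖a‖ = r := by
        simp only [a]
        rw [norm_neg, norm_smul, Real.norm_of_nonneg (by positivity), div_mul_cancel₀ _ hv0.ne']
      have h1 := hR t ht x hx p hp z a (by rw [ha]; exact le_max_left _ _)
      have h2 := hgradaH t ht x hx x hx p hp p a 0 z
      simp only [sub_self, norm_zero, zero_add, sub_zero, add_zero, ha] at h2
      have h3 : inner ℝ a (S.gradaH t x a p z)
          = inner ℝ a v + inner ℝ a (S.gradaH t x a p z - v) := by
        rw [← inner_add_right, add_sub_cancel]
      have h4 : inner ℝ a v = -(r * ‖v‖) := by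
        simp only [a]
        rw [inner_neg_left, real_inner_smul_left, real_inner_self_eq_norm_sq]
        field_simp
      have h5 := (real_inner_le_norm a (S.gradaH t x a p z - v)).trans
        (mul_le_mul_of_nonneg_left h2 (norm_nonneg _))
      rw [ha] at h5
      have h6 : 0 ≤ ε * ‖a‖ ^ 2 := by positivity
      have h7 : r * ‖v‖ ≤ r * (M * r) := by linarith
      exact le_of_mul_le_mul_left h7 hr
  have hH0 : ∀ t ∈ Icc 0 S.T, ∀ x ∈ Kx, ∀ p ∈ Kp, ∀ z,
      |S.H t x 0 p z| ≤ |C₇| + C₀ * Bx + B * C₀ := by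
    intro t ht x hx p hp z
    -- At `p = 0` the Hamiltonian is `L`. The passage from `0` to `x` uses the global Lipschitz
    -- bound of `L`, since `0` need not lie in `Kx`.
    have e1 : |S.L t 0 0 z| ≤ |C₇| := by
      have := h₇ t ht z
      simp only [H, inner_zero_left, add_zero] at this
      exact this.trans (le_abs_self _)
    have e2 := hC₀.L_lip t ht x 0 0 z
    rw [sub_zero] at e2
    have e3 := mul_le_mul_of_nonneg_left (hBx x hx) hC₀0
    have e4 : |inner ℝ p (S.φ t x 0 z)| ≤ B * C₀ := (abs_real_inner_le_norm _ _).trans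
      (mul_le_mul (hB p hp) (hC₀.φ_le t ht x 0 z) (norm_nonneg _) hB0)
    have e5 := abs_add_le (S.L t 0 0 z) (S.L t x 0 z - S.L t 0 0 z)
    rw [add_sub_cancel] at e5
    have e6 := abs_add_le (S.L t x 0 z) (inner ℝ p (S.φ t x 0 z))
    rw [H]
    linarith
  set D₀ := |C₇| + C₀ * Bx + B * C₀
  have hD₀0 : 0 ≤ D₀ := by positivity
  have htaylor : ∀ t ∈ Icc 0 S.T, ∀ x ∈ Kx, ∀ p ∈ Kp, ∀ z a a',
      |S.H t x a' p z - S.H t x a p z - inner ℝ (S.gradaH t x a p z) (a' - a)|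
        ≤ M * ‖a' - a‖ ^ 2 := by
    intro t ht x hx p hp z a a'
    refine abs_sub_sub_inner_gradient_le (f := fun a => S.H t x a p z)
      ((hS.contDiff_H_a ht x p z).differentiable one_ne_zero) (fun b b' => ?_) a a'
    have h := hgradaH t ht x hx x hx p hp p b b' z
    simp only [sub_self, norm_zero, zero_add, add_zero] at h
    exact h
  have hHabs : ∀ t ∈ Icc 0 S.T, ∀ x ∈ Kx, ∀ p ∈ Kp, ∀ z a,
      |S.H t x a p z| ≤ D₀ + M * r * ‖a‖ + M * ‖a‖ ^ 2 := by
    intro t ht x hx p hp z a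
    have e1 := htaylor t ht x hx p hp z 0 a
    rw [sub_zero] at e1
    have e2 := (abs_real_inner_le_norm (S.gradaH t x 0 p z) a).trans
      (mul_le_mul_of_nonneg_right (hzero t ht x hx p hp z) (norm_nonneg _))
    have e3 := hH0 t ht x hx p hp z
    have e4 := abs_add_le (S.H t x 0 p z + inner ℝ (S.gradaH t x 0 p z) a)
      (S.H t x a p z - S.H t x 0 p z - inner ℝ (S.gradaH t x 0 p z) a)
    have e5 := abs_add_le (S.H t x 0 p z) (inner ℝ (S.gradaH t x 0 p z) a)
    rw [show S.H t x 0 p z + inner ℝ (S.gradaH t x 0 p z) a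
      + (S.H t x a p z - S.H t x 0 p z - inner ℝ (S.gradaH t x 0 p z) a) = S.H t x a p z by ring]
      at e4
    linarith
  set D := D₀ + M * r * r + M * r ^ 2
  have hcoer : ∀ t ∈ Icc 0 S.T, ∀ x ∈ Kx, ∀ p ∈ Kp, ∀ z a,
      ε / 2 * ‖a‖ ^ 2 ≤ S.H t x a p z + (D + ε / 2 * r ^ 2) := by
    intro t ht x hx p hp z a
    refine le_of_dissipative ((hS.contDiff_H_a ht x p z).differentiable one_ne_zero) hr hε
      (fun b hb => hR t ht x hx p hp z b ((le_max_left _ _).trans hb)) (fun b hb => ?_) a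
    have e1 := hHabs t ht x hx p hp z b
    have e2 : M * r * ‖b‖ ≤ M * r * r := mul_le_mul_of_nonneg_left hb (by positivity)
    have e3 : M * ‖b‖ ^ 2 ≤ M * r ^ 2 :=
      mul_le_mul_of_nonneg_left (pow_le_pow_left₀ (norm_nonneg _) hb 2) hM0
    have e4 := (abs_le.1 e1).1
    linarith
  have hLH : ∀ t ∈ Icc 0 S.T, ∀ x ∈ Kx, ∀ z a,
      |S.H t x a p₀ z - S.L t x a z| ≤ B * C₀ := by
    intro t ht x hx z a
    rw [H, add_sub_cancel_left]
    exact (abs_real_inner_le_norm _ _).trans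
      (mul_le_mul (hB p₀ hp₀) (hC₀.φ_le t ht x a z) (norm_nonneg _) hB0)
  set D₁ := D₀ + M * r + M + B * C₀
  set D₂ := D + ε / 2 * r ^ 2 + B * C₀
  have hD0 : 0 ≤ D := by positivity
  have hD₂0 : 0 ≤ D₂ := by positivity
  refine Eventually.exists (f := atTop) (p := fun C => S.Bounds Kx Kp C) ?_
  filter_upwards [hS.exists_bounds, eventually_ge_atTop B, eventually_ge_atTop Bx,
    eventually_ge_atTop |C₆|, eventually_ge_atTop (|C₄| + |C₃| * B), eventually_ge_atTop |C₅|,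
    eventually_ge_atTop M, eventually_ge_atTop (M * r), eventually_ge_atTop D₁,
    eventually_ge_atTop D₂, eventually_ge_atTop (2 / ε)]
    with C hCS hCB hCBx hC6 hC4 hC5 hCM hCMr hCD₁ hCD₂ hCε
  have hC0 : 0 ≤ C := zero_le_one.trans hCS.one_le
  have hBC : 0 ≤ B * C₀ := by positivity
  have hquad : ∀ a : E m, D₀ + M * r * ‖a‖ + M * ‖a‖ ^ 2 + B * C₀ ≤ C * (1 + ‖a‖ ^ 2) := by
    intro a
    have e1 : ‖a‖ ≤ 1 + ‖a‖ ^ 2 := by nlinarith [sq_nonneg (‖a‖ - 1), norm_nonneg a]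
    have e2 : M * r * ‖a‖ ≤ M * r * (1 + ‖a‖ ^ 2) :=
      mul_le_mul_of_nonneg_left e1 (by positivity)
    have e3 := mul_le_mul_of_nonneg_right hCD₁ (by positivity : 0 ≤ 1 + ‖a‖ ^ 2)
    simp only [D₁] at e3
    nlinarith [mul_nonneg hD₀0 (sq_nonneg ‖a‖), mul_nonneg hBC (sq_nonneg ‖a‖)]
  have hcoer' : ∀ (a : E m) (h : ℝ), ε / 2 * ‖a‖ ^ 2 ≤ h + D₂ → ‖a‖ ^ 2 ≤ C * (h + C) := by
    intro a h hh
    have e1 : ‖a‖ ^ 2 ≤ 2 / ε * (h + D₂) := by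
      rw [div_mul_eq_mul_div, le_div_iff₀ hε]
      linarith
    have e2 : 0 ≤ h + D₂ := le_trans (by positivity) hh
    calc _ ≤ 2 / ε * (h + D₂) := e1
      _ ≤ C * (h + D₂) := mul_le_mul_of_nonneg_right hCε e2
      _ ≤ C * (h + C) := mul_le_mul_of_nonneg_left (by linarith) hC0
  refine ⟨hCS, fun p hp => (hB p hp).trans hCB, fun x hx => (hBx x hx).trans hCBx,
    fun t ht x hx a a' z => ?_, fun t ht x hx x' hx' p hp a a' z => ?_,
    fun x hx x' hx' z => ?_, fun t ht x hx x' hx' p hp p' hp' a a' z => ?_,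
    fun t ht x hx p hp z => (hzero t ht x hx p hp z).trans hCMr,
    fun t ht x hx p hp z a a' => ?_, fun t ht x hx p hp z a => ?_,
    fun t ht x hx p hp z a => ?_, fun t ht x hx z a => ?_, fun t ht x hx z a => ?_⟩
  · refine (h₆ t ht z x hx x hx a a').trans ?_
    simp only [sub_self, norm_zero, zero_add]
    exact mul_le_mul_of_nonneg_right ((le_abs_self _).trans hC6) (norm_nonneg _)
  · rw [hS.gradxH_eq ht, hS.gradxH_eq ht, add_sub_add_comm, ← sub_apply,
      ← map_sub]
    have e1 := (h₄ t ht z x hx x' hx' a a').trans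
      (mul_le_mul_of_nonneg_right (le_abs_self C₄) (by positivity))
    have e2 := (h₃ t ht z x hx x' hx' a a').trans
      (mul_le_mul_of_nonneg_right (le_abs_self C₃) (by positivity))
    set Δ := fderiv ℝ (fun y => S.φ t y a z) x - fderiv ℝ (fun y => S.φ t y a' z) x'
    have e3 : ‖Δ.adjoint p‖ ≤ |C₃| * (‖x - x'‖ + ‖a - a'‖) * B := by
      refine (ContinuousLinearMap.le_opNorm _ _).trans ?_
      rw [LinearIsometryEquiv.norm_map]
      exact mul_le_mul e2 (hB p hp) (norm_nonneg _) (by positivity)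
    have e4 := mul_le_mul_of_nonneg_right hC4 (by positivity : 0 ≤ ‖x - x'‖ + ‖a - a'‖)
    refine (norm_add_le _ _).trans ?_
    linarith
  · have := h₅ 0 ⟨le_rfl, hS.T_pos.le⟩ z x hx x' hx' 0 0
    simp only [sub_self, norm_zero, add_zero] at this
    exact this.trans (mul_le_mul_of_nonneg_right ((le_abs_self _).trans hC5) (norm_nonneg _))
  · exact (hgradaH t ht x hx x' hx' p hp p' a a' z).trans
      (mul_le_mul_of_nonneg_right hCM (by positivity))
  · exact (htaylor t ht x hx p hp z a a').trans (mul_le_mul_of_nonneg_right hCM (by positivity))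
  · have := hHabs t ht x hx p hp z a
    linarith [hquad a]
  · refine hcoer' a _ ((hcoer t ht x hx p hp z a).trans ?_)
    simp only [D₂]
    linarith
  · have e1 := hHabs t ht x hx p₀ hp₀ z a
    have e2 := hLH t ht x hx z a
    have e3 := abs_add_le (S.H t x a p₀ z) (-(S.H t x a p₀ z - S.L t x a z))
    rw [abs_neg, show S.H t x a p₀ z + -(S.H t x a p₀ z - S.L t x a z) = S.L t x a z by ring] at e3
    linarith [hquad a]
  · refine hcoer' a _ ((hcoer t ht x hx p₀ hp₀ z a).trans ?_)
    have e2 := (abs_le.1 (hLH t ht x hx z a)).2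
    simp only [D₂]
    linarith

theorem Bounds.norm_gradaH_le {C : ℝ} (hC : S.Bounds Kx Kp C) {t : ℝ} (ht : t ∈ Icc 0 S.T)
    {x p : E d} (hx : x ∈ Kx) (hp : p ∈ Kp) (a : E m) (z : 𝒵) :
    ‖S.gradaH t x a p z‖ ≤ C * (1 + ‖a‖) := by
  have h1 := hC.gradaH_lip t ht x hx x hx p hp p hp a 0 z
  simp only [sub_self, norm_zero, zero_add, sub_zero, add_zero] at h1
  have h2 := hC.gradaH_zero t ht x hx p hp z
  have h3 := norm_add_le (S.gradaH t x 0 p z) (S.gradaH t x a p z - S.gradaH t x 0 p z)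
  rw [add_sub_cancel] at h3
  linarith

end RelaxedControl.ControlProblem

/-! ### Integration by parts for primitives of integrable functions -/

/-- Fubini on the triangle `s ≤ r`. In the application `p + ∫ q` is the adjoint process and `δ` the
increment of the drift, so the terminal increment of the state is traded for an increment of the
Hamiltonian. -/
theorem inner_integral_by_parts {n : ℕ} {T : ℝ} (hT : 0 ≤ T) {δ q : ℝ → E n}
    (hδ : IntegrableOn δ (Icc 0 T)) (hq : IntegrableOn q (Icc 0 T)) (p : E n) :
    inner ℝ p (∫ s in (0 : ℝ)..T, δ s)
      = (∫ s in Icc 0 T, inner ℝ (p + ∫ r in s..T, q r) (δ s))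
        - ∫ r in Icc 0 T, inner ℝ (q r) (∫ s in (0 : ℝ)..r, δ s) := by
  set τ := volume.restrict (Icc (0 : ℝ) T)
  let F : ℝ × ℝ → ℝ := {z : ℝ × ℝ | z.1 ≤ z.2}.indicator fun z => inner ℝ (q z.2) (δ z.1)
  have hset : MeasurableSet {z : ℝ × ℝ | z.1 ≤ z.2} := measurableSet_le measurable_fst measurable_snd
  have hF : Integrable F (τ.prod τ) := by
    have h1 : Integrable (fun z : ℝ × ℝ => inner ℝ (q z.2) (δ z.1)) (τ.prod τ) := by
      refine (Integrable.mul_prod hδ.norm hq.norm).mono'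
        (hq.aestronglyMeasurable.comp_snd.inner hδ.aestronglyMeasurable.comp_fst)
        (Eventually.of_forall fun z => ?_)
      rw [mul_comm]
      exact norm_inner_le_norm _ _
    exact h1.indicator hset
  have h1 : ∀ s ∈ Icc 0 T, ∫ r, F (s, r) ∂τ = inner ℝ (∫ r in s..T, q r) (δ s) := by
    intro s hs
    rw [intervalIntegral.integral_of_le hs.2, ← integral_Icc_eq_integral_Ioc, real_inner_comm,
      ← integral_inner (hq.mono_set (Icc_subset_Icc_left hs.1)),
      show Icc s T = Ici s ∩ Icc 0 T by ext; simp; grind, ← Measure.restrict_restrict measurableSet_Ici,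
      ← integral_indicator measurableSet_Ici]
    refine integral_congr_ae (Eventually.of_forall fun r => ?_)
    simp only [F, indicator, mem_ofPred_eq, mem_Ici]
    split_ifs
    · exact real_inner_comm _ _
    · rfl
  have h2 : ∀ r ∈ Icc 0 T, ∫ s, F (s, r) ∂τ = inner ℝ (q r) (∫ s in (0 : ℝ)..r, δ s) := by
    intro r hr
    rw [intervalIntegral.integral_of_le hr.1, ← integral_Icc_eq_integral_Ioc,
      ← integral_inner (hδ.mono_set (Icc_subset_Icc_right hr.2)),
      show Icc 0 r = Iic r ∩ Icc 0 T by ext; simp; grind, ← Measure.restrict_restrict measurableSet_Iic,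
      ← integral_indicator measurableSet_Iic]
    refine integral_congr_ae (Eventually.of_forall fun s => ?_)
    simp only [F, indicator, mem_ofPred_eq, mem_Iic]
  have h3 : ∫ s in Icc 0 T, inner ℝ (∫ r in s..T, q r) (δ s)
      = ∫ r in Icc 0 T, inner ℝ (q r) (∫ s in (0 : ℝ)..r, δ s) := by
    rw [← setIntegral_congr_fun measurableSet_Icc h1, ← setIntegral_congr_fun measurableSet_Icc h2]
    exact integral_integral_swap hF
  have h4 : IntegrableOn (fun s => inner ℝ (∫ r in s..T, q r) (δ s)) (Icc 0 T) :=
    hF.integral_prod_left.congr ((ae_restrict_iff' measurableSet_Icc).2 (Eventually.of_forall h1))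
  have h5 : IntegrableOn (fun s => inner ℝ p (δ s)) (Icc 0 T) := hδ.const_inner p
  simp_rw [inner_add_left]
  rw [integral_add h5 h4, h3, add_sub_cancel_right, integral_inner hδ,
    intervalIntegral.integral_of_le hT, ← integral_Icc_eq_integral_Ioc]

/-- A first order Taylor remainder along a family of increments of order `ε`. -/
theorem tendsto_remainder_div {n : ℕ} {f : E n → ℝ} {x : E n} (hf : DifferentiableAt ℝ f x)
    {Δ : ℝ → E n} {C : ℝ} {l : Filter ℝ} (hl : Tendsto id l (𝓝 0))
    (hΔ : ∀ᶠ ε in l, ‖Δ ε‖ ≤ C * |ε|) :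
    Tendsto (fun ε => (f (x + Δ ε) - f x - inner ℝ (gradient f x) (Δ ε)) / ε) l (𝓝 0) := by
  have hO : Δ =O[l] (fun ε => ε) := by
    refine Asymptotics.IsBigO.of_bound C (hΔ.mono fun ε h => ?_)
    simpa using h
  have h0 : Tendsto Δ l (𝓝 0) := hO.trans_tendsto hl
  have h1 := hf.hasGradientAt.hasFDerivAt.isLittleO
  have h2 : Tendsto (fun ε => x + Δ ε) l (𝓝 x) := by
    simpa using tendsto_const_nhds.add h0
  have h3 := (h1.comp_tendsto h2).trans_isBigO (k := fun ε : ℝ => ε) (by simpa [Function.comp_def] using hO)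
  refine Asymptotics.IsLittleO.tendsto_div_nhds_zero (h3.congr_left fun ε => ?_)
  simp

/-! ### Extended integrals of real functions -/

theorem extIntegral_coe_of_integrable {α : Type*} [MeasurableSpace α] {μ : Measure α} {f : α → ℝ}
    (hf : Integrable f μ) : extIntegral μ (fun x => (f x : EReal)) = ((∫ x, f x ∂μ : ℝ) : EReal) := by
  have h1 : ∫⁻ x, ENNReal.ofReal (f x) ∂μ ≠ ⊤ := hf.lintegral_lt_top.ne
  have h2 : ∫⁻ x, ENNReal.ofReal (-f x) ∂μ ≠ ⊤ := hf.neg.lintegral_lt_top.ne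
  have e : ∀ x, (-(f x : EReal)).toENNReal = ENNReal.ofReal (-f x) := fun x => by
    rw [← EReal.coe_neg, EReal.real_coe_toENNReal]
  simp only [extIntegral, EReal.real_coe_toENNReal, e]
  rw [if_neg h1, integral_eq_lintegral_pos_part_sub_lintegral_neg_part hf, EReal.coe_sub,
    EReal.coe_ennreal_toReal h1, EReal.coe_ennreal_toReal h2]

/-- `extIntegral` is `⊤` as soon as the positive part diverges and `⊥` if only the negative part
does; excluding both values leaves two finite parts. -/
theorem integrable_of_extIntegral {α : Type*} [MeasurableSpace α] {μ : Measure α} {f : α → ℝ}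
    (hf : AEStronglyMeasurable f μ) (h1 : extIntegral μ (fun x => (f x : EReal)) ≠ ⊤)
    (h2 : extIntegral μ (fun x => (f x : EReal)) ≠ ⊥) : Integrable f μ := by
  have e : ∀ x, (-(f x : EReal)).toENNReal = ENNReal.ofReal (-f x) := fun x => by
    rw [← EReal.coe_neg, EReal.real_coe_toENNReal]
  simp only [extIntegral, EReal.real_coe_toENNReal, e] at h1 h2
  split_ifs at h1 h2 with h3
  · exact absurd rfl h1
  have h4 : ∫⁻ x, ENNReal.ofReal (-f x) ∂μ ≠ ⊤ := by
    intro h4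
    rw [h4] at h2
    simp at h2
  refine ⟨hf, ?_⟩
  have h5 : ∀ x, ‖f x‖ₑ ≤ ENNReal.ofReal (f x) + ENNReal.ofReal (-f x) := fun x => by
    rw [Real.enorm_eq_ofReal_abs]
    rcases le_total 0 (f x) with h | h
    · rw [abs_of_nonneg h]; exact le_self_add
    · rw [abs_of_nonpos h]; exact le_add_self
  refine (lintegral_mono h5).trans_lt ?_
  rw [lintegral_add_left' hf.aemeasurable.ennreal_ofReal]
  exact ENNReal.add_lt_top.2 ⟨lt_top_iff_ne_top.2 h3, lt_top_iff_ne_top.2 h4⟩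

/-! ### Mixtures of controls -/

/-- The mixture `(1 - ε) ν + ε γ` of two kernels. -/
noncomputable def mixKernel {α β : Type*} [MeasurableSpace α] [MeasurableSpace β] (ε : ℝ) (ν γ : Kernel α β) :
    Kernel α β where
  toFun t := ENNReal.ofReal (1 - ε) • ν t + ENNReal.ofReal ε • γ t
  measurable' := by
    refine Measure.measurable_of_measurable_coe _ fun s hs => ?_
    simp only [Measure.coe_add, Measure.coe_smul, Pi.add_apply, Pi.smul_apply, smul_eq_mul]
    exact ((ν.measurable_coe hs).const_mul _).add ((γ.measurable_coe hs).const_mul _)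

section Mix

variable {α β : Type*} [MeasurableSpace α] [MeasurableSpace β] {ε : ℝ} {ν γ : Kernel α β}

theorem mixKernel_apply (t : α) :
    mixKernel ε ν γ t = ENNReal.ofReal (1 - ε) • ν t + ENNReal.ofReal ε • γ t := rfl

theorem isMarkovKernel_mixKernel [IsMarkovKernel ν] [IsMarkovKernel γ] (hε : ε ∈ Icc (0 : ℝ) 1) :
    IsMarkovKernel (mixKernel ε ν γ) := by
  refine ⟨fun t => ⟨?_⟩⟩
  rw [mixKernel_apply]
  simp only [Measure.coe_add, Measure.coe_smul, Pi.add_apply, Pi.smul_apply, smul_eq_mul,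
    measure_univ, mul_one]
  rw [← ENNReal.ofReal_add (sub_nonneg.2 hε.2) hε.1]
  simp

theorem compProd_mixKernel {μ : Measure α} [SFinite μ] [IsMarkovKernel ν] [IsMarkovKernel γ]
    (hε : ε ∈ Icc (0 : ℝ) 1) :
    μ ⊗ₘ mixKernel ε ν γ = ENNReal.ofReal (1 - ε) • (μ ⊗ₘ ν) + ENNReal.ofReal ε • (μ ⊗ₘ γ) := by
  have := isMarkovKernel_mixKernel (ν := ν) (γ := γ) hε
  ext s hs
  simp only [Measure.coe_add, Measure.coe_smul, Pi.add_apply, Pi.smul_apply, smul_eq_mul]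
  rw [Measure.compProd_apply hs, Measure.compProd_apply hs, Measure.compProd_apply hs,
    ← lintegral_const_mul _ (Kernel.measurable_kernel_prodMk_left hs),
    ← lintegral_const_mul _ (Kernel.measurable_kernel_prodMk_left hs),
    ← lintegral_add_left ((Kernel.measurable_kernel_prodMk_left hs).const_mul _)]
  simp [mixKernel_apply]

theorem integral_mix {F : Type*} [NormedAddCommGroup F] [NormedSpace ℝ F] {μ₁ μ₂ : Measure α}
    (hε : ε ∈ Icc (0 : ℝ) 1) {f : α → F} (h1 : Integrable f μ₁) (h2 : Integrable f μ₂) :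
    ∫ x, f x ∂(ENNReal.ofReal (1 - ε) • μ₁ + ENNReal.ofReal ε • μ₂)
      = (1 - ε) • ∫ x, f x ∂μ₁ + ε • ∫ x, f x ∂μ₂ := by
  rw [integral_add_measure (h1.smul_measure ENNReal.ofReal_ne_top)
    (h2.smul_measure ENNReal.ofReal_ne_top), integral_smul_measure, integral_smul_measure,
    ENNReal.toReal_ofReal (sub_nonneg.2 hε.2), ENNReal.toReal_ofReal hε.1]

end Mix

/-! ### Costs along paths and their first order expansion -/

namespace RelaxedControl.ControlProblem

variable {d m : ℕ} {𝒵 : Type v} {Ω₀ : Type w} [MeasurableSpace 𝒵] [MeasurableSpace Ω₀]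
  {S : ControlProblem d m 𝒵 Ω₀} {Kx Kp : Set (E d)}

instance : IsFiniteMeasure S.time := by unfold time; infer_instance

instance (ν : Kernel ℝ (E m)) [IsMarkovKernel ν] : IsFiniteMeasure (S.controlMeasure ν) := by
  unfold controlMeasure; infer_instance

theorem quasiMeasurePreserving_fst_controlMeasure (ν : Kernel ℝ (E m)) [IsMarkovKernel ν] :
    Measure.QuasiMeasurePreserving Prod.fst (S.controlMeasure ν) S.time := by
  refine ⟨measurable_fst, ?_⟩
  have h := Measure.fst_compProd S.time ν
  rw [Measure.fst] at h
  rw [controlMeasure, h]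

theorem ae_time_mem : ∀ᵐ t ∂S.time, t ∈ Icc 0 S.T := ae_restrict_mem measurableSet_Icc

theorem ae_controlMeasure_mem (ν : Kernel ℝ (E m)) [IsMarkovKernel ν] :
    ∀ᵐ q ∂S.controlMeasure ν, q.1 ∈ Icc 0 S.T :=
  (quasiMeasurePreserving_fst_controlMeasure ν).ae ae_time_mem

theorem aemeasurable_path {x : ℝ → E d} (hx : ContinuousOn x (Icc 0 S.T)) (ν : Kernel ℝ (E m))
    [IsMarkovKernel ν] : AEMeasurable (fun q : ℝ × E m => x q.1) (S.controlMeasure ν) :=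
  (hx.aemeasurable measurableSet_Icc).comp_quasiMeasurePreserving
    (quasiMeasurePreserving_fst_controlMeasure ν)

/-- The cost `∫∫ L(t, X_t, a, Z) ν_t(da) dt + G(X_T, Z)` along a path. -/
noncomputable def pathCost (S : ControlProblem d m 𝒵 Ω₀) (ν : Kernel ℝ (E m))
    (X : ℝ → Ω₀ → E d) (ω : Ω₀) : ℝ :=
  ∫ q, S.L q.1 (X q.1 ω) q.2 (S.Z ω) ∂S.controlMeasure ν + S.G (X S.T ω) (S.Z ω)

/-- `IsRange` speaks of pairs, so an adjoint process is constructed first; uniqueness identifies the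
state of that pair with the given one. -/
theorem IsRange.state_mem (hK : S.IsRange Kx Kp) (hS : S.Standing) {ν : Kernel ℝ (E m)}
    [IsMarkovKernel ν] {X : ℝ → Ω₀ → E d} (hX : S.IsState ν X) :
    ∀ t ∈ Icc 0 S.T, ∀ ω, X t ω ∈ Kx := by
  obtain ⟨C, hC⟩ := hS.exists_bounds.exists
  obtain ⟨X', P', hX', hP'⟩ := hC.exists_isState_isAdjoint hS ν
  intro t ht ω
  rw [hC.state_unique hS ν hX hX' t ht ω]
  exact (hK.mem ν X' P' hX' hP' t ht ω).1

theorem Standing.state_eq (hS : S.Standing) {ν : Kernel ℝ (E m)} [IsMarkovKernel ν]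
    {X : ℝ → Ω₀ → E d} (hX : S.IsState ν X) : ∀ t ∈ Icc 0 S.T, ∀ ω, S.state ν t ω = X t ω := by
  obtain ⟨C, hC⟩ := hS.exists_bounds.exists
  exact hC.state_unique hS ν (Classical.epsilon_spec (p := S.IsState ν) ⟨X, hX⟩) hX

section Integrability

variable {C : ℝ} (hS : S.Standing) (ν : Kernel ℝ (E m)) [IsMarkovKernel ν]
include hS

/-- The state and adjoint equations ask for measurability in `σ(Z)` at fixed times; joint
measurability in the ambient σ-algebra is added for the sake of Fubini's theorem. -/
theorem StandingBounds.exists_regular (hC : S.StandingBounds C) :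
    ∃ X P : ℝ → Ω₀ → E d, S.IsState ν X ∧ S.IsAdjoint ν X P ∧
      Measurable (Function.uncurry X) ∧ Measurable (Function.uncurry P) ∧
      (∀ ω, Continuous fun t => X t ω) ∧ ∀ ω, Continuous fun t => P t ω := by
  obtain ⟨X, P, h1, h2, h3, h4, h5, h6⟩ := @StandingBounds.exists_processes d m 𝒵 Ω₀ _ _ S hS C hC
    ν _ Ω₀ S.𝒢 S.Z (comap_measurable _) S.X₀ hS.measurable_X₀
  have hle : S.𝒢 ≤ ‹MeasurableSpace Ω₀› := hS.measurable_Z.comap_le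
  exact ⟨X, P, ⟨fun t _ => h1 t, fun ω => (h2 ω).continuousOn, h3⟩,
    ⟨fun t _ => h4 t, fun ω => (h5 ω).continuousOn, h6⟩,
    measurable_uncurry_of_continuous_of_measurable h2 fun t => (h1 t).mono hle le_rfl,
    measurable_uncurry_of_continuous_of_measurable h5 fun t => (h4 t).mono hle le_rfl, h2, h5⟩

variable {x p : ℝ → E d} (hx : ContinuousOn x (Icc 0 S.T)) (hp : ContinuousOn p (Icc 0 S.T))
  (z : 𝒵)
include hx

theorem Standing.aestronglyMeasurable_L_path :
    AEStronglyMeasurable (fun q => S.L q.1 (x q.1) q.2 z) (S.controlMeasure ν) :=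
  (hS.measurable_L.comp_aemeasurable (measurable_fst.aemeasurable.prodMk
    ((aemeasurable_path hx ν).prodMk
      (measurable_snd.aemeasurable.prodMk aemeasurable_const)))).aestronglyMeasurable

theorem StandingBounds.integrable_φ_path (hC : S.StandingBounds C) :
    Integrable (fun q => S.φ q.1 (x q.1) q.2 z) (S.controlMeasure ν) :=
  Integrable.of_bound (hS.measurable_φ.comp_aemeasurable (measurable_fst.aemeasurable.prodMk
    ((aemeasurable_path hx ν).prodMk
      (measurable_snd.aemeasurable.prodMk aemeasurable_const)))).aestronglyMeasurable C
    ((ae_controlMeasure_mem ν).mono fun q hq => hC.φ_le _ hq _ _ _)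

include hp

theorem Standing.aestronglyMeasurable_H_path :
    AEStronglyMeasurable (fun q => S.H q.1 (x q.1) q.2 (p q.1) z) (S.controlMeasure ν) :=
  (hS.measurable_H.comp_aemeasurable (measurable_fst.aemeasurable.prodMk
    ((aemeasurable_path hx ν).prodMk (measurable_snd.aemeasurable.prodMk
      ((aemeasurable_path hp ν).prodMk aemeasurable_const))))).aestronglyMeasurable

theorem Standing.aestronglyMeasurable_gradxH_path :
    AEStronglyMeasurable (fun q => S.gradxH q.1 (x q.1) q.2 (p q.1) z) (S.controlMeasure ν) := by
  refine AEStronglyMeasurable.congr (hS.measurable_gradxH.comp_aemeasurable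
    (measurable_fst.aemeasurable.prodMk ((aemeasurable_path hx ν).prodMk
      (measurable_snd.aemeasurable.prodMk
        ((aemeasurable_path hp ν).prodMk (aemeasurable_const (b := z))))))).aestronglyMeasurable ?_
  filter_upwards [ae_controlMeasure_mem ν] with q hq
  simp [indicator_of_mem hq]

theorem StandingBounds.integrable_gradxH_path (hC : S.StandingBounds C) :
    Integrable (fun q => S.gradxH q.1 (x q.1) q.2 (p q.1) z) (S.controlMeasure ν) := by
  obtain ⟨M, hM⟩ := isCompact_Icc.exists_bound_of_continuousOn hp
  refine Integrable.of_bound (hS.aestronglyMeasurable_gradxH_path ν hx hp z) (C * (1 + M))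
    ((ae_controlMeasure_mem ν).mono fun q hq => (hC.gradxH_le _ hq _ _ _ _).trans ?_)
  exact mul_le_mul_of_nonneg_left (by linarith [hM _ hq]) (zero_le_one.trans hC.one_le)

omit hp

theorem Bounds.integrable_L_path (hC : S.Bounds Kx Kp C) (hxK : ∀ t ∈ Icc 0 S.T, x t ∈ Kx)
    (h2 : Integrable (fun q : ℝ × E m => ‖q.2‖ ^ 2) (S.controlMeasure ν)) :
    Integrable (fun q => S.L q.1 (x q.1) q.2 z) (S.controlMeasure ν) := by
  refine Integrable.mono' (((integrable_const 1).add h2).const_mul C)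
    (hS.aestronglyMeasurable_L_path ν hx z)
    ((ae_controlMeasure_mem ν).mono fun q hq => hC.L_le _ hq _ (hxK _ hq) _ _)

include hp

theorem Bounds.integrable_H_path (hC : S.Bounds Kx Kp C) (hxK : ∀ t ∈ Icc 0 S.T, x t ∈ Kx)
    (hpK : ∀ t ∈ Icc 0 S.T, p t ∈ Kp)
    (h2 : Integrable (fun q : ℝ × E m => ‖q.2‖ ^ 2) (S.controlMeasure ν)) :
    Integrable (fun q => S.H q.1 (x q.1) q.2 (p q.1) z) (S.controlMeasure ν) := by
  refine Integrable.mono' (((integrable_const 1).add h2).const_mul C)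
    (hS.aestronglyMeasurable_H_path ν hx hp z)
    ((ae_controlMeasure_mem ν).mono fun q hq => hC.H_le _ hq _ (hxK _ hq) _ (hpK _ hq) _ _)

end Integrability

section Expansion

variable {C : ℝ} {ν ν' : Kernel ℝ (E m)} [IsMarkovKernel ν] [IsMarkovKernel ν']
  {X X' P : ℝ → Ω₀ → E d}

/-- The increment of the cost, with the first order terms eliminated by the adjoint process. -/
theorem Bounds.pathCost_sub (hC : S.Bounds Kx Kp C) (hS : S.Standing) (hK : S.IsRange Kx Kp)
    (hX : S.IsState ν X) (hX' : S.IsState ν' X') (hP : S.IsAdjoint ν X P)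
    (h2 : Integrable (fun q : ℝ × E m => ‖q.2‖ ^ 2) (S.controlMeasure ν))
    (h2' : Integrable (fun q : ℝ × E m => ‖q.2‖ ^ 2) (S.controlMeasure ν')) (ω : Ω₀) :
    S.pathCost ν' X' ω - S.pathCost ν X ω
      = (∫ q, S.H q.1 (X' q.1 ω) q.2 (P q.1 ω) (S.Z ω) ∂S.controlMeasure ν')
        - (∫ q, S.H q.1 (X q.1 ω) q.2 (P q.1 ω) (S.Z ω) ∂S.controlMeasure ν)
        - (∫ q, inner ℝ (S.gradxH q.1 (X q.1 ω) q.2 (P q.1 ω) (S.Z ω)) (X' q.1 ω - X q.1 ω)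
            ∂S.controlMeasure ν)
        + (S.G (X' S.T ω) (S.Z ω) - S.G (X S.T ω) (S.Z ω)
          - inner ℝ (gradient (fun x => S.G x (S.Z ω)) (X S.T ω)) (X' S.T ω - X S.T ω)) := by
  have hCS := hC.toStandingBounds
  have hT := hS.T_pos.le
  have hPK : ∀ t ∈ Icc 0 S.T, P t ω ∈ Kp := fun t ht => (hK.mem ν X P hX hP t ht ω).2
  have hPc := hP.continuousOn ω
  -- Along the path `L = H - P · φ`, and the second term sees the control only through its drift.
  have key : ∀ {ν : Kernel ℝ (E m)} [IsMarkovKernel ν] {X : ℝ → Ω₀ → E d}, S.IsState ν X →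
      Integrable (fun q : ℝ × E m => ‖q.2‖ ^ 2) (S.controlMeasure ν) →
      ∫ q, S.L q.1 (X q.1 ω) q.2 (S.Z ω) ∂S.controlMeasure ν
        = (∫ q, S.H q.1 (X q.1 ω) q.2 (P q.1 ω) (S.Z ω) ∂S.controlMeasure ν)
          - ∫ t in Icc 0 S.T, inner ℝ (P t ω) (S.fdrift ν t (X t ω) (S.Z ω)) := by
    intro ν _ X hX h2
    have i1 := hCS.integrable_φ_path hS ν (hX.continuousOn ω) (S.Z ω)
    have i2 : Integrable (fun q : ℝ × E m => inner ℝ (P q.1 ω) (S.φ q.1 (X q.1 ω) q.2 (S.Z ω)))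
        (S.controlMeasure ν) := by
      obtain ⟨M, hM⟩ := isCompact_Icc.exists_bound_of_continuousOn hPc
      refine Integrable.mono' (i1.norm.const_mul M)
        ((aemeasurable_path hPc ν).aestronglyMeasurable.inner i1.aestronglyMeasurable)
        ((ae_controlMeasure_mem ν).mono fun q hq => ?_)
      exact (norm_inner_le_norm _ _).trans
        (mul_le_mul_of_nonneg_right (hM _ hq) (norm_nonneg _))
    have i3 := hC.integrable_H_path hS ν (hX.continuousOn ω) hPc (S.Z ω)
      (fun t ht => hK.state_mem hS hX t ht ω) hPK h2
    have e1 : ∫ t in Icc 0 S.T, inner ℝ (P t ω) (S.fdrift ν t (X t ω) (S.Z ω))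
        = ∫ q, inner ℝ (P q.1 ω) (S.φ q.1 (X q.1 ω) q.2 (S.Z ω)) ∂S.controlMeasure ν := by
      rw [controlMeasure, Measure.integral_compProd i2]
      refine setIntegral_congr_fun measurableSet_Icc fun t ht => ?_
      simp only [fdrift]
      rw [integral_inner (hCS.integrable_φ hS ht _ _ _)]
    rw [e1, ← integral_sub i3 i2]
    refine integral_congr_ae (Eventually.of_forall fun q => ?_)
    simp [H]
  have i4 : Integrable (fun q : ℝ × E m =>
      inner ℝ (S.gradxH q.1 (X q.1 ω) q.2 (P q.1 ω) (S.Z ω)) (X' q.1 ω - X q.1 ω))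
      (S.controlMeasure ν) := by
    have i1 := hCS.integrable_gradxH_path hS ν (hX.continuousOn ω) hPc (S.Z ω)
    have hc := (hX'.continuousOn ω).sub (hX.continuousOn ω)
    obtain ⟨M, hM⟩ := isCompact_Icc.exists_bound_of_continuousOn hc
    refine Integrable.mono' (i1.norm.mul_const M)
      (i1.aestronglyMeasurable.inner (aemeasurable_path hc ν).aestronglyMeasurable)
      ((ae_controlMeasure_mem ν).mono fun q hq => ?_)
    exact (norm_inner_le_norm _ _).trans (mul_le_mul_of_nonneg_left (hM _ hq) (norm_nonneg _))
  have e2 : ∫ q, inner ℝ (S.gradxH q.1 (X q.1 ω) q.2 (P q.1 ω) (S.Z ω)) (X' q.1 ω - X q.1 ω)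
      ∂S.controlMeasure ν
      = ∫ t in Icc 0 S.T, inner ℝ (S.bdrift ν t (X t ω) (P t ω) (S.Z ω)) (X' t ω - X t ω) := by
    rw [controlMeasure, Measure.integral_compProd i4]
    refine setIntegral_congr_fun measurableSet_Icc fun t ht => ?_
    simp only [bdrift]
    rw [real_inner_comm, ← integral_inner (hCS.integrable_gradxH hS ht _ _ _ _)]
    exact integral_congr_ae (Eventually.of_forall fun a => real_inner_comm _ _)
  have iδ := hCS.integrableOn_fdrift hS ν (hX.continuousOn ω) (S.Z ω)
  have iδ' := hCS.integrableOn_fdrift hS ν' (hX'.continuousOn ω) (S.Z ω)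
  have hii : ∀ {g : ℝ → E d}, IntegrableOn g (Icc 0 S.T) → ∀ t ∈ Icc 0 S.T,
      IntervalIntegrable g volume 0 t := fun hg t ht =>
    (intervalIntegrable_iff_integrableOn_Icc_of_le ht.1).2
      (hg.mono_set (Icc_subset_Icc_right ht.2))
  have eΔ : ∀ t ∈ Icc 0 S.T, ∫ s in (0 : ℝ)..t, (S.fdrift ν' s (X' s ω) (S.Z ω)
      - S.fdrift ν s (X s ω) (S.Z ω)) = X' t ω - X t ω := by
    intro t ht
    rw [intervalIntegral.integral_sub (hii iδ' t ht) (hii iδ t ht), hX.eq ω t ht, hX'.eq ω t ht,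
      add_sub_add_left_eq_sub]
    rfl
  -- The pairing of `∇G(X_T)` with the state increment becomes the pairing of `P` with the drift
  -- increment, minus that of `∇ₓH` with the state increment.
  have hibp := inner_integral_by_parts hT (iδ'.sub iδ)
    (hCS.integrableOn_bdrift hS ν (hX.continuousOn ω) hPc (S.Z ω))
    (gradient (fun x => S.G x (S.Z ω)) (X S.T ω))
  simp only [Pi.sub_apply] at hibp
  rw [eΔ _ ⟨hT, le_rfl⟩] at hibp
  have e3 : ∫ t in Icc 0 S.T, inner ℝ (S.bdrift ν t (X t ω) (P t ω) (S.Z ω))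
      (∫ s in (0 : ℝ)..t, (S.fdrift ν' s (X' s ω) (S.Z ω) - S.fdrift ν s (X s ω) (S.Z ω)))
      = ∫ t in Icc 0 S.T, inner ℝ (S.bdrift ν t (X t ω) (P t ω) (S.Z ω)) (X' t ω - X t ω) :=
    setIntegral_congr_fun measurableSet_Icc fun t ht => by simp only [eΔ t ht]
  have hPi : ∀ {ν : Kernel ℝ (E m)} [IsMarkovKernel ν] {X : ℝ → Ω₀ → E d}, S.IsState ν X →
      IntegrableOn (fun t => inner ℝ (P t ω) (S.fdrift ν t (X t ω) (S.Z ω))) (Icc 0 S.T) := by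
    intro ν _ X hX
    obtain ⟨M, hM⟩ := isCompact_Icc.exists_bound_of_continuousOn hPc
    have i1 := hCS.integrableOn_fdrift hS ν (hX.continuousOn ω) (S.Z ω)
    refine Integrable.mono' (i1.norm.const_mul M)
      ((hPc.aemeasurable measurableSet_Icc).aestronglyMeasurable.inner i1.aestronglyMeasurable)
      ((ae_restrict_mem measurableSet_Icc).mono fun t ht => ?_)
    exact (norm_inner_le_norm _ _).trans (mul_le_mul_of_nonneg_right (hM _ ht) (norm_nonneg _))
  have e4 : ∫ t in Icc 0 S.T, inner ℝ (gradient (fun x => S.G x (S.Z ω)) (X S.T ω)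
        + ∫ r in t..S.T, S.bdrift ν r (X r ω) (P r ω) (S.Z ω))
        (S.fdrift ν' t (X' t ω) (S.Z ω) - S.fdrift ν t (X t ω) (S.Z ω))
      = (∫ t in Icc 0 S.T, inner ℝ (P t ω) (S.fdrift ν' t (X' t ω) (S.Z ω)))
        - ∫ t in Icc 0 S.T, inner ℝ (P t ω) (S.fdrift ν t (X t ω) (S.Z ω)) := by
    rw [← integral_sub (hPi hX') (hPi hX)]
    refine setIntegral_congr_fun measurableSet_Icc fun t ht => ?_
    have h := hP.eq ω t ht
    simp only [← inner_sub_right]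
    rw [h]
    rfl
  rw [e3, e4] at hibp
  rw [hibp, e2, pathCost, pathCost, key hX h2, key hX' h2']
  ring

end Expansion

end RelaxedControl.ControlProblem

/-! ### The derivative of the cost along mixtures of controls -/

namespace RelaxedControl.ControlProblem

variable {d m : ℕ} {𝒵 : Type v} {Ω₀ : Type w} [MeasurableSpace 𝒵] [MeasurableSpace Ω₀]
  {S : ControlProblem d m 𝒵 Ω₀} {Kx Kp : Set (E d)}

theorem Bounds.H_lip {C : ℝ} (hC : S.Bounds Kx Kp C) {t : ℝ} (ht : t ∈ Icc 0 S.T) (x x' : E d)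
    (a : E m) {p : E d} (hp : p ∈ Kp) (z : 𝒵) :
    |S.H t x a p z - S.H t x' a p z| ≤ C * (1 + C) * ‖x - x'‖ := by
  have h1 := hC.L_lip t ht x x' a z
  have hC0 : 0 ≤ C := zero_le_one.trans hC.one_le
  have h2 : |inner ℝ p (S.φ t x a z - S.φ t x' a z)| ≤ C * (C * ‖x - x'‖) :=
    (abs_real_inner_le_norm _ _).trans
      (mul_le_mul (hC.p_le p hp) (hC.φ_lip t ht x x' a z) (norm_nonneg _) hC0)
  have h3 := abs_add_le (S.L t x a z - S.L t x' a z) (inner ℝ p (S.φ t x a z - S.φ t x' a z))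
  rw [inner_sub_right] at h3 h2
  rw [H, H, add_sub_add_comm]
  linarith

section Derivative

variable {C : ℝ} {ν γ : Kernel ℝ (E m)} [IsMarkovKernel ν] [IsMarkovKernel γ]
  {X P : ℝ → Ω₀ → E d} {Xε : ℝ → ℝ → Ω₀ → E d}

/-- The drift is affine in the control, so the mixture moves it by `ε` times a difference of two
drifts, at most `2 C ε`. -/
theorem StandingBounds.norm_state_mix_sub_le (hC : S.StandingBounds C) (hS : S.Standing)
    (hX : S.IsState ν X) (hXε : ∀ ε ∈ Icc (0 : ℝ) 1, S.IsState (mixKernel ε ν γ) (Xε ε)) :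
    ∃ K, 0 ≤ K ∧ ∀ ε ∈ Icc (0 : ℝ) 1, ∀ t ∈ Icc 0 S.T, ∀ ω, ‖Xε ε t ω - X t ω‖ ≤ K * ε := by
  have hC0 : 0 ≤ C := zero_le_one.trans hC.one_le
  have hT := hS.T_pos.le
  refine ⟨2 * C * S.T * Real.exp (C * S.T), by positivity, fun ε hε t ht ω => ?_⟩
  have := isMarkovKernel_mixKernel (ν := ν) (γ := γ) hε
  have h := hC.norm_state_sub_le hS ν (mixKernel ε ν γ) hX (hXε ε hε) ω
    (A := 2 * C * ε * S.T) ?_ t ht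
  · rw [norm_sub_rev]
    exact h.trans (le_of_eq (by ring))
  · have hb : ∀ r ∈ Icc 0 S.T, ‖S.fdrift ν r (X r ω) (S.Z ω)
        - S.fdrift (mixKernel ε ν γ) r (X r ω) (S.Z ω)‖ ≤ 2 * C * ε := by
      intro r hr
      have e : S.fdrift ν r (X r ω) (S.Z ω) - S.fdrift (mixKernel ε ν γ) r (X r ω) (S.Z ω)
          = ε • (S.fdrift ν r (X r ω) (S.Z ω) - S.fdrift γ r (X r ω) (S.Z ω)) := by
        rw [fdrift, fdrift, mixKernel_apply, integral_mix hε (hC.integrable_φ hS hr _ _ _)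
          (hC.integrable_φ hS hr _ _ _), fdrift, smul_sub, sub_smul, one_smul]
        abel
      rw [e, norm_smul, Real.norm_of_nonneg hε.1]
      have h1 := norm_sub_le (S.fdrift ν r (X r ω) (S.Z ω)) (S.fdrift γ r (X r ω) (S.Z ω))
      have h2 := hC.norm_fdrift_le ν hr (X r ω) (S.Z ω)
      have h3 := hC.norm_fdrift_le γ hr (X r ω) (S.Z ω)
      have h4 := mul_le_mul_of_nonneg_left (h1.trans (add_le_add h2 h3)) hε.1
      linarith
    refine (setIntegral_mono_on (g := fun _ => 2 * C * ε)
      (((hC.integrableOn_fdrift hS ν (hX.continuousOn ω) _).sub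
      (hC.integrableOn_fdrift hS _ (hX.continuousOn ω) _)).norm)
      continuousOn_const.integrableOn_Icc measurableSet_Icc hb).trans ?_
    simp [hT, mul_comm]

theorem integrable_norm_sq_mix {ε : ℝ} (hε : ε ∈ Icc (0 : ℝ) 1)
    (h2 : Integrable (fun q : ℝ × E m => ‖q.2‖ ^ 2) (S.controlMeasure ν))
    (h2' : Integrable (fun q : ℝ × E m => ‖q.2‖ ^ 2) (S.controlMeasure γ)) :
    Integrable (fun q : ℝ × E m => ‖q.2‖ ^ 2) (S.controlMeasure (mixKernel ε ν γ)) := by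
  rw [controlMeasure, compProd_mixKernel hε]
  exact (h2.smul_measure ENNReal.ofReal_ne_top).add_measure
    (h2'.smul_measure ENNReal.ofReal_ne_top)

/-- Uniformity in `ω` is the point: the constant yields integrability of the cost of the mixture and
dominates the difference quotients under the expectation. -/
theorem Bounds.abs_pathCost_mix_sub_le (hC : S.Bounds Kx Kp C) (hS : S.Standing)
    (hK : S.IsRange Kx Kp)
    (hX : S.IsState ν X) (hXε : ∀ ε ∈ Icc (0 : ℝ) 1, S.IsState (mixKernel ε ν γ) (Xε ε))
    (h2 : Integrable (fun q : ℝ × E m => ‖q.2‖ ^ 2) (S.controlMeasure ν))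
    (h2' : Integrable (fun q : ℝ × E m => ‖q.2‖ ^ 2) (S.controlMeasure γ)) :
    ∃ K, ∀ ε ∈ Icc (0 : ℝ) 1, ∀ ω,
      |S.pathCost (mixKernel ε ν γ) (Xε ε) ω - S.pathCost ν X ω| ≤ K * ε := by
  obtain ⟨K, hK0, hKε⟩ := hC.norm_state_mix_sub_le hS hX hXε
  have hC0 : 0 ≤ C := zero_le_one.trans hC.one_le
  have hT := hS.T_pos.le
  have hT' : S.T ∈ Icc 0 S.T := ⟨hT, le_rfl⟩
  set A := ∫ q, C * (1 + ‖q.2‖ ^ 2) ∂S.controlMeasure ν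
  set B := ∫ q, C * (1 + ‖q.2‖ ^ 2) ∂S.controlMeasure γ
  set N := (S.time univ).toReal
  refine ⟨C * K * N + C * K + (A + B), fun ε hε ω => ?_⟩
  have := isMarkovKernel_mixKernel (ν := ν) (γ := γ) hε
  have h2ε := integrable_norm_sq_mix (S := S) hε h2 h2'
  have i1 := hC.integrable_L_path hS (mixKernel ε ν γ) ((hXε ε hε).continuousOn ω) (S.Z ω)
    (fun t ht => hK.state_mem hS (hXε ε hε) t ht ω) h2ε
  have hXK : ∀ t ∈ Icc 0 S.T, X t ω ∈ Kx := fun t ht => hK.state_mem hS hX t ht ω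
  have i2 := hC.integrable_L_path hS (mixKernel ε ν γ) (hX.continuousOn ω) (S.Z ω) hXK h2ε
  have i3 := hC.integrable_L_path hS ν (hX.continuousOn ω) (S.Z ω) hXK h2
  have i4 := hC.integrable_L_path hS γ (hX.continuousOn ω) (S.Z ω) hXK h2'
  have e1 : |∫ q, S.L q.1 (Xε ε q.1 ω) q.2 (S.Z ω) ∂S.controlMeasure (mixKernel ε ν γ)
      - ∫ q, S.L q.1 (X q.1 ω) q.2 (S.Z ω) ∂S.controlMeasure (mixKernel ε ν γ)|
      ≤ C * (K * ε) * N := by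
    rw [← integral_sub i1 i2]
    have hb : ∀ᵐ q ∂S.controlMeasure (mixKernel ε ν γ),
        ‖S.L q.1 (Xε ε q.1 ω) q.2 (S.Z ω) - S.L q.1 (X q.1 ω) q.2 (S.Z ω)‖ ≤ C * (K * ε) :=
      (ae_controlMeasure_mem _).mono fun q hq =>
        (hC.L_lip _ hq _ _ _ _).trans (mul_le_mul_of_nonneg_left (hKε ε hε _ hq ω) hC0)
    refine (norm_integral_le_of_norm_le_const hb).trans (le_of_eq ?_)
    simp [N, measureReal_def, controlMeasure, Measure.compProd_apply_univ]
  have e2 : ∫ q, S.L q.1 (X q.1 ω) q.2 (S.Z ω) ∂S.controlMeasure (mixKernel ε ν γ)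
      = (1 - ε) • ∫ q, S.L q.1 (X q.1 ω) q.2 (S.Z ω) ∂S.controlMeasure ν
        + ε • ∫ q, S.L q.1 (X q.1 ω) q.2 (S.Z ω) ∂S.controlMeasure γ := by
    rw [← integral_mix hε i3 i4, controlMeasure, compProd_mixKernel hε]
    rfl
  have e3 : |∫ q, S.L q.1 (X q.1 ω) q.2 (S.Z ω) ∂S.controlMeasure ν| ≤ A := by
    rw [← Real.norm_eq_abs]
    exact norm_integral_le_of_norm_le (((integrable_const 1).add h2).const_mul C)
      ((ae_controlMeasure_mem ν).mono fun q hq => hC.L_le _ hq _ (hXK _ hq) _ _)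
  have e4 : |∫ q, S.L q.1 (X q.1 ω) q.2 (S.Z ω) ∂S.controlMeasure γ| ≤ B := by
    rw [← Real.norm_eq_abs]
    exact norm_integral_le_of_norm_le (((integrable_const 1).add h2').const_mul C)
      ((ae_controlMeasure_mem γ).mono fun q hq => hC.L_le _ hq _ (hXK _ hq) _ _)
  have e5 : |S.G (Xε ε S.T ω) (S.Z ω) - S.G (X S.T ω) (S.Z ω)| ≤ C * (K * ε) :=
    (hC.G_lip _ _ _).trans (mul_le_mul_of_nonneg_left (hKε ε hε _ hT' ω) hC0)
  rw [e2] at e1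
  simp only [smul_eq_mul] at e1
  rw [abs_le] at e1 e3 e4 e5 ⊢
  have e6 := mul_le_mul_of_nonneg_left e3.1 hε.1
  have e7 := mul_le_mul_of_nonneg_left e3.2 hε.1
  have e8 := mul_le_mul_of_nonneg_left e4.1 hε.1
  have e9 := mul_le_mul_of_nonneg_left e4.2 hε.1
  rw [pathCost, pathCost]
  constructor <;> linarith [e1.1, e1.2, e5.1, e5.2]

/-- The directional derivative of the cost along a path. -/
theorem Bounds.tendsto_pathCost_mix (hC : S.Bounds Kx Kp C) (hS : S.Standing)
    (hK : S.IsRange Kx Kp) (hX : S.IsState ν X) (hP : S.IsAdjoint ν X P)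
    (hXε : ∀ ε ∈ Icc (0 : ℝ) 1, S.IsState (mixKernel ε ν γ) (Xε ε))
    (h2 : Integrable (fun q : ℝ × E m => ‖q.2‖ ^ 2) (S.controlMeasure ν))
    (h2' : Integrable (fun q : ℝ × E m => ‖q.2‖ ^ 2) (S.controlMeasure γ)) (ω : Ω₀) :
    Tendsto (fun ε => (S.pathCost (mixKernel ε ν γ) (Xε ε) ω - S.pathCost ν X ω) / ε) (𝓝[>] 0)
      (𝓝 (∫ q, S.H q.1 (X q.1 ω) q.2 (P q.1 ω) (S.Z ω) ∂S.controlMeasure γ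
        - ∫ q, S.H q.1 (X q.1 ω) q.2 (P q.1 ω) (S.Z ω) ∂S.controlMeasure ν)) := by
  obtain ⟨K, hK0, hKε⟩ := hC.norm_state_mix_sub_le hS hX hXε
  have hC0 : 0 ≤ C := zero_le_one.trans hC.one_le
  have hT' : S.T ∈ Icc 0 S.T := ⟨hS.T_pos.le, le_rfl⟩
  have hPK : ∀ t ∈ Icc 0 S.T, P t ω ∈ Kp := fun t ht => (hK.mem ν X P hX hP t ht ω).2
  have hPc := hP.continuousOn ω
  have hev : ∀ᶠ ε in 𝓝[>] (0 : ℝ), ε ∈ Ioc (0 : ℝ) 1 := by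
    filter_upwards [Ioc_mem_nhdsGT (zero_lt_one : (0 : ℝ) < 1)] with ε hε using hε
  have hid : Tendsto id (𝓝[>] (0 : ℝ)) (𝓝 0) := tendsto_id'.2 nhdsWithin_le_nhds
  have hIcc : ∀ {ε : ℝ}, ε ∈ Ioc (0 : ℝ) 1 → ε ∈ Icc (0 : ℝ) 1 := fun h => Ioc_subset_Icc_self h
  have hXεK : ∀ ε ∈ Icc (0 : ℝ) 1, ∀ t ∈ Icc 0 S.T, Xε ε t ω ∈ Kx := by
    intro ε hε t ht
    have := isMarkovKernel_mixKernel (ν := ν) (γ := γ) hε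
    exact hK.state_mem hS (hXε ε hε) t ht ω
  have hXK : ∀ t ∈ Icc 0 S.T, X t ω ∈ Kx := fun t ht => hK.state_mem hS hX t ht ω
  have hHt : ∀ {η : Kernel ℝ (E m)} [IsMarkovKernel η],
      Integrable (fun q : ℝ × E m => ‖q.2‖ ^ 2) (S.controlMeasure η) →
      Tendsto (fun ε => ∫ q, S.H q.1 (Xε ε q.1 ω) q.2 (P q.1 ω) (S.Z ω) ∂S.controlMeasure η)
        (𝓝[>] 0) (𝓝 (∫ q, S.H q.1 (X q.1 ω) q.2 (P q.1 ω) (S.Z ω) ∂S.controlMeasure η)) := by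
    intro η _ hη
    refine tendsto_integral_filter_of_dominated_convergence (fun q => C * (1 + ‖q.2‖ ^ 2))
      (hev.mono fun ε hε => hS.aestronglyMeasurable_H_path η ((hXε ε (hIcc hε)).continuousOn ω)
        hPc _) (hev.mono fun ε hε => (ae_controlMeasure_mem η).mono fun q hq =>
        hC.H_le _ hq _ (hXεK ε (hIcc hε) _ hq) _ (hPK _ hq) _ _)
      (((integrable_const 1).add hη).const_mul C) ((ae_controlMeasure_mem η).mono fun q hq => ?_)
    refine tendsto_iff_norm_sub_tendsto_zero.2 ?_
    refine squeeze_zero' (Eventually.of_forall fun ε => norm_nonneg _)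
      (hev.mono fun ε hε => (hC.H_lip hq _ _ _ (hPK _ hq) _).trans
        (mul_le_mul_of_nonneg_left (hKε ε (hIcc hε) _ hq ω) (by positivity))) ?_
    have := (hid.const_mul K).const_mul (C * (1 + C))
    simpa using this
  set g : ℝ × E m → E d := fun q => S.gradxH q.1 (X q.1 ω) q.2 (P q.1 ω) (S.Z ω)
  -- The remainder in the state, divided by `ε`, vanishes pointwise by differentiability and is
  -- bounded because the state moves by `O(ε)`. No second derivative in `x` is used.
  have hR : Tendsto (fun ε => ∫ q, (S.H q.1 (Xε ε q.1 ω) q.2 (P q.1 ω) (S.Z ω)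
      - S.H q.1 (X q.1 ω) q.2 (P q.1 ω) (S.Z ω) - inner ℝ (g q) (Xε ε q.1 ω - X q.1 ω)) / ε
      ∂S.controlMeasure ν) (𝓝[>] 0) (𝓝 0) := by
    suffices h : Tendsto (fun ε => ∫ q, (S.H q.1 (Xε ε q.1 ω) q.2 (P q.1 ω) (S.Z ω)
      - S.H q.1 (X q.1 ω) q.2 (P q.1 ω) (S.Z ω) - inner ℝ (g q) (Xε ε q.1 ω - X q.1 ω)) / ε
      ∂S.controlMeasure ν) (𝓝[>] 0) (𝓝 (∫ q, (0 : ℝ) ∂S.controlMeasure ν)) by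
      rwa [integral_zero] at h
    refine tendsto_integral_filter_of_dominated_convergence
      (fun q => C * (1 + C) * K + C * (1 + C) * K) ?_ ?_ (integrable_const _) ?_
    · refine hev.mono fun ε hε => ?_
      have hc := ((hXε ε (hIcc hε)).continuousOn ω).sub (hX.continuousOn ω)
      simp only [div_eq_mul_inv]
      exact AEStronglyMeasurable.mul_const
        (((hS.aestronglyMeasurable_H_path ν ((hXε ε (hIcc hε)).continuousOn ω) hPc _).sub
        (hS.aestronglyMeasurable_H_path ν (hX.continuousOn ω) hPc _)).sub
        ((hS.aestronglyMeasurable_gradxH_path ν (hX.continuousOn ω) hPc _).inner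
          (aemeasurable_path hc ν).aestronglyMeasurable)) _
    · refine hev.mono fun ε hε => (ae_controlMeasure_mem ν).mono fun q hq => ?_
      rw [norm_div, Real.norm_of_nonneg hε.1.le, div_le_iff₀ hε.1]
      have h1 := hKε ε (hIcc hε) _ hq ω
      have h2 := (hC.H_lip hq (Xε ε q.1 ω) (X q.1 ω) q.2 (hPK _ hq) (S.Z ω)).trans
        (mul_le_mul_of_nonneg_left h1 (by positivity))
      have h3 : ‖g q‖ ≤ C * (1 + C) := (hC.gradxH_le _ hq _ _ _ _).trans
        (mul_le_mul_of_nonneg_left (by linarith [hC.p_le _ (hPK _ hq)]) hC0)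
      have h4 : |inner ℝ (g q) (Xε ε q.1 ω - X q.1 ω)| ≤ C * (1 + C) * (K * ε) :=
        (abs_real_inner_le_norm _ _).trans (mul_le_mul h3 h1 (norm_nonneg _) (by positivity))
      refine (norm_sub_le _ _).trans ?_
      simp only [Real.norm_eq_abs]
      linarith
    · refine (ae_controlMeasure_mem ν).mono fun q hq => ?_
      have h := tendsto_remainder_div (f := fun x => S.H q.1 x q.2 (P q.1 ω) (S.Z ω))
        ((hS.contDiff_H_x hq _ _ _).differentiable one_ne_zero (X q.1 ω))
        (Δ := fun ε => Xε ε q.1 ω - X q.1 ω) (C := K) hid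
        (hev.mono fun ε hε => by rw [abs_of_pos hε.1]; exact hKε ε (hIcc hε) _ hq ω)
      simp only [add_sub_cancel] at h
      exact h
  have hG := tendsto_remainder_div (f := fun x => S.G x (S.Z ω))
    ((hS.contDiff_G _).differentiable one_ne_zero (X S.T ω))
    (Δ := fun ε => Xε ε S.T ω - X S.T ω) (C := K) hid
    (hev.mono fun ε hε => by rw [abs_of_pos hε.1]; exact hKε ε (hIcc hε) _ hT' ω)
  simp only [add_sub_cancel] at hG
  -- Integration of `H` is linear in the control, so the quotient equals the difference of its
  -- integrals against `γ` and `ν` along the perturbed state, plus two vanishing remainders.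
  have hlim := ((hHt h2').sub (hHt h2)).add (hR.add hG)
  rw [add_zero, add_zero] at hlim
  refine hlim.congr' (hev.mono fun ε hε => ?_)
  have := isMarkovKernel_mixKernel (ν := ν) (γ := γ) (hIcc hε)
  have h2ε := integrable_norm_sq_mix (S := S) (hIcc hε) h2 h2'
  have hXc := (hXε ε (hIcc hε)).continuousOn ω
  have i1 := hC.integrable_H_path hS ν hXc hPc (S.Z ω) (hXεK ε (hIcc hε)) hPK h2
  have i2 := hC.integrable_H_path hS γ hXc hPc (S.Z ω) (hXεK ε (hIcc hε)) hPK h2'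
  have i3 := hC.integrable_H_path hS ν (hX.continuousOn ω) hPc (S.Z ω) hXK hPK h2
  have i4 : Integrable (fun q : ℝ × E m => inner ℝ (g q) (Xε ε q.1 ω - X q.1 ω))
      (S.controlMeasure ν) := by
    have hg := hC.integrable_gradxH_path hS ν (hX.continuousOn ω) hPc (S.Z ω)
    have hc := hXc.sub (hX.continuousOn ω)
    refine Integrable.mono' (hg.norm.mul_const (K * ε))
      (hg.aestronglyMeasurable.inner (aemeasurable_path hc ν).aestronglyMeasurable)
      ((ae_controlMeasure_mem ν).mono fun q hq => ?_)
    exact (norm_inner_le_norm _ _).trans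
      (mul_le_mul_of_nonneg_left (hKε ε (hIcc hε) _ hq ω) (norm_nonneg _))
  have e1 : ∫ q, S.H q.1 (Xε ε q.1 ω) q.2 (P q.1 ω) (S.Z ω) ∂S.controlMeasure (mixKernel ε ν γ)
      = (1 - ε) • ∫ q, S.H q.1 (Xε ε q.1 ω) q.2 (P q.1 ω) (S.Z ω) ∂S.controlMeasure ν
        + ε • ∫ q, S.H q.1 (Xε ε q.1 ω) q.2 (P q.1 ω) (S.Z ω) ∂S.controlMeasure γ := by
    rw [← integral_mix (hIcc hε) i1 i2, controlMeasure, compProd_mixKernel (hIcc hε)]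
    rfl
  beta_reduce
  rw [hC.pathCost_sub hS hK hX (hXε ε (hIcc hε)) hP h2 h2ε ω, e1, integral_div,
    show (∫ q, (S.H q.1 (Xε ε q.1 ω) q.2 (P q.1 ω) (S.Z ω)
      - S.H q.1 (X q.1 ω) q.2 (P q.1 ω) (S.Z ω) - inner ℝ (g q) (Xε ε q.1 ω - X q.1 ω))
      ∂S.controlMeasure ν) = _ from integral_sub (i1.sub i3) i4,
    show (∫ q, _ ∂S.controlMeasure ν) = _ from integral_sub i1 i3]
  have hε0 : ε ≠ 0 := hε.1.ne'
  simp only [smul_eq_mul, g]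
  field_simp
  ring

end Derivative

end RelaxedControl.ControlProblem

theorem extIntegral_congr_ae {α : Type*} [MeasurableSpace α] {μ : Measure α} {f g : α → EReal}
    (h : f =ᵐ[μ] g) : extIntegral μ f = extIntegral μ g := by
  have h1 : ∫⁻ x, (f x).toENNReal ∂μ = ∫⁻ x, (g x).toENNReal ∂μ :=
    lintegral_congr_ae (h.mono fun x hx => by simp only [hx])
  have h2 : ∫⁻ x, (-f x).toENNReal ∂μ = ∫⁻ x, (-g x).toENNReal ∂μ :=
    lintegral_congr_ae (h.mono fun x hx => by simp only [hx])
  simp only [extIntegral, h1, h2]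

theorem extIntegral_coe_eq_top {α : Type*} [MeasurableSpace α] {μ : Measure α} {f : α → ℝ}
    (h : ∫⁻ x, ENNReal.ofReal (f x) ∂μ = ⊤) : extIntegral μ (fun x => (f x : EReal)) = ⊤ :=
  if_pos h

/-! ### The objective and its directional derivatives -/

namespace RelaxedControl.ControlProblem

variable {d m : ℕ} {𝒵 : Type v} {Ω₀ : Type w} [MeasurableSpace 𝒵] [MeasurableSpace Ω₀]
  {S : ControlProblem d m 𝒵 Ω₀} {Kx Kp : Set (E d)}

/-- The forward and adjoint processes of `ν`, in versions that are continuous in time and jointly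
measurable. -/
structure IsRegularPair (S : ControlProblem d m 𝒵 Ω₀) (ν : Kernel ℝ (E m))
    (X P : ℝ → Ω₀ → E d) : Prop where
  isState : S.IsState ν X
  isAdjoint : S.IsAdjoint ν X P
  measurable_state : Measurable (Function.uncurry X)
  measurable_adjoint : Measurable (Function.uncurry P)
  continuous_state : ∀ ω, Continuous fun t => X t ω
  continuous_adjoint : ∀ ω, Continuous fun t => P t ω

theorem Standing.exists_isRegularPair (hS : S.Standing) (ν : Kernel ℝ (E m)) [IsMarkovKernel ν] :
    ∃ X P, S.IsRegularPair ν X P := by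
  obtain ⟨C, hC⟩ := hS.exists_bounds.exists
  obtain ⟨X, P, h1, h2, h3, h4, h5, h6⟩ := hC.exists_regular hS ν
  exact ⟨X, P, h1, h2, h3, h4, h5, h6⟩

/-- The averaged Hamiltonian `𝖤[H(t, X_t, a, P_t, Z)]`. -/
noncomputable def meanH (S : ControlProblem d m 𝒵 Ω₀) (X P : ℝ → Ω₀ → E d) (t : ℝ) (a : E m) : ℝ :=
  ∫ ω, S.H t (X t ω) a (P t ω) (S.Z ω) ∂S.P

section Objective

variable {C : ℝ} {ν γ : Kernel ℝ (E m)} [IsMarkovKernel ν] [IsMarkovKernel γ]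
  {X P : ℝ → Ω₀ → E d}

theorem Standing.pathCost_congr (hS : S.Standing) {X' : ℝ → Ω₀ → E d}
    (h : ∀ t ∈ Icc 0 S.T, ∀ ω, X t ω = X' t ω) : S.pathCost ν X = S.pathCost ν X' := by
  ext ω
  rw [pathCost, pathCost, h _ ⟨hS.T_pos.le, le_rfl⟩]
  congr 1
  exact integral_congr_ae ((ae_controlMeasure_mem ν).mono fun q hq => by simp only [h _ hq])

theorem Standing.aestronglyMeasurable_pathCost (hS : S.Standing) (hX : S.IsState ν X) :
    AEStronglyMeasurable (S.pathCost ν X) S.P := by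
  obtain ⟨C, hC⟩ := hS.exists_bounds.exists
  obtain ⟨Y, Q, hY⟩ := hS.exists_isRegularPair ν
  rw [hS.pathCost_congr (hC.state_unique hS ν hX hY.isState)]
  have hZ := hS.measurable_Z
  have hYm := hY.measurable_state
  have h1 : Measurable fun z : Ω₀ × (ℝ × E m) => S.L z.2.1 (Y z.2.1 z.1) z.2.2 (S.Z z.1) := by
    have : Measurable fun z : Ω₀ × (ℝ × E m) =>
      (z.2.1, Function.uncurry Y (z.2.1, z.1), z.2.2, S.Z z.1) := by fun_prop
    exact hS.measurable_L.comp this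
  have h2 : Measurable fun ω => S.G (Y S.T ω) (S.Z ω) := by
    have : Measurable fun ω => (Function.uncurry Y (S.T, ω), S.Z ω) := by fun_prop
    exact hS.measurable_G.comp this
  exact (h1.stronglyMeasurable.integral_prod_right'.measurable.add h2).aestronglyMeasurable

/-- For a control with a finite second moment the objective is the expectation of the cost. -/
theorem Bounds.V_eq (hC : S.Bounds Kx Kp C) (hS : S.Standing) (hK : S.IsRange Kx Kp)
    (hX : S.IsState ν X)
    (h2 : Integrable (fun q : ℝ × E m => ‖q.2‖ ^ 2) (S.controlMeasure ν)) :
    S.V ν = extIntegral S.P fun ω => (S.pathCost ν X ω : EReal) := by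
  rw [V]
  congr 1
  ext ω
  rw [hS.state_eq hX _ ⟨hS.T_pos.le, le_rfl⟩, extIntegral_congr_ae
    (g := fun q => ((S.L q.1 (X q.1 ω) q.2 (S.Z ω) : ℝ) : EReal))
    ((ae_controlMeasure_mem ν).mono fun q hq => by simp only [hS.state_eq hX _ hq]),
    extIntegral_coe_of_integrable (hC.integrable_L_path hS ν (hX.continuousOn ω) (S.Z ω)
      (fun t ht => hK.state_mem hS hX t ht ω) h2), ← EReal.coe_add]
  rfl

/-- Coercivity of `L`: an infinite second moment makes the inner integral `+∞` for every `ω`, and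
then the objective as well. -/
theorem Bounds.integrable_norm_sq_of_V (hC : S.Bounds Kx Kp C) (hS : S.Standing)
    (hK : S.IsRange Kx Kp) (hV : S.V ν ≠ ⊤) :
    Integrable (fun q : ℝ × E m => ‖q.2‖ ^ 2) (S.controlMeasure ν) := by
  have := hS.isProb
  have hC0 : 0 ≤ C := zero_le_one.trans hC.one_le
  obtain ⟨X, P, hXP⟩ := hS.exists_isRegularPair ν
  have hX := hXP.isState
  by_contra hcon
  have h1 : ∫⁻ q : ℝ × E m, ENNReal.ofReal (‖q.2‖ ^ 2) ∂S.controlMeasure ν = ⊤ := by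
    by_contra h
    refine hcon ⟨by fun_prop, ?_⟩
    rw [hasFiniteIntegral_iff_ofReal (Eventually.of_forall fun q => by positivity)]
    exact lt_top_iff_ne_top.2 h
  have h2 : ∀ ω, ∫⁻ q, ENNReal.ofReal (S.L q.1 (S.state ν q.1 ω) q.2 (S.Z ω))
      ∂S.controlMeasure ν = ⊤ := by
    intro ω
    by_contra h
    refine (lt_top_iff_ne_top.2 ?_ : (_ : ℝ≥0∞) < ⊤).ne h1
    refine ne_top_of_le_ne_top (b := ENNReal.ofReal C * ((∫⁻ q,
      ENNReal.ofReal (S.L q.1 (S.state ν q.1 ω) q.2 (S.Z ω)) ∂S.controlMeasure ν)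
      + ENNReal.ofReal C * S.controlMeasure ν univ)) ?_ ?_
    · exact ENNReal.mul_ne_top ENNReal.ofReal_ne_top (ENNReal.add_ne_top.2
        ⟨h, ENNReal.mul_ne_top ENNReal.ofReal_ne_top (measure_ne_top _ _)⟩)
    · rw [← lintegral_const, ← lintegral_add_right _ measurable_const,
        ← lintegral_const_mul' _ _ ENNReal.ofReal_ne_top]
      refine lintegral_mono_ae ((ae_controlMeasure_mem ν).mono fun q hq => ?_)
      refine (ENNReal.ofReal_le_ofReal (hC.L_ge _ hq (S.state ν q.1 ω) ?_ (S.Z ω) q.2)).trans ?_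
      · rw [hS.state_eq hX _ hq]
        exact hK.state_mem hS hX _ hq ω
      · rw [ENNReal.ofReal_mul hC0]
        gcongr
        exact ENNReal.ofReal_add_le
  apply hV
  have h3 : ∀ ω, extIntegral (S.controlMeasure ν)
      (fun q => ((S.L q.1 (S.state ν q.1 ω) q.2 (S.Z ω) : ℝ) : EReal))
      + ((S.G (S.state ν S.T ω) (S.Z ω) : ℝ) : EReal) = ⊤ := by
    intro ω
    rw [extIntegral_coe_eq_top (h2 ω), EReal.top_add_coe]
  simp only [V, h3]
  simp [extIntegral]

/-- The upper hypothesis excludes `⊤` and the lower bound on `V` excludes `⊥`. -/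
theorem Bounds.integrable_pathCost (hC : S.Bounds Kx Kp C) (hS : S.Standing) (hK : S.IsRange Kx Kp)
    (hV : S.BoundedBelow) (hV' : S.V ν ≠ ⊤) (hX : S.IsState ν X) :
    Integrable (S.pathCost ν X) S.P := by
  have h2 := hC.integrable_norm_sq_of_V hS hK hV'
  obtain ⟨c, hc⟩ := hV
  have h3 := hc ν
  rw [hC.V_eq hS hK hX h2] at hV' h3
  exact integrable_of_extIntegral (hS.aestronglyMeasurable_pathCost hX) hV'
    (ne_bot_of_le_ne_bot (EReal.coe_ne_bot c) h3)

theorem IsRegularPair.measurable_H (hXP : S.IsRegularPair ν X P) (hS : S.Standing) :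
    Measurable fun z : Ω₀ × (ℝ × E m) =>
      S.H z.2.1 (X z.2.1 z.1) z.2.2 (P z.2.1 z.1) (S.Z z.1) := by
  have hZ := hS.measurable_Z
  have hXm := hXP.measurable_state
  have hPm := hXP.measurable_adjoint
  have : Measurable fun z : Ω₀ × (ℝ × E m) => (z.2.1, Function.uncurry X (z.2.1, z.1), z.2.2,
    Function.uncurry P (z.2.1, z.1), S.Z z.1) := by fun_prop
  exact hS.measurable_H.comp this

theorem IsRegularPair.measurable_meanH (hXP : S.IsRegularPair ν X P) (hS : S.Standing) :
    Measurable fun q : ℝ × E m => S.meanH X P q.1 q.2 := by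
  have := hS.isProb
  exact (((hXP.measurable_H hS).comp measurable_swap).stronglyMeasurable.integral_prod_right').measurable

/-- Quadratic growth and the second moment justify Fubini. The processes belong to `ν`, while `γ` is
only the measure of integration; this lets both terms of the directional derivative be written with
one averaged Hamiltonian. -/
theorem Bounds.integral_integral_H (hC : S.Bounds Kx Kp C) (hS : S.Standing)
    (hK : S.IsRange Kx Kp) (hXP : S.IsRegularPair ν X P)
    (h2 : Integrable (fun q : ℝ × E m => ‖q.2‖ ^ 2) (S.controlMeasure γ)) :
    Integrable (fun ω => ∫ q, S.H q.1 (X q.1 ω) q.2 (P q.1 ω) (S.Z ω) ∂S.controlMeasure γ) S.P ∧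
    Integrable (fun q => S.meanH X P q.1 q.2) (S.controlMeasure γ) ∧
    ∫ ω, (∫ q, S.H q.1 (X q.1 ω) q.2 (P q.1 ω) (S.Z ω) ∂S.controlMeasure γ) ∂S.P
      = ∫ q, S.meanH X P q.1 q.2 ∂S.controlMeasure γ := by
  have := hS.isProb
  have hi : Integrable (fun z : Ω₀ × (ℝ × E m) =>
      S.H z.2.1 (X z.2.1 z.1) z.2.2 (P z.2.1 z.1) (S.Z z.1)) (S.P.prod (S.controlMeasure γ)) := by
    have hb : Integrable (fun z : Ω₀ × (ℝ × E m) => C * (1 + ‖z.2.2‖ ^ 2))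
        (S.P.prod (S.controlMeasure γ)) :=
      (((integrable_const 1).add h2).const_mul C).comp_snd S.P
    refine Integrable.mono' hb (hXP.measurable_H hS).aestronglyMeasurable ?_
    have h1 : ∀ᵐ z ∂S.P.prod (S.controlMeasure γ), z.2.1 ∈ Icc 0 S.T :=
      Measure.quasiMeasurePreserving_snd.ae (ae_controlMeasure_mem γ)
    refine h1.mono fun z hz => ?_
    have h3 := hK.mem ν X P hXP.isState hXP.isAdjoint _ hz z.1
    exact hC.H_le _ hz _ h3.1 _ h3.2 _ _
  exact ⟨hi.integral_prod_left, hi.integral_prod_right, integral_integral_swap hi⟩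

/-- The directional derivatives of the objective. -/
theorem Bounds.exists_tendsto_V_mix (hC : S.Bounds Kx Kp C) (hS : S.Standing)
    (hK : S.IsRange Kx Kp) (hXP : S.IsRegularPair ν X P) (hV : S.BoundedBelow) (hV' : S.V ν ≠ ⊤)
    (h2' : Integrable (fun q : ℝ × E m => ‖q.2‖ ^ 2) (S.controlMeasure γ)) :
    ∃ (J₀ : ℝ) (J : ℝ → ℝ), S.V ν = J₀ ∧
      (∀ ε ∈ Icc (0 : ℝ) 1, S.V (mixKernel ε ν γ) = J ε) ∧
      Tendsto (fun ε => (J ε - J₀) / ε) (𝓝[>] 0)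
        (𝓝 (∫ q, S.meanH X P q.1 q.2 ∂S.controlMeasure γ
          - ∫ q, S.meanH X P q.1 q.2 ∂S.controlMeasure ν)) := by
  have := hS.isProb
  have h2 := hC.integrable_norm_sq_of_V hS hK hV'
  have hi := hC.integrable_pathCost hS hK hV hV' hXP.isState
  have hex : ∀ ε : ℝ, ∃ Y : ℝ → Ω₀ → E d, ε ∈ Icc (0 : ℝ) 1 → S.IsState (mixKernel ε ν γ) Y := by
    intro ε
    by_cases hε : ε ∈ Icc (0 : ℝ) 1
    · have := isMarkovKernel_mixKernel (ν := ν) (γ := γ) hε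
      obtain ⟨Y, Q, hY⟩ := hS.exists_isRegularPair (mixKernel ε ν γ)
      exact ⟨Y, fun _ => hY.isState⟩
    · exact ⟨X, fun h => absurd h hε⟩
  choose Xε hXε using hex
  obtain ⟨K, hKb⟩ := hC.abs_pathCost_mix_sub_le hS hK hXP.isState hXε h2 h2'
  have hiε : ∀ ε ∈ Icc (0 : ℝ) 1, Integrable (S.pathCost (mixKernel ε ν γ) (Xε ε)) S.P := by
    intro ε hε
    have := isMarkovKernel_mixKernel (ν := ν) (γ := γ) hε
    have h3 : Integrable (fun ω => S.pathCost (mixKernel ε ν γ) (Xε ε) ω - S.pathCost ν X ω) S.P :=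
      Integrable.of_bound ((hS.aestronglyMeasurable_pathCost (hXε ε hε)).sub hi.aestronglyMeasurable)
        (K * ε) (Eventually.of_forall (hKb ε hε))
    exact (h3.add hi).congr (Eventually.of_forall fun ω => by simp)
  refine ⟨∫ ω, S.pathCost ν X ω ∂S.P, fun ε => ∫ ω, S.pathCost (mixKernel ε ν γ) (Xε ε) ω ∂S.P,
    ?_, fun ε hε => ?_, ?_⟩
  · rw [hC.V_eq hS hK hXP.isState h2, extIntegral_coe_of_integrable hi]
  · have := isMarkovKernel_mixKernel (ν := ν) (γ := γ) hε
    rw [hC.V_eq hS hK (hXε ε hε) (integrable_norm_sq_mix hε h2 h2'),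
      extIntegral_coe_of_integrable (hiε ε hε)]
  · have hev : ∀ᶠ ε in 𝓝[>] (0 : ℝ), ε ∈ Ioc (0 : ℝ) 1 := by
      filter_upwards [Ioc_mem_nhdsGT (zero_lt_one : (0 : ℝ) < 1)] with ε hε using hε
    obtain ⟨i1, -, e1⟩ := hC.integral_integral_H hS hK hXP h2'
    obtain ⟨i2, -, e2⟩ := hC.integral_integral_H hS hK hXP h2
    rw [← e1, ← e2, ← integral_sub i1 i2]
    have hlim := tendsto_integral_filter_of_dominated_convergence (μ := S.P)
      (F := fun ε ω => (S.pathCost (mixKernel ε ν γ) (Xε ε) ω - S.pathCost ν X ω) / ε)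
      (fun _ => K) (hev.mono fun ε hε => by
        simp only [div_eq_mul_inv]
        exact ((hiε ε (Ioc_subset_Icc_self hε)).aestronglyMeasurable.sub
          hi.aestronglyMeasurable).mul_const _)
      (hev.mono fun ε hε => Eventually.of_forall fun ω => by
        rw [norm_div, Real.norm_of_nonneg hε.1.le, div_le_iff₀ hε.1]
        exact hKb ε (Ioc_subset_Icc_self hε) ω) (integrable_const K)
      (Eventually.of_forall fun ω =>
        hC.tendsto_pathCost_mix hS hK hXP.isState hXP.isAdjoint hXε h2 h2' ω)
    refine hlim.congr' (hev.mono fun ε hε => ?_)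
    rw [integral_div, integral_sub (hiε ε (Ioc_subset_Icc_self hε)) hi]

end Objective

end RelaxedControl.ControlProblem

/-! ### Densities of kernels and their entropy -/

/-- Derivatives chosen separately for each `t` need not be jointly measurable, whereas those of
kernels are. The detour through the equivalent finite measure `μ.toFinite` provides a finite
reference kernel. -/
theorem exists_measurable_density {α β : Type*} [MeasurableSpace α] [MeasurableSpace β]
    [MeasurableSpace.CountableOrCountablyGenerated α β] (κ : Kernel α β) [IsFiniteKernel κ]
    (μ : Measure β) [SigmaFinite μ] :
    MeasurableSet {t | κ t ≪ μ} ∧ ∃ ρ : α × β → ℝ, Measurable ρ ∧ (∀ q, 0 ≤ ρ q) ∧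
      ∀ t, κ t ≪ μ → κ t = μ.withDensity fun a => ENNReal.ofReal (ρ (t, a)) := by
  set g := μ.toFinite
  set η : Kernel α β := Kernel.const α g
  have hiff : ∀ t, κ t ≪ μ ↔ κ t ≪ η t := fun t =>
    ⟨fun h => h.trans (absolutelyContinuous_toFinite μ),
      fun h => h.trans (toFinite_absolutelyContinuous μ)⟩
  refine ⟨by simpa only [hiff] using Kernel.measurableSet_absolutelyContinuous κ η,
    fun q => (g.rnDeriv μ q.2 * Kernel.rnDeriv κ η q.1 q.2).toReal, ?_,
    fun q => ENNReal.toReal_nonneg, fun t ht => ?_⟩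
  · exact (((Measure.measurable_rnDeriv g μ).comp measurable_snd).mul
      (Kernel.measurable_rnDeriv κ η)).ennreal_toReal
  · have h1 : g.withDensity (Kernel.rnDeriv κ η t) = κ t := by
      change (η t).withDensity (Kernel.rnDeriv κ η t) = κ t
      rw [withDensity_congr_ae (Kernel.rnDeriv_eq_rnDeriv_measure (κ := κ) (η := η) (a := t))]
      exact Measure.withDensity_rnDeriv_eq _ _ ((hiff t).1 ht)
    have h2 : μ.withDensity (g.rnDeriv μ) = g :=
      Measure.withDensity_rnDeriv_eq _ _ (toFinite_absolutelyContinuous μ)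
    have h3 : μ.withDensity (g.rnDeriv μ * Kernel.rnDeriv κ η t) = κ t := by
      rw [withDensity_mul _ (Measure.measurable_rnDeriv g μ)
        (Kernel.measurable_rnDeriv_right κ η t), h2, h1]
    rw [← h3]
    refine withDensity_congr_ae ?_
    have h4 : ∀ᵐ a ∂μ, g.rnDeriv μ a < ⊤ := Measure.rnDeriv_lt_top g μ
    have h5 : ∀ᵐ a ∂μ, Kernel.rnDeriv κ η t a < ⊤ :=
      (absolutelyContinuous_toFinite μ).ae_le (Kernel.rnDeriv_lt_top κ η (a := t))
    filter_upwards [h4, h5] with a ha hb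
    rw [Pi.mul_apply, ENNReal.ofReal_toReal (ENNReal.mul_lt_top ha hb).ne]

theorem entropy_withDensity {m : ℕ} {ρ : E m → ℝ} (hρ : Measurable ρ) (h0 : ∀ a, 0 ≤ ρ a) :
    entropy (volume.withDensity fun a => ENNReal.ofReal (ρ a))
      = extIntegral volume fun a => ((ρ a * Real.log (ρ a) : ℝ) : EReal) := by
  rw [entropy, if_pos (withDensity_absolutelyContinuous _ _)]
  refine extIntegral_congr_ae ?_
  filter_upwards [Measure.rnDeriv_withDensity (volume : Measure (E m)) hρ.ennreal_ofReal] with a ha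
  rw [ha, ENNReal.toReal_ofReal (h0 a)]

/-- The negative part of `r ln r` is controlled by a moment and a constant. -/
theorem neg_mul_log_le {r s : ℝ} (hr : 0 ≤ r) : -(r * Real.log r) ≤ r * s + Real.exp (-s) := by
  rcases hr.eq_or_lt with rfl | hr
  · simp [(Real.exp_pos _).le]
  · have h1 := Real.add_one_le_exp (-s - Real.log r)
    have h2 : r * Real.exp (-s - Real.log r) = Real.exp (-s) := by
      rw [Real.exp_sub, Real.exp_log hr]
      field_simp
    have h3 := mul_le_mul_of_nonneg_left h1 hr.le
    rw [h2] at h3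
    linarith

/-! ### Joint densities of controls and the integrated entropy -/

namespace RelaxedControl.ControlProblem

variable {d m : ℕ} {𝒵 : Type v} {Ω₀ : Type w} [MeasurableSpace 𝒵] [MeasurableSpace Ω₀]
  {S : ControlProblem d m 𝒵 Ω₀} {Kx Kp : Set (E d)}

/-- `ρ` is a joint density of the kernel `ν` with respect to the Lebesgue measure. -/
structure HasDensity (S : ControlProblem d m 𝒵 Ω₀) (ν : Kernel ℝ (E m)) (ρ : ℝ × E m → ℝ) :
    Prop where
  measurable : Measurable ρ
  nonneg : ∀ q, 0 ≤ ρ q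
  ae_eq : ∀ᵐ t ∂S.time, ν t = volume.withDensity fun a => ENNReal.ofReal (ρ (t, a))

section Density

variable {ν γ : Kernel ℝ (E m)} [IsMarkovKernel ν] [IsMarkovKernel γ] {ρ g : ℝ × E m → ℝ}

theorem HasDensity.controlMeasure_eq (hρ : S.HasDensity ν ρ) :
    S.controlMeasure ν = (S.time.prod volume).withDensity fun q => ENNReal.ofReal (ρ q) := by
  ext s hs
  rw [controlMeasure, Measure.compProd_apply hs, withDensity_apply _ hs,
    ← lintegral_indicator hs, lintegral_prod _
      ((hρ.measurable.ennreal_ofReal.indicator hs).aemeasurable)]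
  refine lintegral_congr_ae (hρ.ae_eq.mono fun t ht => ?_)
  simp only [ht]
  rw [withDensity_apply _ (measurable_prodMk_left hs),
    ← lintegral_indicator (measurable_prodMk_left hs)]
  rfl

theorem HasDensity.integrable_iff (hρ : S.HasDensity ν ρ) {f : ℝ × E m → ℝ} :
    Integrable f (S.controlMeasure ν)
      ↔ Integrable (fun q => ρ q * f q) (S.time.prod volume) := by
  rw [hρ.controlMeasure_eq, integrable_withDensity_iff_integrable_smul'
    hρ.measurable.ennreal_ofReal (Eventually.of_forall fun _ => ENNReal.ofReal_lt_top)]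
  simp only [ENNReal.toReal_ofReal (hρ.nonneg _), smul_eq_mul]

theorem HasDensity.integral_eq (hρ : S.HasDensity ν ρ) (f : ℝ × E m → ℝ) :
    ∫ q, f q ∂S.controlMeasure ν = ∫ q, ρ q * f q ∂(S.time.prod volume) := by
  rw [hρ.controlMeasure_eq, integral_withDensity_eq_integral_toReal_smul
    hρ.measurable.ennreal_ofReal (Eventually.of_forall fun _ => ENNReal.ofReal_lt_top)]
  simp only [ENNReal.toReal_ofReal (hρ.nonneg _), smul_eq_mul]

theorem HasDensity.integrable (hρ : S.HasDensity ν ρ) : Integrable ρ (S.time.prod volume) := by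
  have h := hρ.integrable_iff.1 (integrable_const (1 : ℝ))
  simpa using h

theorem HasDensity.mix (hρ : S.HasDensity ν ρ) (hg : S.HasDensity γ g) {ε : ℝ}
    (hε : ε ∈ Icc (0 : ℝ) 1) :
    S.HasDensity (mixKernel ε ν γ) fun q => (1 - ε) * ρ q + ε * g q where
  measurable := (hρ.measurable.const_mul _).add (hg.measurable.const_mul _)
  nonneg q := add_nonneg (mul_nonneg (sub_nonneg.2 hε.2) (hρ.nonneg q))
    (mul_nonneg hε.1 (hg.nonneg q))
  ae_eq := by
    filter_upwards [hρ.ae_eq, hg.ae_eq] with t h1 h2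
    have m1 : Measurable fun a => ENNReal.ofReal (ρ (t, a)) :=
      (hρ.measurable.comp measurable_prodMk_left).ennreal_ofReal
    have m2 : Measurable fun a => ENNReal.ofReal (g (t, a)) :=
      (hg.measurable.comp measurable_prodMk_left).ennreal_ofReal
    rw [mixKernel_apply, h1, h2, ← withDensity_smul _ m1, ← withDensity_smul _ m2,
      ← withDensity_add_left (m1.const_smul _)]
    congr 1
    ext a
    simp only [Pi.add_apply, Pi.smul_apply, smul_eq_mul]
    rw [ENNReal.ofReal_add (mul_nonneg (sub_nonneg.2 hε.2) (hρ.nonneg _))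
      (mul_nonneg hε.1 (hg.nonneg _)), ENNReal.ofReal_mul (sub_nonneg.2 hε.2),
      ENNReal.ofReal_mul hε.1]

theorem HasDensity.extIntegral_entropy (hρ : S.HasDensity ν ρ)
    (hi : Integrable (fun q => ρ q * Real.log (ρ q)) (S.time.prod volume)) :
    extIntegral S.time (fun t => entropy (ν t))
      = ((∫ q, ρ q * Real.log (ρ q) ∂(S.time.prod volume) : ℝ) : EReal) := by
  rw [integral_prod _ hi, ← extIntegral_coe_of_integrable hi.integral_prod_left]
  refine extIntegral_congr_ae ?_
  filter_upwards [hρ.ae_eq, hi.prod_right_ae] with t h1 h2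
  rw [h1, entropy_withDensity (ρ := fun a => ρ (t, a))
      (hρ.measurable.comp measurable_prodMk_left) fun a => hρ.nonneg _,
    extIntegral_coe_of_integrable h2]

theorem integrable_exp_neg_norm_sq_prod :
    Integrable (fun q : ℝ × E m => Real.exp (-‖q.2‖ ^ 2)) (S.time.prod volume) := by
  have h := integrable_exp_neg_mul_norm_sq (m := m) (c := 1) one_pos
  simp only [neg_mul, one_mul] at h
  exact h.comp_snd S.time

/-- The entropy of a singular slice is `⊤`, so almost every slice has a density. The second moment
bounds the negative part of `ρ ln ρ`, and the entropy then bounds the positive part. -/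
theorem exists_hasDensity_of_entropy
    (hent : extIntegral S.time (fun t => entropy (ν t)) ≠ ⊤)
    (h2 : Integrable (fun q : ℝ × E m => ‖q.2‖ ^ 2) (S.controlMeasure ν)) :
    ∃ ρ, S.HasDensity ν ρ ∧
      Integrable (fun q => ρ q * Real.log (ρ q)) (S.time.prod volume) := by
  obtain ⟨hms, ρ, hρm, hρ0, hρ⟩ := exists_measurable_density ν (volume : Measure (E m))
  have hfin : ∫⁻ t, (entropy (ν t)).toENNReal ∂S.time ≠ ⊤ := fun h => hent (if_pos h)
  have hac : ∀ᵐ t ∂S.time, ν t ≪ volume := by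
    by_contra hcon
    rw [ae_iff] at hcon
    refine hfin (top_unique ?_)
    calc (⊤ : ℝ≥0∞) = ⊤ * S.time {t | ¬ ν t ≪ volume} := (ENNReal.top_mul hcon).symm
      _ = ∫⁻ t, {t | ¬ ν t ≪ volume}.indicator (fun _ => ⊤) t ∂S.time :=
        (lintegral_indicator_const hms.compl _).symm
      _ ≤ _ := lintegral_mono fun t => by
        by_cases ht : ν t ≪ volume
        · simp [ht]
        · simp [ht, entropy]
  have hd : S.HasDensity ν ρ := ⟨hρm, hρ0, hac.mono fun t ht => hρ t ht⟩
  refine ⟨ρ, hd, ?_⟩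
  set f : ℝ × E m → ℝ := fun q => ρ q * Real.log (ρ q)
  have hfm : Measurable f := hρm.mul (Real.measurable_log.comp hρm)
  -- The negative part on a slice. Being finite for almost every `t`, it can be added back to the
  -- entropy to recover the positive part.
  set B : ℝ → ℝ≥0∞ := fun t => ∫⁻ a, ENNReal.ofReal (-f (t, a))
  have hBm : Measurable B := (hfm.neg.ennreal_ofReal).lintegral_prod_right'
  have hneg : ∫⁻ q, ENNReal.ofReal (-f q) ∂(S.time.prod volume) < ⊤ := by
    have hi := (hd.integrable_iff.1 h2).add (integrable_exp_neg_norm_sq_prod (S := S) (m := m))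
    refine (lintegral_mono fun q => ENNReal.ofReal_le_ofReal ?_).trans_lt hi.lintegral_lt_top
    exact neg_mul_log_le (hρ0 q)
  have hBi : ∫⁻ t, B t ∂S.time < ⊤ := by
    rw [lintegral_prod (fun q => ENNReal.ofReal (-f q)) hfm.neg.ennreal_ofReal.aemeasurable] at hneg
    exact hneg
  have hpos : ∫⁻ q, ENNReal.ofReal (f q) ∂(S.time.prod volume) < ⊤ := by
    rw [lintegral_prod _ hfm.ennreal_ofReal.aemeasurable]
    have hle : ∀ᵐ t ∂S.time, ∫⁻ a, ENNReal.ofReal (f (t, a))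
        ≤ (entropy (ν t)).toENNReal + B t := by
      filter_upwards [hd.ae_eq, ae_lt_top hBm hBi.ne] with t ht hBt
      rw [ht, entropy_withDensity (ρ := fun a => ρ (t, a)) (hρm.comp measurable_prodMk_left)
        fun a => hρ0 _]
      have e : ∀ a, (-((f (t, a) : ℝ) : EReal)).toENNReal = ENNReal.ofReal (-f (t, a)) := fun a => by
        rw [← EReal.coe_neg, EReal.real_coe_toENNReal]
      change _ ≤ (extIntegral volume fun a => ((f (t, a) : ℝ) : EReal)).toENNReal + B t
      simp only [extIntegral, e, EReal.real_coe_toENNReal]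
      split_ifs with h
      · simp
      · change _ ≤ (_ - ((B t : ℝ≥0∞) : EReal)).toENNReal + B t
        rw [EReal.toENNReal_sub (EReal.coe_ennreal_nonneg _), EReal.toENNReal_coe,
          EReal.toENNReal_coe]
        exact le_tsub_add
    refine (lintegral_mono_ae hle).trans_lt ?_
    rw [lintegral_add_right _ hBm]
    exact ENNReal.add_lt_top.2 ⟨lt_top_iff_ne_top.2 hfin, hBi⟩
  refine ⟨hfm.aestronglyMeasurable, ?_⟩
  have h5 : ∀ q, ‖f q‖ₑ ≤ ENNReal.ofReal (f q) + ENNReal.ofReal (-f q) := fun q => by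
    rw [Real.enorm_eq_ofReal_abs]
    rcases le_total 0 (f q) with h | h
    · rw [abs_of_nonneg h]; exact le_self_add
    · rw [abs_of_nonpos h]; exact le_add_self
  refine (lintegral_mono h5).trans_lt ?_
  rw [lintegral_add_left hfm.ennreal_ofReal]
  exact ENNReal.add_lt_top.2 ⟨hpos, hneg⟩

/-- Convexity of the entropy, in integrated form. -/
theorem HasDensity.integral_mul_log_mix_le (hρ : S.HasDensity ν ρ) (hg : S.HasDensity γ g)
    (h2 : Integrable (fun q : ℝ × E m => ‖q.2‖ ^ 2) (S.controlMeasure ν))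
    (h2' : Integrable (fun q : ℝ × E m => ‖q.2‖ ^ 2) (S.controlMeasure γ))
    (hi : Integrable (fun q => ρ q * Real.log (ρ q)) (S.time.prod volume))
    (hi' : Integrable (fun q => g q * Real.log (g q)) (S.time.prod volume))
    {ε : ℝ} (hε : ε ∈ Icc (0 : ℝ) 1) :
    Integrable (fun q => ((1 - ε) * ρ q + ε * g q) * Real.log ((1 - ε) * ρ q + ε * g q))
        (S.time.prod volume) ∧
      ∫ q, ((1 - ε) * ρ q + ε * g q) * Real.log ((1 - ε) * ρ q + ε * g q) ∂(S.time.prod volume)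
        ≤ (1 - ε) * (∫ q, ρ q * Real.log (ρ q) ∂(S.time.prod volume))
          + ε * ∫ q, g q * Real.log (g q) ∂(S.time.prod volume) := by
  have := isMarkovKernel_mixKernel (ν := ν) (γ := γ) hε
  have hm := hρ.mix hg hε
  set r : ℝ × E m → ℝ := fun q => (1 - ε) * ρ q + ε * g q
  have hup : ∀ q, r q * Real.log (r q)
      ≤ (1 - ε) * (ρ q * Real.log (ρ q)) + ε * (g q * Real.log (g q)) := fun q => by
    have := Real.convexOn_mul_log.2 (hρ.nonneg q) (hg.nonneg q) (sub_nonneg.2 hε.2) hε.1 (by ring)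
    simpa [r] using this
  have hiu := (hi.const_mul (1 - ε)).add (hi'.const_mul ε)
  have hil := (hm.integrable_iff.1 (integrable_norm_sq_mix hε h2 h2')).add
    (integrable_exp_neg_norm_sq_prod (S := S) (m := m))
  have hir : Integrable (fun q => r q * Real.log (r q)) (S.time.prod volume) := by
    refine Integrable.mono' (hiu.abs.add hil.abs)
      (hm.measurable.mul (Real.measurable_log.comp hm.measurable)).aestronglyMeasurable
      (Eventually.of_forall fun q => ?_)
    rw [Real.norm_eq_abs, abs_le]
    have h1 := neg_mul_log_le (s := ‖q.2‖ ^ 2) (hm.nonneg q)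
    have h3 := hup q
    simp only [Pi.add_apply]
    have h4 := le_abs_self ((1 - ε) * (ρ q * Real.log (ρ q)) + ε * (g q * Real.log (g q)))
    have h5 := le_abs_self (((1 - ε) * ρ q + ε * g q) * ‖q.2‖ ^ 2 + Real.exp (-‖q.2‖ ^ 2))
    have h6 := abs_nonneg ((1 - ε) * (ρ q * Real.log (ρ q)) + ε * (g q * Real.log (g q)))
    have h7 := abs_nonneg (((1 - ε) * ρ q + ε * g q) * ‖q.2‖ ^ 2 + Real.exp (-‖q.2‖ ^ 2))
    constructor
    · simp only [r] at h1 ⊢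
      linarith
    · linarith
  refine ⟨hir, ?_⟩
  rw [← integral_const_mul, ← integral_const_mul,
    ← integral_add (hi.const_mul (1 - ε)) (hi'.const_mul ε)]
  exact integral_mono hir hiu hup

end Density

end RelaxedControl.ControlProblem

/-! ### Gibbs kernels -/

/-- A measurable family of potentials with uniform quadratic growth. -/
structure IsQuadratic {m : ℕ} (U : ℝ → E m → ℝ) (C : ℝ) : Prop where
  one_le : 1 ≤ C
  measurable : Measurable fun q : ℝ × E m => U q.1 q.2
  le : ∀ t a, |U t a| ≤ C * (1 + ‖a‖ ^ 2)
  ge : ∀ t a, ‖a‖ ^ 2 ≤ C * (U t a + C)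

/-- The partition function of `exp (-β U)`. -/
noncomputable def partitionFun {m : ℕ} (β : ℝ) (U : ℝ → E m → ℝ) (t : ℝ) : ℝ := ∫ a, Real.exp (-β * U t a)

/-- The Gibbs density `exp (-β U) / Z`. -/
noncomputable def gibbsDensity {m : ℕ} (β : ℝ) (U : ℝ → E m → ℝ) (q : ℝ × E m) : ℝ :=
  (partitionFun β U q.1)⁻¹ * Real.exp (-β * U q.1 q.2)

/-- Half of a Gaussian exponent pays for a quadratic factor, so splitting the exponent keeps
polynomial moments integrable. -/
theorem one_add_mul_exp_neg_le {c x : ℝ} (hc : 0 < c) (hx : 0 ≤ x) :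
    (1 + x) * Real.exp (-c * x) ≤ 1 + 1 / c := by
  have h1 := mul_le_mul_of_nonneg_left (Real.add_one_le_exp (c * x)) (one_div_pos.2 hc).le
  have h2 : 1 / c * (c * x + 1) = x + 1 / c := by field_simp
  have h3 : 1 ≤ Real.exp (c * x) := Real.one_le_exp (by positivity)
  have h4 : 0 < 1 / c := one_div_pos.2 hc
  rw [neg_mul, Real.exp_neg, ← div_eq_mul_inv, div_le_iff₀ (Real.exp_pos _)]
  linarith

theorem integrable_norm_sq_mul_exp {m : ℕ} {c : ℝ} (hc : 0 < c) :
    Integrable fun a : E m => (1 + ‖a‖ ^ 2) * Real.exp (-c * ‖a‖ ^ 2) := by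
  have h1 := (integrable_exp_neg_mul_norm_sq (m := m) (c := c / 2) (by positivity)).const_mul
    (1 + 1 / (c / 2))
  refine h1.mono' (by fun_prop) (Eventually.of_forall fun a => ?_)
  rw [Real.norm_of_nonneg (by positivity)]
  have h2 : Real.exp (-c * ‖a‖ ^ 2)
      = Real.exp (-(c / 2) * ‖a‖ ^ 2) * Real.exp (-(c / 2) * ‖a‖ ^ 2) := by
    rw [← Real.exp_add]; ring_nf
  rw [h2, ← mul_assoc]
  exact mul_le_mul_of_nonneg_right (one_add_mul_exp_neg_le (half_pos hc) (by positivity))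
    (Real.exp_pos _).le

namespace IsQuadratic

variable {m : ℕ} {U : ℝ → E m → ℝ} {C β : ℝ} (hU : IsQuadratic U C) (hβ : 0 < β)
include hU

theorem measurable_section (t : ℝ) : Measurable (U t) :=
  hU.measurable.comp measurable_prodMk_left

include hβ

theorem exp_le (t : ℝ) (a : E m) :
    Real.exp (-β * U t a) ≤ Real.exp (β * C) * Real.exp (-(β / C) * ‖a‖ ^ 2) := by
  rw [← Real.exp_add, Real.exp_le_exp]
  have hC : 0 < C := zero_lt_one.trans_le hU.one_le
  have h1 : ‖a‖ ^ 2 / C ≤ U t a + C := (div_le_iff₀' hC).2 (hU.ge t a)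
  have h2 := mul_le_mul_of_nonneg_left h1 hβ.le
  have h3 : β / C * ‖a‖ ^ 2 = β * (‖a‖ ^ 2 / C) := by ring
  linarith

theorem integrable_exp (t : ℝ) : Integrable fun a => Real.exp (-β * U t a) := by
  have hC : 0 < C := zero_lt_one.trans_le hU.one_le
  refine ((integrable_exp_neg_mul_norm_sq (m := m) (c := β / C) (by positivity)).const_mul
    (Real.exp (β * C))).mono' ?_ (Eventually.of_forall fun a => ?_)
  · have := hU.measurable_section t
    exact (by fun_prop : Measurable fun a => Real.exp (-β * U t a)).aestronglyMeasurable
  · rw [Real.norm_of_nonneg (Real.exp_pos _).le]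
    exact hU.exp_le hβ t a

/-- Independence of `t` makes the logarithm of the partition function bounded, hence integrable
under every control. -/
theorem exists_partitionFun_bounds :
    ∃ c₀ c₁ : ℝ, 0 < c₀ ∧ ∀ t, c₀ ≤ partitionFun β U t ∧ partitionFun β U t ≤ c₁ := by
  have hC : 0 < C := zero_lt_one.trans_le hU.one_le
  have hi : Integrable fun a : E m => Real.exp (-(β * C)) * Real.exp (-(β * C) * ‖a‖ ^ 2) :=
    (integrable_exp_neg_mul_norm_sq (m := m) (c := β * C) (by positivity)).const_mul _
  refine ⟨∫ a : E m, Real.exp (-(β * C)) * Real.exp (-(β * C) * ‖a‖ ^ 2),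
    ∫ a : E m, Real.exp (β * C) * Real.exp (-(β / C) * ‖a‖ ^ 2), ?_, fun t => ⟨?_, ?_⟩⟩
  · rw [integral_const_mul]
    exact mul_pos (Real.exp_pos _) (integral_exp_pos
      (integrable_exp_neg_mul_norm_sq (m := m) (c := β * C) (by positivity)))
  · refine integral_mono hi (hU.integrable_exp hβ t) fun a => ?_
    simp only
    rw [← Real.exp_add, Real.exp_le_exp]
    have h1 := mul_le_mul_of_nonneg_left ((abs_le.1 (hU.le t a)).2) hβ.le
    linarith
  · exact integral_mono (hU.integrable_exp hβ t)
      ((integrable_exp_neg_mul_norm_sq (m := m) (c := β / C) (by positivity)).const_mul _)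
      fun a => hU.exp_le hβ t a

theorem partitionFun_pos (t : ℝ) : 0 < partitionFun β U t := by
  obtain ⟨c₀, c₁, h0, h⟩ := hU.exists_partitionFun_bounds hβ
  exact h0.trans_le (h t).1

theorem gibbsDensity_pos (q : ℝ × E m) : 0 < gibbsDensity β U q :=
  mul_pos (inv_pos.2 (hU.partitionFun_pos hβ _)) (Real.exp_pos _)

omit hβ in
theorem measurable_partitionFun : Measurable (partitionFun β U) := by
  have := hU.measurable
  have h : Measurable fun q : ℝ × E m => Real.exp (-β * U q.1 q.2) := by fun_prop
  exact h.stronglyMeasurable.integral_prod_right'.measurable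

omit hβ in
theorem measurable_gibbsDensity : Measurable (gibbsDensity β U) := by
  have := hU.measurable
  have h : Measurable fun q : ℝ × E m => Real.exp (-β * U q.1 q.2) := by fun_prop
  exact ((hU.measurable_partitionFun (β := β)).comp measurable_fst).inv.mul h

theorem log_gibbsDensity (q : ℝ × E m) :
    Real.log (gibbsDensity β U q) = -Real.log (partitionFun β U q.1) - β * U q.1 q.2 := by
  rw [gibbsDensity, Real.log_mul (inv_pos.2 (hU.partitionFun_pos hβ _)).ne' (Real.exp_pos _).ne',
    Real.log_inv, Real.log_exp]
  ring

theorem exists_gibbsKernel : ∃ γ : Kernel ℝ (E m), IsMarkovKernel γ ∧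
    ∀ t, γ t = volume.withDensity fun a => ENNReal.ofReal (gibbsDensity β U (t, a)) := by
  refine ⟨⟨fun t => volume.withDensity fun a => ENNReal.ofReal (gibbsDensity β U (t, a)), ?_⟩,
    ⟨fun t => ⟨?_⟩⟩, fun t => rfl⟩
  · refine Measure.measurable_of_measurable_coe _ fun s hs => ?_
    simp_rw [withDensity_apply _ hs]
    exact (hU.measurable_gibbsDensity.ennreal_ofReal).lintegral_prod_right'
  · change (volume.withDensity fun a => ENNReal.ofReal (gibbsDensity β U (t, a))) univ = 1
    rw [withDensity_apply _ MeasurableSet.univ, Measure.restrict_univ,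
      ← ofReal_integral_eq_lintegral_ofReal (f := fun a => gibbsDensity β U (t, a))
        ((hU.integrable_exp hβ t).const_mul (partitionFun β U t)⁻¹)
        (Eventually.of_forall fun a => (hU.gibbsDensity_pos hβ _).le)]
    simp only [gibbsDensity]
    rw [integral_const_mul, ← partitionFun, inv_mul_cancel₀ (hU.partitionFun_pos hβ t).ne',
      ENNReal.ofReal_one]

end IsQuadratic

/-- The relative entropy integrand is nonnegative and vanishes only for equal densities. -/
theorem mul_log_sub_nonneg {r g : ℝ} (hr : 0 ≤ r) (hg : 0 < g) :
    0 ≤ r * Real.log r - r * Real.log g - r + g ∧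
      (r * Real.log r - r * Real.log g - r + g = 0 → r = g) := by
  rcases hr.eq_or_lt with rfl | hr
  · simp [hg.le, hg.ne']
  have e : r * Real.log r - r * Real.log g = -(r * Real.log (g / r)) := by
    rw [Real.log_div hg.ne' hr.ne']; ring
  have e2 : r * (g / r - 1) = g - r := by field_simp
  constructor
  · have h := mul_le_mul_of_nonneg_left (Real.log_le_sub_one_of_pos (div_pos hg hr)) hr.le
    linarith
  · intro h0
    by_contra hne
    have h := mul_lt_mul_of_pos_left (Real.log_lt_sub_one_of_pos (div_pos hg hr)
      (fun h => hne ((div_eq_one_iff_eq hr.ne').1 h).symm)) hr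
    linarith

/-! ### The Gibbs variational principle -/

namespace RelaxedControl.ControlProblem

variable {d m : ℕ} {𝒵 : Type v} {Ω₀ : Type w} [MeasurableSpace 𝒵] [MeasurableSpace Ω₀]
  {S : ControlProblem d m 𝒵 Ω₀} {Kx Kp : Set (E d)}

section Gibbs

variable {ν γ : Kernel ℝ (E m)} [IsMarkovKernel ν] [IsMarkovKernel γ] {ρ : ℝ × E m → ℝ}
  {U : ℝ → E m → ℝ} {C β : ℝ}

theorem integrable_gibbs (hU : IsQuadratic U C) (hβ : 0 < β)
    (hγ : S.HasDensity γ (gibbsDensity β U)) :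
    Integrable (fun q : ℝ × E m => ‖q.2‖ ^ 2) (S.controlMeasure γ) ∧
      Integrable (fun q => gibbsDensity β U q * Real.log (gibbsDensity β U q))
        (S.time.prod volume) := by
  obtain ⟨c₀, c₁, h0, hc⟩ := hU.exists_partitionFun_bounds hβ
  have hC : 0 < C := zero_lt_one.trans_le hU.one_le
  have h2 : Integrable (fun q : ℝ × E m => ‖q.2‖ ^ 2) (S.controlMeasure γ) := by
    rw [hγ.integrable_iff]
    have hb := ((integrable_norm_sq_mul_exp (m := m) (c := β / C) (by positivity)).const_mul
      (c₀⁻¹ * Real.exp (β * C))).comp_snd S.time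
    refine hb.mono' (hγ.measurable.mul (by fun_prop)).aestronglyMeasurable
      (Eventually.of_forall fun q => ?_)
    rw [Real.norm_of_nonneg (mul_nonneg (hγ.nonneg q) (by positivity)), gibbsDensity]
    have h3 : (partitionFun β U q.1)⁻¹ ≤ c₀⁻¹ := inv_anti₀ h0 (hc _).1
    have h4 := mul_le_mul h3 (hU.exp_le hβ q.1 q.2) (Real.exp_pos _).le (by positivity)
    have h5 : ‖q.2‖ ^ 2 ≤ 1 + ‖q.2‖ ^ 2 := by linarith
    have h6 := mul_le_mul h4 h5 (by positivity) (by positivity)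
    exact h6.trans (le_of_eq (by ring))
  refine ⟨h2, ?_⟩
  rw [← hγ.integrable_iff]
  set B := max |Real.log c₀| |Real.log c₁|
  refine Integrable.mono' (((integrable_const 1).add h2).const_mul (β * C) |>.add
    (integrable_const B)) (Real.measurable_log.comp hγ.measurable).aestronglyMeasurable
    (Eventually.of_forall fun q => ?_)
  rw [hU.log_gibbsDensity hβ]
  have h3 : |Real.log (partitionFun β U q.1)| ≤ B :=
    abs_le_max_abs_abs (Real.log_le_log h0 (hc _).1)
      (Real.log_le_log (h0.trans_le (hc _).1) (hc _).2)
  have h4 := mul_le_mul_of_nonneg_left (hU.le q.1 q.2) hβ.le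
  refine (norm_sub_le _ _).trans ?_
  rw [norm_neg, Real.norm_eq_abs, Real.norm_eq_abs, abs_mul, abs_of_pos hβ]
  simp only [Pi.add_apply]
  linarith

/-- The Gibbs variational principle: a density whose free energy does not exceed the one of the
Gibbs density is the Gibbs density. -/
theorem HasDensity.ae_eq_gibbs (hρ : S.HasDensity ν ρ) (hU : IsQuadratic U C) (hβ : 0 < β)
    (hγ : S.HasDensity γ (gibbsDensity β U))
    (h2 : Integrable (fun q : ℝ × E m => ‖q.2‖ ^ 2) (S.controlMeasure ν))
    (hi : Integrable (fun q => ρ q * Real.log (ρ q)) (S.time.prod volume))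
    (hle : β * ∫ q, U q.1 q.2 ∂S.controlMeasure ν + ∫ q, ρ q * Real.log (ρ q) ∂(S.time.prod volume)
      ≤ β * ∫ q, U q.1 q.2 ∂S.controlMeasure γ
        + ∫ q, gibbsDensity β U q * Real.log (gibbsDensity β U q) ∂(S.time.prod volume)) :
    ρ =ᵐ[S.time.prod volume] gibbsDensity β U := by
  obtain ⟨c₀, c₁, h0, hc⟩ := hU.exists_partitionFun_bounds hβ
  obtain ⟨h2', hi'⟩ := integrable_gibbs (S := S) hU hβ hγ
  set g := gibbsDensity β U
  set ℓ : ℝ → ℝ := fun t => Real.log (partitionFun β U t)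
  have hℓm : Measurable ℓ := Real.measurable_log.comp hU.measurable_partitionFun
  have hℓb : ∀ t, ‖ℓ t‖ ≤ max |Real.log c₀| |Real.log c₁| := fun t =>
    abs_le_max_abs_abs (Real.log_le_log h0 (hc _).1)
      (Real.log_le_log (h0.trans_le (hc _).1) (hc _).2)
  have hUi : ∀ {η : Kernel ℝ (E m)} [IsMarkovKernel η],
      Integrable (fun q : ℝ × E m => ‖q.2‖ ^ 2) (S.controlMeasure η) →
      Integrable (fun q => U q.1 q.2) (S.controlMeasure η) := fun h =>
    (((integrable_const 1).add h).const_mul C).mono' hU.measurable.aestronglyMeasurable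
      (Eventually.of_forall fun q => hU.le _ _)
  have hℓi : ∀ {η : Kernel ℝ (E m)} [IsMarkovKernel η],
      Integrable (fun q : ℝ × E m => ℓ q.1) (S.controlMeasure η) ∧
      ∫ q, ℓ q.1 ∂S.controlMeasure η = ∫ t, ℓ t ∂S.time := by
    intro η _
    refine ⟨Integrable.of_bound (hℓm.comp measurable_fst).aestronglyMeasurable _
      (Eventually.of_forall fun q => hℓb q.1), ?_⟩
    have h := Measure.fst_compProd S.time η
    rw [Measure.fst] at h
    conv_rhs => rw [← h]
    rw [integral_map measurable_fst.aemeasurable hℓm.aestronglyMeasurable]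
    rfl
  have i1 := hρ.integrable_iff.1 (hUi h2)
  have i2 := hρ.integrable_iff.1 (hℓi (η := ν)).1
  have j1 := hγ.integrable_iff.1 (hUi h2')
  have j2 := hγ.integrable_iff.1 (hℓi (η := γ)).1
  have e1 : ∫ q, g q * Real.log (g q) ∂(S.time.prod volume)
      = -(∫ t, ℓ t ∂S.time) - β * ∫ q, U q.1 q.2 ∂S.controlMeasure γ := by
    rw [hγ.integral_eq, ← (hℓi (η := γ)).2, hγ.integral_eq, ← integral_const_mul, ← integral_neg]
    refine Eq.trans ?_ (integral_sub j2.neg (j1.const_mul β))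
    refine integral_congr_ae (Eventually.of_forall fun q => ?_)
    simp only [g, hU.log_gibbsDensity hβ, ℓ, Pi.neg_apply]
    ring
  -- The integrand of the relative entropy of `ρ` with respect to `g`. The added `-ρ + g` has
  -- integral zero and makes it nonnegative pointwise.
  set D : ℝ × E m → ℝ := fun q => ρ q * Real.log (ρ q) - ρ q * Real.log (g q) - ρ q + g q
  have hD0 : ∀ q, 0 ≤ D q := fun q =>
    (mul_log_sub_nonneg (hρ.nonneg q) (hU.gibbsDensity_pos hβ q)).1
  have hDe : ∀ q, D q = ρ q * Real.log (ρ q) + (ρ q * ℓ q.1 + β * (ρ q * U q.1 q.2))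
      - ρ q + g q := fun q => by
    simp only [D, g, hU.log_gibbsDensity hβ, ℓ]
    ring
  have hmass : ∀ {η : Kernel ℝ (E m)} [IsMarkovKernel η] {r : ℝ × E m → ℝ}, S.HasDensity η r →
      ∫ q, r q ∂(S.time.prod volume) = (S.time univ).toReal := by
    intro η _ r hr
    have h := hr.integral_eq (fun _ => 1)
    simp only [mul_one] at h
    rw [← h]
    simp [measureReal_def, controlMeasure, Measure.compProd_apply_univ]
  have i3 := i2.add (i1.const_mul β)
  have hDi : Integrable D (S.time.prod volume) := by
    refine (((hi.add i3).sub hρ.integrable).add hγ.integrable).congr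
      (Eventually.of_forall fun q => ?_)
    simp only [hDe, Pi.add_apply, Pi.sub_apply]
  -- Here `-log g` is `β U` plus the logarithm of the partition function. The latter depends on time
  -- only, so its integral is the same under both controls, and the difference of the free energies
  -- remains.
  have hDint : ∫ q, D q ∂(S.time.prod volume) ≤ 0 := by
    have e2 : ∫ q, D q ∂(S.time.prod volume) = ∫ q, ρ q * Real.log (ρ q) ∂(S.time.prod volume)
        + (∫ t, ℓ t ∂S.time + β * ∫ q, U q.1 q.2 ∂S.controlMeasure ν) := by
      have e3 := integral_add' ((hi.add i3).sub hρ.integrable) hγ.integrable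
      rw [integral_sub' (hi.add i3) hρ.integrable, hmass hρ, hmass hγ, sub_add_cancel,
        integral_add' hi i3, integral_add' i2 (i1.const_mul β), integral_const_mul,
        ← hρ.integral_eq (fun q => ℓ q.1), ← hρ.integral_eq (fun q => U q.1 q.2), (hℓi (η := ν)).2] at e3
      rw [← e3]
      exact integral_congr_ae (Eventually.of_forall hDe)
    rw [e2]
    linarith
  have hD : D =ᵐ[S.time.prod volume] 0 :=
    (integral_eq_zero_iff_of_nonneg hD0 hDi).1 (le_antisymm hDint (integral_nonneg hD0))
  exact hD.mono fun q hq =>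
    (mul_log_sub_nonneg (hρ.nonneg q) (hU.gibbsDensity_pos hβ q)).2 hq

end Gibbs

end RelaxedControl.ControlProblem

namespace RelaxedControl.ControlProblem

variable {d m : ℕ} {𝒵 : Type v} {Ω₀ : Type w} [MeasurableSpace 𝒵] [MeasurableSpace Ω₀]
  {S : ControlProblem d m 𝒵 Ω₀} {Kx Kp : Set (E d)}

/-! ### The averaged gradient -/

/-- `𝖤[∇ₐH(t, x, a, p, Z)]` for random `x` and `p`. -/
noncomputable def meanGrad (S : ControlProblem d m 𝒵 Ω₀) (x p : Ω₀ → E d) (t : ℝ) (a : E m) : E m :=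
  ∫ ω, S.gradaH t (x ω) a (p ω) (S.Z ω) ∂S.P

section MeanGrad

variable {C t : ℝ} {x p x' p' : Ω₀ → E d}

theorem Bounds.integrable_gradaH (hC : S.Bounds Kx Kp C) (hS : S.Standing) (ht : t ∈ Icc 0 S.T)
    (hx : Measurable x) (hp : Measurable p) (hxK : ∀ ω, x ω ∈ Kx) (hpK : ∀ ω, p ω ∈ Kp) (a : E m) :
    Integrable (fun ω => S.gradaH t (x ω) a (p ω) (S.Z ω)) S.P := by
  have := hS.isProb
  have hZ := hS.measurable_Z
  have h : Measurable fun ω => (t, x ω, a, p ω, S.Z ω) := by fun_prop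
  have h1 := hS.measurable_gradaH.comp h
  simp only [Function.comp_def, indicator_of_mem ht] at h1
  exact Integrable.of_bound h1.aestronglyMeasurable (C * (1 + ‖a‖))
    (Eventually.of_forall fun ω => hC.norm_gradaH_le ht (hxK ω) (hpK ω) a _)

theorem Bounds.norm_meanGrad_le (hC : S.Bounds Kx Kp C) (hS : S.Standing) (ht : t ∈ Icc 0 S.T)
    (hxK : ∀ ω, x ω ∈ Kx) (hpK : ∀ ω, p ω ∈ Kp) (a : E m) :
    ‖S.meanGrad x p t a‖ ≤ C * (1 + ‖a‖) := by
  have := hS.isProb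
  exact (norm_integral_le_of_norm_le_const
    (Eventually.of_forall fun ω => hC.norm_gradaH_le ht (hxK ω) (hpK ω) a _)).trans (by simp)

theorem Bounds.norm_meanGrad_sub_le (hC : S.Bounds Kx Kp C) (hS : S.Standing)
    (ht : t ∈ Icc 0 S.T) (hx : Measurable x) (hp : Measurable p) (hxK : ∀ ω, x ω ∈ Kx)
    (hpK : ∀ ω, p ω ∈ Kp) (hx' : Measurable x') (hp' : Measurable p') (hxK' : ∀ ω, x' ω ∈ Kx)
    (hpK' : ∀ ω, p' ω ∈ Kp) {D : ℝ} (hD : ∀ ω, ‖x ω - x' ω‖ + ‖p ω - p' ω‖ ≤ D) (a a' : E m) :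
    ‖S.meanGrad x p t a - S.meanGrad x' p' t a'‖ ≤ C * (‖a - a'‖ + D) := by
  have := hS.isProb
  have hC0 : 0 ≤ C := zero_le_one.trans hC.one_le
  rw [meanGrad, meanGrad, ← integral_sub (hC.integrable_gradaH hS ht hx hp hxK hpK a)
    (hC.integrable_gradaH hS ht hx' hp' hxK' hpK' a')]
  refine (norm_integral_le_of_norm_le_const (C := C * (‖a - a'‖ + D))
    (Eventually.of_forall fun ω => ?_)).trans (by simp)
  refine (hC.gradaH_lip t ht _ (hxK ω) _ (hxK' ω) _ (hpK ω) _ (hpK' ω) a a' _).trans ?_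
  exact mul_le_mul_of_nonneg_left (by linarith [hD ω]) hC0

end MeanGrad

/-! ### The averaged Hamiltonian and the Gibbs form of the minimiser -/

section MeanH

variable {C : ℝ} {ν : Kernel ℝ (E m)} [IsMarkovKernel ν] {X P : ℝ → Ω₀ → E d}

theorem IsRegularPair.measurable_X (hXP : S.IsRegularPair ν X P) (t : ℝ) : Measurable (X t) :=
  hXP.measurable_state.comp measurable_prodMk_left

theorem IsRegularPair.measurable_P (hXP : S.IsRegularPair ν X P) (t : ℝ) : Measurable (P t) :=
  hXP.measurable_adjoint.comp measurable_prodMk_left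

theorem IsRegularPair.mem (hXP : S.IsRegularPair ν X P) (hK : S.IsRange Kx Kp) :
    ∀ t ∈ Icc 0 S.T, ∀ ω, X t ω ∈ Kx ∧ P t ω ∈ Kp :=
  hK.mem ν X P hXP.isState hXP.isAdjoint

theorem Bounds.integrable_H (hC : S.Bounds Kx Kp C) (hS : S.Standing) (hK : S.IsRange Kx Kp)
    (hXP : S.IsRegularPair ν X P) {t : ℝ} (ht : t ∈ Icc 0 S.T) (a : E m) :
    Integrable (fun ω => S.H t (X t ω) a (P t ω) (S.Z ω)) S.P := by
  have := hS.isProb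
  have h : Measurable fun ω : Ω₀ => (ω, (t, a)) := measurable_prodMk_right
  exact Integrable.of_bound ((hXP.measurable_H hS).comp h).aestronglyMeasurable
    (C * (1 + ‖a‖ ^ 2)) (Eventually.of_forall fun ω =>
      hC.H_le t ht _ (hXP.mem hK t ht ω).1 _ (hXP.mem hK t ht ω).2 _ _)

theorem Bounds.abs_meanH_le (hC : S.Bounds Kx Kp C) (hS : S.Standing) (hK : S.IsRange Kx Kp)
    (hXP : S.IsRegularPair ν X P) {t : ℝ} (ht : t ∈ Icc 0 S.T) (a : E m) :
    |S.meanH X P t a| ≤ C * (1 + ‖a‖ ^ 2) := by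
  have := hS.isProb
  rw [← Real.norm_eq_abs]
  exact (norm_integral_le_of_norm_le_const (Eventually.of_forall fun ω =>
      hC.H_le t ht _ (hXP.mem hK t ht ω).1 _ (hXP.mem hK t ht ω).2 _ _)).trans (by simp)

theorem Bounds.le_meanH (hC : S.Bounds Kx Kp C) (hS : S.Standing) (hK : S.IsRange Kx Kp)
    (hXP : S.IsRegularPair ν X P) {t : ℝ} (ht : t ∈ Icc 0 S.T) (a : E m) :
    ‖a‖ ^ 2 ≤ C * (S.meanH X P t a + C) := by
  have := hS.isProb
  have hi := hC.integrable_H hS hK hXP ht a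
  have h := integral_mono (μ := S.P) (integrable_const (‖a‖ ^ 2))
    ((hi.add (integrable_const C)).const_mul C) fun ω =>
      hC.H_ge t ht _ (hXP.mem hK t ht ω).1 _ (hXP.mem hK t ht ω).2 (S.Z ω) a
  rw [integral_const_mul, integral_add' hi (integrable_const C)] at h
  simpa [meanH] using h

/-- Averaging the Taylor bound identifies the gradient of the averaged Hamiltonian without
differentiating under the expectation. -/
theorem Bounds.meanH_taylor (hC : S.Bounds Kx Kp C) (hS : S.Standing) (hK : S.IsRange Kx Kp)
    (hXP : S.IsRegularPair ν X P) {t : ℝ} (ht : t ∈ Icc 0 S.T) (a a' : E m) :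
    |S.meanH X P t a' - S.meanH X P t a - inner ℝ (S.meanGrad (X t) (P t) t a) (a' - a)|
      ≤ C * ‖a' - a‖ ^ 2 := by
  have := hS.isProb
  have hi := hC.integrable_H hS hK hXP ht a
  have hi' := hC.integrable_H hS hK hXP ht a'
  have hg := hC.integrable_gradaH hS ht (hXP.measurable_X t) (hXP.measurable_P t)
    (fun ω => (hXP.mem hK t ht ω).1) (fun ω => (hXP.mem hK t ht ω).2) a
  have e : inner ℝ (S.meanGrad (X t) (P t) t a) (a' - a)
      = ∫ ω, inner ℝ (S.gradaH t (X t ω) a (P t ω) (S.Z ω)) (a' - a) ∂S.P := by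
    rw [meanGrad, real_inner_comm, ← integral_inner hg]
    exact integral_congr_ae (Eventually.of_forall fun ω => real_inner_comm _ _)
  have hg' : Integrable (fun ω => inner ℝ (S.gradaH t (X t ω) a (P t ω) (S.Z ω)) (a' - a)) S.P :=
    hg.inner_const _
  rw [e, meanH, meanH, ← integral_sub' hi' hi, ← integral_sub' (hi'.sub hi) hg', ← Real.norm_eq_abs]
  exact (norm_integral_le_of_norm_le_const (C := C * ‖a' - a‖ ^ 2) (Eventually.of_forall fun ω =>
    hC.H_taylor t ht _ (hXP.mem hK t ht ω).1 _ (hXP.mem hK t ht ω).2 (S.Z ω) a a')).trans (by simp)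

/-- The averaged Hamiltonian, extended by a quadratic function outside `[0, T]`. -/
noncomputable def potential (S : ControlProblem d m 𝒵 Ω₀) (X P : ℝ → Ω₀ → E d) (t : ℝ) (a : E m) : ℝ :=
  open Classical in if t ∈ Icc 0 S.T then S.meanH X P t a else ‖a‖ ^ 2

theorem Bounds.isQuadratic_potential (hC : S.Bounds Kx Kp C) (hS : S.Standing)
    (hK : S.IsRange Kx Kp) (hXP : S.IsRegularPair ν X P) : IsQuadratic (S.potential X P) C where
  one_le := hC.one_le
  measurable := by
    have h1 : MeasurableSet {q : ℝ × E m | q.1 ∈ Icc 0 S.T} := measurable_fst measurableSet_Icc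
    have h2 : Measurable fun q : ℝ × E m => ‖q.2‖ ^ 2 := by fun_prop
    exact Measurable.ite h1 (hXP.measurable_meanH hS) h2
  le t a := by
    rw [potential]
    split_ifs with ht
    · exact hC.abs_meanH_le hS hK hXP ht a
    · rw [abs_of_nonneg (by positivity)]
      nlinarith [hC.one_le, sq_nonneg ‖a‖]
  ge t a := by
    rw [potential]
    split_ifs with ht
    · exact hC.le_meanH hS hK hXP ht a
    · nlinarith [hC.one_le, sq_nonneg ‖a‖]

/-- A minimiser has the Gibbs density of its averaged Hamiltonian. -/
theorem Bounds.ae_eq_gibbs_of_isOptimal (hC : S.Bounds Kx Kp C) (hS : S.Standing)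
    (hK : S.IsRange Kx Kp) (hV : S.BoundedBelow) (hXP : S.IsRegularPair ν X P)
    (hopt : S.IsOptimal ν) (hfin : S.Vreg ν < ⊤) :
    Integrable (fun q : ℝ × E m => ‖q.2‖ ^ 2) (S.controlMeasure ν) ∧
      S.HasDensity ν (gibbsDensity (2 / S.σ ^ 2) (S.potential X P)) := by
  have hσ := hS.σ_pos
  set β := 2 / S.σ ^ 2
  have hβ : 0 < β := by positivity
  have hκ : 0 < S.σ ^ 2 / 2 := by positivity
  have hVtop : S.V ν ≠ ⊤ := by
    intro h
    rw [Vreg, if_pos h] at hfin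
    exact lt_irrefl _ hfin
  have h2 := hC.integrable_norm_sq_of_V hS hK hVtop
  refine ⟨h2, ?_⟩
  have hU := hC.isQuadratic_potential hS hK hXP
  set U := S.potential X P
  -- The only competing direction that is needed: the Gibbs kernel of the Hamiltonian that `ν`
  -- itself generates.
  obtain ⟨γ, hγM, hγd⟩ := hU.exists_gibbsKernel hβ
  set g := gibbsDensity β U
  have hγ : S.HasDensity γ g := ⟨hU.measurable_gibbsDensity, fun q => (hU.gibbsDensity_pos hβ q).le,
    Eventually.of_forall hγd⟩
  obtain ⟨h2', hi'⟩ := integrable_gibbs (S := S) hU hβ hγ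
  obtain ⟨J₀, J, hJ₀, hJ, hlim⟩ := hC.exists_tendsto_V_mix hS hK hXP hV hVtop h2'
  have hent : extIntegral S.time (fun t => entropy (ν t)) ≠ ⊤ := by
    intro h
    rw [Vreg, if_neg hVtop, h, hJ₀, EReal.coe_mul_top_of_pos hκ, EReal.coe_add_top] at hfin
    exact lt_irrefl _ hfin
  obtain ⟨ρ, hρ, hi⟩ := exists_hasDensity_of_entropy hent h2
  -- Minimality against the mixture, divided by `ε`, with the entropy of the mixture replaced by its
  -- convexity bound. Thus no derivative of the entropy is taken.
  have hineq : ∀ ε ∈ Ioc (0 : ℝ) 1, 0 ≤ (J ε - J₀) / ε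
      + S.σ ^ 2 / 2 * ((∫ q, g q * Real.log (g q) ∂(S.time.prod volume))
        - ∫ q, ρ q * Real.log (ρ q) ∂(S.time.prod volume)) := by
    intro ε hε
    have hε' := Ioc_subset_Icc_self hε
    haveI := isMarkovKernel_mixKernel (ν := ν) (γ := γ) hε'
    obtain ⟨hir, hle⟩ := hρ.integral_mul_log_mix_le hγ h2 h2' hi hi' hε'
    have h := hopt (mixKernel ε ν γ)
    rw [Vreg, if_neg hVtop, Vreg, if_neg (by rw [hJ ε hε']; exact EReal.coe_ne_top _), hJ₀,
      hJ ε hε', hρ.extIntegral_entropy hi, (hρ.mix hγ hε').extIntegral_entropy hir,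
      ← EReal.coe_mul, ← EReal.coe_mul, ← EReal.coe_add, ← EReal.coe_add, EReal.coe_le_coe_iff] at h
    have h3 := mul_le_mul_of_nonneg_left hle hκ.le
    have h4 : 0 ≤ (J ε - J₀) + ε * (S.σ ^ 2 / 2 *
        ((∫ q, g q * Real.log (g q) ∂(S.time.prod volume))
          - ∫ q, ρ q * Real.log (ρ q) ∂(S.time.prod volume))) := by linarith
    have h5 := div_nonneg h4 hε.1.le
    rwa [add_div, mul_div_cancel_left₀ _ hε.1.ne'] at h5
  have hev : ∀ᶠ ε in 𝓝[>] (0 : ℝ), ε ∈ Ioc (0 : ℝ) 1 := by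
    filter_upwards [Ioc_mem_nhdsGT (zero_lt_one : (0 : ℝ) < 1)] with ε hε using hε
  have h0 := ge_of_tendsto (hlim.add_const _) (hev.mono hineq)
  have hUe : ∀ {η : Kernel ℝ (E m)} [IsMarkovKernel η],
      ∫ q, S.meanH X P q.1 q.2 ∂S.controlMeasure η = ∫ q, U q.1 q.2 ∂S.controlMeasure η :=
    integral_congr_ae ((ae_controlMeasure_mem _).mono fun q hq => by simp [U, potential, hq.1, hq.2])
  rw [hUe, hUe] at h0
  have hle : β * ∫ q, U q.1 q.2 ∂S.controlMeasure ν + ∫ q, ρ q * Real.log (ρ q) ∂(S.time.prod volume)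
      ≤ β * ∫ q, U q.1 q.2 ∂S.controlMeasure γ
        + ∫ q, g q * Real.log (g q) ∂(S.time.prod volume) := by
    have h1 := mul_nonneg hβ.le h0
    have e : β * (S.σ ^ 2 / 2) = 1 := by simp only [β]; field_simp
    rw [mul_add, ← mul_assoc, e, one_mul, mul_sub] at h1
    linarith
  have hae := hρ.ae_eq_gibbs hU hβ hγ h2 hi hle
  refine ⟨hU.measurable_gibbsDensity, fun q => (hU.gibbsDensity_pos hβ q).le, ?_⟩
  filter_upwards [hρ.ae_eq, Measure.ae_ae_of_ae_prod hae] with t h1 h3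
  rw [h1]
  exact withDensity_congr_ae (h3.mono fun a ha => by simp only [ha, g])

/-- Up to a constant in `a`, the logarithm of the density is `-(2/σ²)` times the averaged
Hamiltonian. Its gradient is the Lipschitz averaged gradient, which makes the density `C¹`. -/
theorem Bounds.firstOrderCondition (hC : S.Bounds Kx Kp C) (hS : S.Standing)
    (hK : S.IsRange Kx Kp) (hXP : S.IsRegularPair ν X P)
    (hν : S.HasDensity ν (gibbsDensity (2 / S.σ ^ 2) (S.potential X P))) :
    S.FirstOrderCondition ν X P := by
  have hσ := hS.σ_pos
  have hβ : 0 < 2 / S.σ ^ 2 := by positivity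
  have hU := hC.isQuadratic_potential hS hK hXP
  have hC0 : 0 ≤ C := zero_le_one.trans hC.one_le
  filter_upwards [hν.ae_eq, ae_time_mem (S := S)] with t hνt ht
  have hpot : ∀ a, S.potential X P t a = S.meanH X P t a := fun a => by
    rw [potential, if_pos ht]
  have hgrad : ∀ a, HasGradientAt (S.meanH X P t) (S.meanGrad (X t) (P t) t a) a :=
    hasGradientAt_of_abs_sub_le (hC.meanH_taylor hS hK hXP ht)
  have hcont : Continuous (S.meanGrad (X t) (P t) t) := by
    have : LipschitzWith C.toNNReal (S.meanGrad (X t) (P t) t) :=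
      LipschitzWith.of_dist_le_mul fun a a' => by
        have h := hC.norm_meanGrad_sub_le hS ht (hXP.measurable_X t) (hXP.measurable_P t)
          (fun ω => (hXP.mem hK t ht ω).1) (fun ω => (hXP.mem hK t ht ω).2)
          (hXP.measurable_X t) (hXP.measurable_P t)
          (fun ω => (hXP.mem hK t ht ω).1) (fun ω => (hXP.mem hK t ht ω).2) (D := 0)
          (fun ω => by simp) a a'
        rw [add_zero] at h
        rwa [dist_eq_norm, dist_eq_norm, Real.coe_toNNReal _ hC0]
    exact this.continuous
  have hC1 : ContDiff ℝ 1 (S.meanH X P t) := by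
    rw [contDiff_one_iff_fderiv]
    refine ⟨fun a => (hgrad a).differentiableAt, ?_⟩
    have h : fderiv ℝ (S.meanH X P t)
        = fun a => InnerProductSpace.toDual ℝ (E m) (S.meanGrad (X t) (P t) t a) :=
      funext fun a => (hgrad a).hasFDerivAt.fderiv
    rw [h]
    exact (InnerProductSpace.toDual ℝ (E m)).continuous.comp hcont
  refine ⟨fun a => gibbsDensity (2 / S.σ ^ 2) (S.potential X P) (t, a),
    fun a => hU.gibbsDensity_pos hβ _, ?_, hνt, fun a => ⟨?_, ?_⟩⟩
  · simp only [gibbsDensity, hpot]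
    exact contDiff_const.mul (Real.contDiff_exp.comp (contDiff_const.mul hC1))
  · exact hC.integrable_gradaH hS ht (hXP.measurable_X t) (hXP.measurable_P t)
      (fun ω => (hXP.mem hK t ht ω).1) (fun ω => (hXP.mem hK t ht ω).2) a
  · simp only [hU.log_gibbsDensity hβ, hpot]
    have h : HasGradientAt (fun b => -Real.log (partitionFun (2 / S.σ ^ 2) (S.potential X P) t)
        - 2 / S.σ ^ 2 * S.meanH X P t b) (-((2 / S.σ ^ 2) • S.meanGrad (X t) (P t) t a)) a := by
      have h1 := (hgrad a).hasFDerivAt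
      rw [hasGradientAt_iff_hasFDerivAt]
      refine ((h1.const_mul (2 / S.σ ^ 2)).const_sub _).congr_fderiv ?_
      simp
    rw [h.gradient, smul_neg, smul_smul, show S.σ ^ 2 / 2 * (2 / S.σ ^ 2) = 1 by field_simp,
      one_smul, meanGrad, add_neg_cancel]

theorem HasDensity.mutually_absolutelyContinuous {ρ : ℝ × E m → ℝ} (hρ : S.HasDensity ν ρ)
    (hpos : ∀ q, 0 < ρ q) :
    S.controlMeasure ν ≪ S.time.prod volume ∧ S.time.prod volume ≪ S.controlMeasure ν := by
  rw [hρ.controlMeasure_eq]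
  exact ⟨withDensity_absolutelyContinuous _ _, withDensity_absolutelyContinuous'
    hρ.measurable.ennreal_ofReal.aemeasurable
    (Eventually.of_forall fun q => (ENNReal.ofReal_pos.2 (hpos q)).ne')⟩

end MeanH

end RelaxedControl.ControlProblem

/-! ### Solutions of Langevin equations with additive noise -/

section Langevin

variable {m : ℕ} {Ω : Type*} [MeasurableSpace Ω] {μ : Measure Ω} {W : ℝ≥0 → Ω → E m}

theorem brownian_ae_zero (hW : ControlProblem.IsBrownian μ W) : ∀ᵐ ω ∂μ, W 0 ω = 0 := by
  have h1 : ∀ᵐ ω ∂μ, ∀ i, W 0 ω i = 0 :=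
    ae_all_iff.2 fun i => (hW.coord i).toIsPreBrownianReal.eval_zero_ae_eq_zero
  filter_upwards [h1] with ω hω
  ext i
  simpa using hω i

theorem brownian_ae_continuous (hW : ControlProblem.IsBrownian μ W) :
    ∀ᵐ ω ∂μ, Continuous fun s => W s ω := by
  have h1 : ∀ᵐ ω ∂μ, ∀ i, Continuous fun s => W s ω i := ae_all_iff.2 fun i => (hW.coord i).cont
  filter_upwards [h1] with ω hω
  exact (PiLp.continuous_toLp 2 _).comp (continuous_pi hω)

/-- The noise is additive, so `θ - σ W` solves an ordinary differential equation whose coefficient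
is random and continuous in time. -/
theorem exists_langevin_solution {K σ : ℝ} {b : E m → E m} (hK : 0 < K)
    (hb : ∀ x y, ‖b x - b y‖ ≤ K * ‖x - y‖) (hW : ControlProblem.IsBrownian μ W) {θ₀ : Ω → E m}
    (hθ₀ : Measurable θ₀) :
    ∃ θ : ℝ≥0 → Ω → E m, (∀ s, Measurable (θ s)) ∧ (∀ᵐ ω ∂μ, Continuous fun s => θ s ω) ∧
      ∀ᵐ ω ∂μ, ∀ s : ℝ≥0,
        θ s ω = θ₀ ω - (∫ r in (0 : ℝ)..s, b (θ r.toNNReal ω)) + σ • W s ω := by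
  classical
  have hbc : Continuous b := by
    have : LipschitzWith K.toNNReal b := LipschitzWith.of_dist_le_mul fun x y => by
      rw [dist_eq_norm, dist_eq_norm, Real.coe_toNNReal _ hK.le]
      exact hb x y
    exact this.continuous
  -- Paths of `W` are continuous only almost surely. Replacing them by zero on a measurable null set
  -- makes every path continuous, as the existence theorem for random coefficients requires here.
  obtain ⟨N, hN, hNm, hN0⟩ := exists_measurable_superset_of_null (brownian_ae_continuous hW)
  set w : ℝ≥0 → Ω → E m := fun s ω => Nᶜ.indicator (W s) ω
  have hwm : ∀ s, Measurable (w s) := fun s => (hW.measurable s).indicator hNm.compl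
  have hwc : ∀ ω, Continuous fun s => w s ω := by
    intro ω
    by_cases h : ω ∈ Nᶜ
    · simp only [w, indicator_of_mem h]
      by_contra hcon
      exact h (hN hcon)
    · simp only [w, indicator_of_notMem h]
      exact continuous_const
  have hwu : Measurable (Function.uncurry w) :=
    measurable_uncurry_of_continuous_of_measurable hwc hwm
  obtain ⟨Y, hYm, hYc, hYe⟩ := exists_caratheodory_solution (Ω := Ω) (F := E m) (y₀ := θ₀)
    (f := fun r ω y => -b (y + σ • w r.toNNReal ω)) hK (by
      have h : Measurable fun q : ℝ × Ω × E m =>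
          q.2.2 + σ • Function.uncurry w (q.1.toNNReal, q.2.1) :=
        (measurable_snd.comp measurable_snd).add ((hwu.comp
          (measurable_fst.real_toNNReal.prodMk (measurable_fst.comp measurable_snd))).const_smul σ)
      exact (hbc.measurable.comp h).neg)
    (fun t ω x y => by
      rw [neg_sub_neg, norm_sub_rev]
      refine (hb _ _).trans (le_of_eq ?_)
      rw [add_sub_add_right_eq_sub])
    (fun ω T => by
      have hc : ContinuousOn (fun t : ℝ => -b (0 + σ • w t.toNNReal ω)) (Icc 0 T) := by
        have h := (hwc ω).comp continuous_real_toNNReal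
        exact (hbc.comp (continuous_const.add (h.const_smul σ))).neg.continuousOn
      exact isCompact_Icc.exists_bound_of_continuousOn hc) hθ₀
  refine ⟨fun s ω => Y s ω + σ • w s ω, fun s => (hYm _).add ((hwm s).const_smul σ),
    Eventually.of_forall fun ω =>
      ((hYc ω).comp NNReal.continuous_coe).add ((hwc ω).const_smul σ), ?_⟩
  have hae : ∀ᵐ ω ∂μ, ω ∈ Nᶜ := compl_mem_ae_iff.2 hN0
  filter_upwards [hae] with ω hω s
  have h1 : w s ω = W s ω := indicator_of_mem hω _
  rw [hYe ω s s.2, h1, intervalIntegral.integral_neg, ← sub_eq_add_neg]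
  congr 2
  refine intervalIntegral.integral_congr fun r hr => ?_
  rw [uIcc_of_le (NNReal.coe_nonneg s)] at hr
  simp only [Real.coe_toNNReal r hr.1]

/-- Comparison of two solutions of Langevin equations driven by the same noise. -/
theorem norm_sub_le_of_langevin {C M s : ℝ} {n : ℕ} (hC : 0 ≤ C) (hs : 0 ≤ s)
    {Δ : ℝ → E m} (hΔ : ContinuousOn Δ (Icc 0 s)) (hM : 0 ≤ M) {f : ℝ → E m}
    (hf : ∀ r ∈ Icc 0 s, ‖f r‖ ≤ C * (‖Δ r‖ + M * r ^ n))
    (he : ∀ r ∈ Icc 0 s, Δ r = ∫ q in (0 : ℝ)..r, f q) :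
    ‖Δ s‖ ≤ C * (M * s ^ (n + 1) / (n + 1)) * Real.exp (C * s) := by
  -- The source `M rⁿ` integrates to `M s^{n+1} / (n + 1)`; under iteration these divisors build up
  -- a factorial.
  refine le_mul_exp_of_le_add_mul_integral hC hΔ.norm (fun r hr => ?_) s ⟨hs, le_rfl⟩
  have hc1 : ContinuousOn (fun q => ‖Δ q‖) (uIcc 0 r) := by
    rw [uIcc_of_le hr.1]
    exact hΔ.norm.mono (Icc_subset_Icc_right hr.2)
  have hc2 : ContinuousOn (fun q : ℝ => M * q ^ n) (uIcc 0 r) := by fun_prop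
  rw [he r hr]
  refine (intervalIntegral.norm_integral_le_of_norm_le hr.1
    (Eventually.of_forall fun q hq => hf q ⟨hq.1.le, hq.2.trans hr.2⟩)
    ((hc1.intervalIntegrable.add hc2.intervalIntegrable).const_mul C)).trans ?_
  rw [intervalIntegral.integral_const_mul,
    intervalIntegral.integral_add hc1.intervalIntegrable hc2.intervalIntegrable,
    intervalIntegral.integral_const_mul, integral_pow, mul_add, add_comm]
  gcongr
  rw [mul_div_assoc]
  gcongr
  simp only [ne_eq, Nat.add_eq_zero_iff, one_ne_zero, and_false, not_false_eq_true, zero_pow,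
    sub_zero]
  exact pow_le_pow_left₀ hr.1 hr.2 _

end Langevin

/-! ### Invariance under the Langevin equation with frozen drift -/

namespace RelaxedControl.ControlProblem

variable {d m : ℕ} {𝒵 : Type v} {Ω₀ : Type w} [MeasurableSpace 𝒵] [MeasurableSpace Ω₀]
  {S : ControlProblem d m 𝒵 Ω₀} {Kx Kp : Set (E d)}

section Stationary

variable {C : ℝ} {ν : Kernel ℝ (E m)} [IsMarkovKernel ν] {X P : ℝ → Ω₀ → E d}

theorem Bounds.meanGrad_lip (hC : S.Bounds Kx Kp C) (hS : S.Standing) (hK : S.IsRange Kx Kp)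
    (hXP : S.IsRegularPair ν X P) {t : ℝ} (ht : t ∈ Icc 0 S.T) (a a' : E m) :
    ‖S.meanGrad (X t) (P t) t a - S.meanGrad (X t) (P t) t a'‖ ≤ C * ‖a - a'‖ := by
  have h := hC.norm_meanGrad_sub_le hS ht (hXP.measurable_X t) (hXP.measurable_P t)
    (fun ω => (hXP.mem hK t ht ω).1) (fun ω => (hXP.mem hK t ht ω).2)
    (hXP.measurable_X t) (hXP.measurable_P t)
    (fun ω => (hXP.mem hK t ht ω).1) (fun ω => (hXP.mem hK t ht ω).2) (D := 0)
    (fun ω => by simp) a a'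
  rwa [add_zero] at h

variable {Ω : Type*} [MeasurableSpace Ω] {μ : Measure Ω} [IsProbabilityMeasure μ]
  {W : ℝ≥0 → Ω → E m}

/-- The Langevin equation with the frozen drift leaves the Gibbs law invariant. -/
theorem Bounds.map_langevin_eq_gibbs (hC : S.Bounds Kx Kp C) (hS : S.Standing)
    (hK : S.IsRange Kx Kp) (hXP : S.IsRegularPair ν X P) {t : ℝ} (ht : t ∈ Icc 0 S.T)
    (hνt : ν t = volume.withDensity fun a =>
      ENNReal.ofReal (gibbsDensity (2 / S.σ ^ 2) (S.potential X P) (t, a)))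
    (hW : IsBrownian μ W) {θ₀ : Ω → E m} (hθ₀ : Measurable θ₀) (hlaw : μ.map θ₀ = ν t)
    (hind : IndepFun θ₀ (fun ω s => W s ω) μ) {θ : ℝ≥0 → Ω → E m} (hθm : ∀ s, Measurable (θ s))
    (hθc : ∀ᵐ ω ∂μ, Continuous fun s => θ s ω)
    (heq : ∀ᵐ ω ∂μ, ∀ s : ℝ≥0, θ s ω = θ₀ ω
      - (∫ r in (0 : ℝ)..s, S.meanGrad (X t) (P t) t (θ r.toNNReal ω)) + S.σ • W s ω) (s : ℝ≥0) :
    μ.map (θ s) = ν t := by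
  have hσ := hS.σ_pos
  have hC0 : 0 ≤ C := zero_le_one.trans hC.one_le
  have hCpos : 0 < C := zero_lt_one.trans_le hC.one_le
  -- Half of the inverse temperature `2 / σ²`, because `map_langevin_eq` works with the square root
  -- of the Gibbs weight.
  have hβ : 0 < 1 / S.σ ^ 2 := by positivity
  have hU := hC.isQuadratic_potential hS hK hXP
  have hpot : ∀ a, S.potential X P t a = S.meanH X P t a := fun a => by
    rw [potential, if_pos ht]
  have hexp : ∀ a, Real.exp (-S.meanH X P t a / S.σ ^ 2)
      = Real.exp (-(1 / S.σ ^ 2) * S.potential X P t a) := fun a => by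
    rw [hpot]; ring_nf
  have hmeas : Measurable (S.meanGrad (X t) (P t) t) := by
    have : LipschitzWith C.toNNReal (S.meanGrad (X t) (P t) t) :=
      LipschitzWith.of_dist_le_mul fun a a' => by
        rw [dist_eq_norm, dist_eq_norm, Real.coe_toNNReal _ hC0]
        exact hC.meanGrad_lip hS hK hXP ht a a'
    exact this.continuous.measurable
  refine map_langevin_eq hσ hC0 (hC.meanGrad_lip hS hK hXP ht) (hC.meanH_taylor hS hK hXP ht)
    (R := Real.exp (1 / S.σ ^ 2 * C)) (fun a => ?_) ?_
    (inv_nonneg.2 (hU.partitionFun_pos (by positivity : 0 < 2 / S.σ ^ 2) t).le) ?_ hW hθ₀ hlaw hind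
    hθm hθc heq s
  · rw [hexp]
    refine (hU.exp_le hβ t a).trans (mul_le_of_le_one_right (Real.exp_pos _).le ?_)
    rw [Real.exp_le_one_iff]
    have : 0 ≤ 1 / S.σ ^ 2 / C * ‖a‖ ^ 2 := by positivity
    linarith
  · set c := 1 / S.σ ^ 2 / C
    have hc : 0 < c := by positivity
    have hi : Integrable fun a : E m => (1 + ‖a‖ ^ 2) ^ 2 * Real.exp (-c * ‖a‖ ^ 2) := by
      have h1 := (integrable_norm_sq_mul_exp (m := m) (c := c / 2) (by positivity)).const_mul
        (1 + 1 / (c / 2))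
      refine h1.mono' (by fun_prop) (Eventually.of_forall fun a => ?_)
      have h2 : Real.exp (-c * ‖a‖ ^ 2)
          = Real.exp (-(c / 2) * ‖a‖ ^ 2) * Real.exp (-(c / 2) * ‖a‖ ^ 2) := by
        rw [← Real.exp_add]; ring_nf
      have h3 := one_add_mul_exp_neg_le (half_pos hc) (sq_nonneg ‖a‖)
      rw [Real.norm_of_nonneg (by positivity), h2]
      calc (1 + ‖a‖ ^ 2) ^ 2 * (Real.exp (-(c / 2) * ‖a‖ ^ 2) * Real.exp (-(c / 2) * ‖a‖ ^ 2))
          = ((1 + ‖a‖ ^ 2) * Real.exp (-(c / 2) * ‖a‖ ^ 2))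
            * ((1 + ‖a‖ ^ 2) * Real.exp (-(c / 2) * ‖a‖ ^ 2)) := by ring
        _ ≤ _ := mul_le_mul_of_nonneg_right h3 (by positivity)
    refine (hi.const_mul (32 * C ^ 3 * Real.exp (1 / S.σ ^ 2 * C))).mono' ?_
      (Eventually.of_forall fun a => ?_)
    · have hm := hU.measurable_section t
      simp only [hexp]
      exact (by fun_prop : Measurable fun a => (1 + ‖S.meanGrad (X t) (P t) t a‖) ^ 3
        * Real.exp (-(1 / S.σ ^ 2) * S.potential X P t a)).aestronglyMeasurable
    · rw [Real.norm_of_nonneg (by positivity), hexp]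
      have h1 := hC.norm_meanGrad_le hS ht (fun ω => (hXP.mem hK t ht ω).1)
        (fun ω => (hXP.mem hK t ht ω).2) a
      have h2 : 1 + ‖S.meanGrad (X t) (P t) t a‖ ≤ 2 * C * (1 + ‖a‖) := by
        nlinarith [hC.one_le, norm_nonneg a]
      -- `32 = 2³ · 2²`: the cube comes from `h2`, the square from `(1 + ‖a‖)² ≤ 2 (1 + ‖a‖²)` after
      -- the exponent 3 has been raised to 4.
      have h3 : (1 + ‖S.meanGrad (X t) (P t) t a‖) ^ 3 ≤ 32 * C ^ 3 * (1 + ‖a‖ ^ 2) ^ 2 := by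
        refine (pow_le_pow_left₀ (by positivity) h2 3).trans ?_
        have h4 : (1 + ‖a‖) ^ 3 ≤ (1 + ‖a‖) ^ 4 :=
          pow_le_pow_right₀ (by linarith [norm_nonneg a]) (by norm_num)
        have h5 : (1 + ‖a‖) ^ 2 ≤ 2 * (1 + ‖a‖ ^ 2) := by nlinarith [sq_nonneg (1 - ‖a‖)]
        have h6 := pow_le_pow_left₀ (by positivity) h5 2
        have h7 : (2 * C) ^ 3 * (1 + ‖a‖) ^ 3 ≤ (2 * C) ^ 3 * (2 * (1 + ‖a‖ ^ 2)) ^ 2 :=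
          mul_le_mul_of_nonneg_left (h4.trans (by rwa [← pow_mul] at h6)) (by positivity)
        calc (2 * C * (1 + ‖a‖)) ^ 3 = (2 * C) ^ 3 * (1 + ‖a‖) ^ 3 := by ring
          _ ≤ _ := h7.trans (le_of_eq (by ring))
      have h8 := mul_le_mul h3 (hU.exp_le hβ t a) (Real.exp_pos _).le (by positivity)
      exact h8.trans (le_of_eq (by ring))
  · rw [hνt]
    congr 1
    ext a
    rw [gibbsDensity, hpot, ← Real.exp_nat_mul]
    congr 3
    push_cast
    ring

end Stationary

end RelaxedControl.ControlProblem

/-! ### Dependence of the processes and of the drift on the control -/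

theorem continuous_integral_law {m : ℕ} {F : Type*} [NormedAddCommGroup F] [NormedSpace ℝ F]
    {Ω : Type*} [MeasurableSpace Ω] {μ : Measure Ω} [IsProbabilityMeasure μ]
    {θ : ℝ≥0 → Ω → E m} {κ : ℝ≥0 → Measure (E m)}
    (hθ : ∀ s, Measurable (θ s)) (hc : ∀ᵐ ω ∂μ, Continuous fun s => θ s ω)
    (hlaw : ∀ s, μ.map (θ s) = κ s) {f : E m → F} (hf : Continuous f) {B : ℝ}
    (hB : ∀ a, ‖f a‖ ≤ B) : Continuous fun s => ∫ a, f a ∂κ s := by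
  have e : (fun s => ∫ a, f a ∂κ s) = fun s => ∫ ω, f (θ s ω) ∂μ := by
    ext s
    rw [← hlaw s, integral_map (hθ s).aemeasurable hf.aestronglyMeasurable]
  rw [e]
  exact continuous_of_dominated
    (fun s => (hf.stronglyMeasurable.comp_measurable (hθ s)).aestronglyMeasurable)
    (fun s => Eventually.of_forall fun ω => hB _) (integrable_const B)
    (hc.mono fun ω hω => hf.comp hω)

namespace RelaxedControl.ControlProblem

variable {d m : ℕ} {𝒵 : Type v} {Ω₀ : Type w} [MeasurableSpace 𝒵] [MeasurableSpace Ω₀]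
  {S : ControlProblem d m 𝒵 Ω₀} {Kx Kp : Set (E d)}

theorem continuous_of_norm_sub_le {F : Type*} [NormedAddCommGroup F] {f : E m → F} {C : ℝ}
    (hC : 0 ≤ C) (h : ∀ a a', ‖f a - f a'‖ ≤ C * ‖a - a'‖) : Continuous f := by
  have : LipschitzWith C.toNNReal f := LipschitzWith.of_dist_le_mul fun a a' => by
    rw [dist_eq_norm, dist_eq_norm, Real.coe_toNNReal _ hC]
    exact h a a'
  exact this.continuous

section Continuity

variable {C : ℝ}

theorem Bounds.bdrift_lip_x (hC : S.Bounds Kx Kp C) (hS : S.Standing) (ν : Kernel ℝ (E m))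
    [IsMarkovKernel ν] {t : ℝ} (ht : t ∈ Icc 0 S.T) {x x' p : E d} (hx : x ∈ Kx) (hx' : x' ∈ Kx)
    (hp : p ∈ Kp) (z : 𝒵) :
    ‖S.bdrift ν t x p z - S.bdrift ν t x' p z‖ ≤ C * ‖x - x'‖ := by
  rw [bdrift, bdrift, ← integral_sub (hC.integrable_gradxH hS ht x p z _)
    (hC.integrable_gradxH hS ht x' p z _)]
  exact (norm_integral_le_of_norm_le_const (C := C * ‖x - x'‖) (Eventually.of_forall fun a => by
    have h := hC.gradxH_lip t ht x hx x' hx' p hp a a z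
    rwa [sub_self, norm_zero, add_zero] at h)).trans (by simp)

theorem Bounds.norm_bdrift_le_of_mem (hC : S.Bounds Kx Kp C) (ν : Kernel ℝ (E m))
    [IsMarkovKernel ν] {t : ℝ} (ht : t ∈ Icc 0 S.T) (x : E d) {p : E d} (hp : p ∈ Kp) (z : 𝒵) :
    ‖S.bdrift ν t x p z‖ ≤ C * (1 + C) :=
  (hC.norm_bdrift_le ν ht x p z).trans (mul_le_mul_of_nonneg_left
    (by linarith [hC.p_le p hp]) (zero_le_one.trans hC.one_le))

variable {κ : ℝ≥0 → Kernel ℝ (E m)} [∀ s, IsMarkovKernel (κ s)] {X P : ℝ≥0 → ℝ → Ω₀ → E d}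

/-- Continuity of the control in `s` enters only through the averaged drift at fixed points, for
almost every `t`. Dominated convergence in time makes the source term of the stability estimate tend
to zero. -/
theorem Bounds.continuous_state (hC : S.Bounds Kx Kp C) (hS : S.Standing) (hK : S.IsRange Kx Kp)
    (hX : ∀ s, S.IsState (κ s) (X s))
    (hκ : ∀ᵐ t ∂S.time, ∀ x ∈ Kx, ∀ z, Continuous fun s => S.fdrift (κ s) t x z)
    {t : ℝ} (ht : t ∈ Icc 0 S.T) (ω : Ω₀) : Continuous fun s => X s t ω := by
  have hCS := hC.toStandingBounds
  refine continuous_iff_continuousAt.2 fun s => ?_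
  rw [ContinuousAt, tendsto_iff_norm_sub_tendsto_zero]
  have hA : Tendsto (fun s' => ∫ r in Icc 0 S.T, ‖S.fdrift (κ s) r (X s r ω) (S.Z ω)
      - S.fdrift (κ s') r (X s r ω) (S.Z ω)‖) (𝓝 s) (𝓝 0) := by
    suffices h : Tendsto (fun s' => ∫ r in Icc 0 S.T, ‖S.fdrift (κ s) r (X s r ω) (S.Z ω)
      - S.fdrift (κ s') r (X s r ω) (S.Z ω)‖) (𝓝 s)
        (𝓝 (∫ r in Icc 0 S.T, (0 : ℝ))) by rwa [integral_zero] at h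
    refine tendsto_integral_filter_of_dominated_convergence (μ := S.time) (fun _ => C + C)
      (Eventually.of_forall fun s' => ((hCS.integrableOn_fdrift hS (κ s) ((hX s).continuousOn ω)
        _).sub (hCS.integrableOn_fdrift hS (κ s') ((hX s).continuousOn ω) _)).norm.1)
      (Eventually.of_forall fun s' => ae_time_mem.mono fun r hr => ?_) (integrable_const _) ?_
    · rw [norm_norm]
      exact (norm_sub_le _ _).trans (add_le_add (hCS.norm_fdrift_le _ hr _ _)
        (hCS.norm_fdrift_le _ hr _ _))
    · filter_upwards [hκ, ae_time_mem (S := S)] with r hr hrm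
      have h := (hr (X s r ω) (hK.state_mem hS (hX s) r hrm ω) (S.Z ω)).tendsto s
      simpa using ((tendsto_const_nhds
        (x := S.fdrift (κ s) r (X s r ω) (S.Z ω))).sub h).norm
  have hlim := hA.mul_const (Real.exp (C * S.T))
  rw [zero_mul] at hlim
  refine squeeze_zero (fun _ => norm_nonneg _) (fun s' => ?_) hlim
  rw [norm_sub_rev]
  exact hCS.norm_state_sub_le hS (κ s) (κ s') (hX s) (hX s') ω le_rfl t ht

theorem Bounds.continuous_adjoint (hC : S.Bounds Kx Kp C) (hS : S.Standing)
    (hK : S.IsRange Kx Kp) (hX : ∀ s, S.IsState (κ s) (X s))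
    (hP : ∀ s, S.IsAdjoint (κ s) (X s) (P s))
    (hXc : ∀ t ∈ Icc 0 S.T, ∀ ω, Continuous fun s => X s t ω)
    (hκ : ∀ᵐ t ∂S.time, ∀ x ∈ Kx, ∀ p ∈ Kp, ∀ z, Continuous fun s => S.bdrift (κ s) t x p z)
    {t : ℝ} (ht : t ∈ Icc 0 S.T) (ω : Ω₀) : Continuous fun s => P s t ω := by
  have hCS := hC.toStandingBounds
  have hT : S.T ∈ Icc 0 S.T := ⟨hS.T_pos.le, le_rfl⟩
  have hmem : ∀ s, ∀ t ∈ Icc 0 S.T, X s t ω ∈ Kx ∧ P s t ω ∈ Kp := fun s t ht =>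
    hK.mem (κ s) (X s) (P s) (hX s) (hP s) t ht ω
  refine continuous_iff_continuousAt.2 fun s => ?_
  rw [ContinuousAt, tendsto_iff_norm_sub_tendsto_zero]
  have hA : Tendsto (fun s' => ∫ r in Icc 0 S.T, ‖S.bdrift (κ s) r (X s r ω) (P s r ω) (S.Z ω)
      - S.bdrift (κ s') r (X s' r ω) (P s r ω) (S.Z ω)‖) (𝓝 s) (𝓝 0) := by
    suffices h : Tendsto (fun s' => ∫ r in Icc 0 S.T, ‖S.bdrift (κ s) r (X s r ω) (P s r ω) (S.Z ω)
      - S.bdrift (κ s') r (X s' r ω) (P s r ω) (S.Z ω)‖) (𝓝 s)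
        (𝓝 (∫ r in Icc 0 S.T, (0 : ℝ))) by rwa [integral_zero] at h
    refine tendsto_integral_filter_of_dominated_convergence (μ := S.time) (fun _ => C * (1 + C) + C * (1 + C))
      (Eventually.of_forall fun s' => ((hCS.integrableOn_bdrift hS (κ s) ((hX s).continuousOn ω)
        ((hP s).continuousOn ω) _).sub (hCS.integrableOn_bdrift hS (κ s') ((hX s').continuousOn ω)
        ((hP s).continuousOn ω) _)).norm.1)
      (Eventually.of_forall fun s' => ae_time_mem.mono fun r hr => ?_) (integrable_const _) ?_
    · rw [norm_norm]
      exact (norm_sub_le _ _).trans (add_le_add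
        (hC.norm_bdrift_le_of_mem _ hr _ (hmem s r hr).2 _)
        (hC.norm_bdrift_le_of_mem _ hr _ (hmem s r hr).2 _))
    · filter_upwards [hκ, ae_time_mem (S := S)] with r hr hrm
      have h := (hr _ (hmem s r hrm).1 _ (hmem s r hrm).2 (S.Z ω)).tendsto s
      have h1 : Tendsto (fun s' => ‖S.bdrift (κ s) r (X s r ω) (P s r ω) (S.Z ω)
          - S.bdrift (κ s') r (X s r ω) (P s r ω) (S.Z ω)‖ + C * ‖X s r ω - X s' r ω‖)
          (𝓝 s) (𝓝 0) := by
        have h2 := ((tendsto_const_nhds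
          (x := S.bdrift (κ s) r (X s r ω) (P s r ω) (S.Z ω))).sub h).norm
        have h3 := ((tendsto_const_nhds (x := X s r ω)).sub ((hXc r hrm ω).tendsto s)).norm.const_mul C
        simpa using h2.add h3
      refine squeeze_zero (fun _ => norm_nonneg _) (fun s' => ?_) h1
      rw [← sub_add_sub_cancel _ (S.bdrift (κ s') r (X s r ω) (P s r ω) (S.Z ω))]
      exact (norm_add_le _ _).trans (add_le_add_right (hC.bdrift_lip_x hS (κ s') hrm
        (hmem s r hrm).1 (hmem s' r hrm).1 (hmem s r hrm).2 _) _)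
  have hG : Tendsto (fun s' => C * ‖X s S.T ω - X s' S.T ω‖) (𝓝 s) (𝓝 0) := by
    have h := ((tendsto_const_nhds (x := X s S.T ω)).sub
      ((hXc S.T hT ω).tendsto s)).norm.const_mul C
    simpa using h
  have hlim := (hG.add hA).mul_const (Real.exp (C * S.T))
  rw [add_zero, zero_mul] at hlim
  refine squeeze_zero (fun _ => norm_nonneg _) (fun s' => ?_) hlim
  rw [norm_sub_rev]
  refine hCS.norm_adjoint_sub_le hS (κ s) (κ s') (hX s) (hX s') (hP s) (hP s') ω ?_ t ht
  exact add_le_add_left (hC.gradG_lip _ (hmem s _ hT).1 _ (hmem s' _ hT).1 _) _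

/-- Continuity in `s` of the drift along a continuous path. -/
theorem Bounds.continuous_meanGrad (hC : S.Bounds Kx Kp C) (hS : S.Standing) {t : ℝ}
    (ht : t ∈ Icc 0 S.T) {x p : ℝ≥0 → Ω₀ → E d} (hx : ∀ s, Measurable (x s))
    (hp : ∀ s, Measurable (p s)) (hxK : ∀ s ω, x s ω ∈ Kx) (hpK : ∀ s ω, p s ω ∈ Kp)
    (hxc : ∀ ω, Continuous fun s => x s ω) (hpc : ∀ ω, Continuous fun s => p s ω)
    {θ : ℝ≥0 → E m} (hθ : Continuous θ) :
    Continuous fun s => S.meanGrad (x s) (p s) t (θ s) := by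
  haveI := hS.isProb
  have h1 : ∀ a, Continuous fun s => S.meanGrad (x s) (p s) t a := by
    intro a
    refine continuous_of_dominated
      (fun s => (hC.integrable_gradaH hS ht (hx s) (hp s) (hxK s) (hpK s) a).1)
      (fun s => Eventually.of_forall fun ω => hC.norm_gradaH_le ht (hxK s ω) (hpK s ω) a _)
      (integrable_const _) (Eventually.of_forall fun ω => ?_)
    refine continuous_iff_continuousAt.2 fun s => ?_
    rw [ContinuousAt, tendsto_iff_norm_sub_tendsto_zero]
    have hlim : Tendsto (fun s' => C * (‖x s' ω - x s ω‖ + ‖a - a‖ + ‖p s' ω - p s ω‖))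
        (𝓝 s) (𝓝 0) := by
      have h2 := tendsto_iff_norm_sub_tendsto_zero.1 ((hxc ω).tendsto s)
      have h3 := tendsto_iff_norm_sub_tendsto_zero.1 ((hpc ω).tendsto s)
      simpa using (h2.add h3).const_mul C
    exact squeeze_zero (fun _ => norm_nonneg _) (fun s' => hC.gradaH_lip t ht _ (hxK s' ω) _
      (hxK s ω) _ (hpK s' ω) _ (hpK s ω) a a _) hlim
  refine continuous_iff_continuousAt.2 fun s => ?_
  rw [ContinuousAt, tendsto_iff_norm_sub_tendsto_zero]
  have hlim : Tendsto (fun s' => C * ‖θ s' - θ s‖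
      + ‖S.meanGrad (x s') (p s') t (θ s) - S.meanGrad (x s) (p s) t (θ s)‖) (𝓝 s) (𝓝 0) := by
    have h2 := (tendsto_iff_norm_sub_tendsto_zero.1 (hθ.tendsto s)).const_mul C
    have h3 := tendsto_iff_norm_sub_tendsto_zero.1 ((h1 (θ s)).tendsto s)
    simpa using h2.add h3
  refine squeeze_zero (fun _ => norm_nonneg _) (fun s' => ?_) hlim
  rw [← sub_add_sub_cancel _ (S.meanGrad (x s') (p s') t (θ s))]
  refine (norm_add_le _ _).trans (add_le_add_left ?_ _)
  have h := hC.norm_meanGrad_sub_le hS ht (hx s') (hp s') (hxK s') (hpK s') (hx s') (hp s')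
    (hxK s') (hpK s') (D := 0) (fun ω => by simp) (θ s') (θ s)
  rwa [add_zero] at h

end Continuity

section Coupling

variable {C : ℝ} {κ₁ κ₂ : Kernel ℝ (E m)} [IsMarkovKernel κ₁] [IsMarkovKernel κ₂]
  {X₁ X₂ P₁ P₂ : ℝ → Ω₀ → E d}

/-- Lipschitz dependence of the forward and adjoint processes on the control. -/
theorem Bounds.norm_processes_sub_le (hC : S.Bounds Kx Kp C) (hS : S.Standing)
    (hK : S.IsRange Kx Kp) (hX₁ : S.IsState κ₁ X₁) (hP₁ : S.IsAdjoint κ₁ X₁ P₁)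
    (hX₂ : S.IsState κ₂ X₂) (hP₂ : S.IsAdjoint κ₂ X₂ P₂) {η : ℝ} (hη : 0 ≤ η)
    (h : ∀ᵐ t ∂S.time, ∀ (f : E m → E d) (B : ℝ), (∀ a, ‖f a‖ ≤ B) →
      (∀ a a', ‖f a - f a'‖ ≤ C * ‖a - a'‖) → ‖∫ a, f a ∂κ₁ t - ∫ a, f a ∂κ₂ t‖ ≤ C * η)
    {t : ℝ} (ht : t ∈ Icc 0 S.T) (ω : Ω₀) :
    ‖X₁ t ω - X₂ t ω‖ + ‖P₁ t ω - P₂ t ω‖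
      ≤ (C * S.T * Real.exp (C * S.T) + (C * (C * S.T * Real.exp (C * S.T))
        + (C + C * (C * S.T * Real.exp (C * S.T))) * S.T) * Real.exp (C * S.T)) * η := by
  have hCS := hC.toStandingBounds
  have hC0 : 0 ≤ C := zero_le_one.trans hC.one_le
  have hT0 := hS.T_pos.le
  have hT : S.T ∈ Icc 0 S.T := ⟨hT0, le_rfl⟩
  have hm₁ := fun t ht => hK.mem κ₁ X₁ P₁ hX₁ hP₁ t ht ω
  have hm₂ := fun t ht => hK.mem κ₂ X₂ P₂ hX₂ hP₂ t ht ω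
  -- `η` acts as a Wasserstein distance of the controls, tested on bounded `C`-Lipschitz functions.
  -- `K₁` is the Lipschitz constant of the state, which then enters the estimate of the adjoint
  -- process.
  set K₁ := C * S.T * Real.exp (C * S.T)
  have hK₁ : 0 ≤ K₁ := by positivity
  have h1 : ∀ t ∈ Icc 0 S.T, ‖X₁ t ω - X₂ t ω‖ ≤ K₁ * η := by
    intro t ht
    refine (hCS.norm_state_sub_le hS κ₁ κ₂ hX₁ hX₂ ω (A := C * η * S.T) ?_ t ht).trans
      (le_of_eq (by simp only [K₁]; ring))
    refine (integral_mono_ae (g := fun _ => C * η) (((hCS.integrableOn_fdrift hS κ₁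
      (hX₁.continuousOn ω) _).sub (hCS.integrableOn_fdrift hS κ₂ (hX₁.continuousOn ω) _)).norm)
      (integrable_const _) ?_).trans (by simp [hT0, mul_comm])
    filter_upwards [h, ae_time_mem (S := S)] with r hr hrm
    exact hr _ C (fun a => hC.φ_le r hrm _ a _)
      (fun a a' => hC.φ_lip_a r hrm _ (hm₁ r hrm).1 a a' _)
  have h2 : ‖P₁ t ω - P₂ t ω‖ ≤ (C * (K₁ * η) + (C * η + C * (K₁ * η)) * S.T)
      * Real.exp (C * S.T) := by
    refine hCS.norm_adjoint_sub_le hS κ₁ κ₂ hX₁ hX₂ hP₁ hP₂ ω ?_ t ht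
    refine add_le_add ((hC.gradG_lip _ (hm₁ _ hT).1 _ (hm₂ _ hT).1 _).trans
      (mul_le_mul_of_nonneg_left (h1 _ hT) hC0)) ?_
    refine (integral_mono_ae (g := fun _ => C * η + C * (K₁ * η)) (((hCS.integrableOn_bdrift hS κ₁
      (hX₁.continuousOn ω) (hP₁.continuousOn ω) _).sub (hCS.integrableOn_bdrift hS κ₂
      (hX₂.continuousOn ω) (hP₁.continuousOn ω) _)).norm)
      (integrable_const _) ?_).trans (by simp [hT0, mul_comm])
    filter_upwards [h, ae_time_mem (S := S)] with r hr hrm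
    simp only [Pi.sub_apply]
    rw [← sub_add_sub_cancel _ (S.bdrift κ₂ r (X₁ r ω) (P₁ r ω) (S.Z ω))]
    refine (norm_add_le _ _).trans (add_le_add ?_ ?_)
    · refine hr _ (C * (1 + C)) (fun a => (hC.gradxH_le r hrm _ a _ _).trans
        (mul_le_mul_of_nonneg_left (by linarith [hC.p_le _ (hm₁ r hrm).2]) hC0)) fun a a' => ?_
      have h3 := hC.gradxH_lip r hrm _ (hm₁ r hrm).1 _ (hm₁ r hrm).1 _ (hm₁ r hrm).2 a a' (S.Z ω)
      rwa [sub_self, norm_zero, zero_add] at h3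
    · exact (hC.bdrift_lip_x hS κ₂ hrm (hm₁ r hrm).1 (hm₂ r hrm).1 (hm₁ r hrm).2 _).trans
        (mul_le_mul_of_nonneg_left (h1 r hrm) hC0)
  refine (add_le_add (h1 t ht) h2).trans (le_of_eq ?_)
  ring

end Coupling

end RelaxedControl.ControlProblem

/-! ### Uniqueness for the mean-field Langevin system -/

namespace RelaxedControl.ControlProblem

variable {d m : ℕ} {𝒵 : Type v} {Ω₀ : Type w} [MeasurableSpace 𝒵] [MeasurableSpace Ω₀]
  {S : ControlProblem d m 𝒵 Ω₀} {Kx Kp : Set (E d)}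

section Pathwise

variable {C : ℝ} {x₁ p₁ x₂ p₂ : ℝ≥0 → Ω₀ → E d} {θ₁ θ₂ w : ℝ≥0 → E m} {θ₀ : E m}

/-- Noise and initial value cancel in the difference of the equations, so only the distance of the
processes drives it; integration in time raises the power of `s` by one. -/
theorem Bounds.norm_langevin_path_sub_le (hC : S.Bounds Kx Kp C) (hS : S.Standing) {t : ℝ}
    (ht : t ∈ Icc 0 S.T) (hx₁ : ∀ s, Measurable (x₁ s)) (hp₁ : ∀ s, Measurable (p₁ s))
    (hK₁ : ∀ s ω, x₁ s ω ∈ Kx ∧ p₁ s ω ∈ Kp)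
    (hc₁ : ∀ ω, (Continuous fun s => x₁ s ω) ∧ Continuous fun s => p₁ s ω)
    (hx₂ : ∀ s, Measurable (x₂ s)) (hp₂ : ∀ s, Measurable (p₂ s))
    (hK₂ : ∀ s ω, x₂ s ω ∈ Kx ∧ p₂ s ω ∈ Kp)
    (hc₂ : ∀ ω, (Continuous fun s => x₂ s ω) ∧ Continuous fun s => p₂ s ω)
    (hθ₁ : Continuous θ₁) (hθ₂ : Continuous θ₂)
    (he₁ : ∀ s : ℝ≥0, θ₁ s = θ₀ - (∫ r in (0 : ℝ)..s,
      S.meanGrad (x₁ r.toNNReal) (p₁ r.toNNReal) t (θ₁ r.toNNReal)) + w s)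
    (he₂ : ∀ s : ℝ≥0, θ₂ s = θ₀ - (∫ r in (0 : ℝ)..s,
      S.meanGrad (x₂ r.toNNReal) (p₂ r.toNNReal) t (θ₂ r.toNNReal)) + w s)
    {M : ℝ} (hM : 0 ≤ M) {n : ℕ} {s : ℝ≥0}
    (h : ∀ r ≤ s, ∀ ω, ‖x₁ r ω - x₂ r ω‖ + ‖p₁ r ω - p₂ r ω‖ ≤ M * (r : ℝ) ^ n) :
    ‖θ₁ s - θ₂ s‖ ≤ C * (M * (s : ℝ) ^ (n + 1) / (n + 1)) * Real.exp (C * s) := by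
  have hC0 : 0 ≤ C := zero_le_one.trans hC.one_le
  have hb₁ := hC.continuous_meanGrad hS ht hx₁ hp₁ (fun s ω => (hK₁ s ω).1)
    (fun s ω => (hK₁ s ω).2) (fun ω => (hc₁ ω).1) (fun ω => (hc₁ ω).2) hθ₁
  have hb₂ := hC.continuous_meanGrad hS ht hx₂ hp₂ (fun s ω => (hK₂ s ω).1)
    (fun s ω => (hK₂ s ω).2) (fun ω => (hc₂ ω).1) (fun ω => (hc₂ ω).2) hθ₂
  have hi₁ := hb₁.comp continuous_real_toNNReal
  have hi₂ := hb₂.comp continuous_real_toNNReal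
  have key := norm_sub_le_of_langevin (Δ := fun r : ℝ => θ₁ r.toNNReal - θ₂ r.toNNReal)
    (f := fun r : ℝ => S.meanGrad (x₂ r.toNNReal) (p₂ r.toNNReal) t (θ₂ r.toNNReal)
      - S.meanGrad (x₁ r.toNNReal) (p₁ r.toNNReal) t (θ₁ r.toNNReal)) (n := n) hC0 s.2
    ((hθ₁.sub hθ₂).comp continuous_real_toNNReal).continuousOn hM (fun r hr => ?_) (fun r hr => ?_)
  · simpa using key
  · have hr' : r.toNNReal ≤ s := Real.toNNReal_le_iff_le_coe.2 hr.2
    have h1 := h _ hr'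
    rw [Real.coe_toNNReal r hr.1] at h1
    rw [norm_sub_rev]
    exact hC.norm_meanGrad_sub_le hS ht (hx₁ _) (hp₁ _) (fun ω => (hK₁ _ ω).1)
      (fun ω => (hK₁ _ ω).2) (hx₂ _) (hp₂ _) (fun ω => (hK₂ _ ω).1) (fun ω => (hK₂ _ ω).2) h1 _ _
  · have e₁ := he₁ r.toNNReal
    have e₂ := he₂ r.toNNReal
    rw [Real.coe_toNNReal r hr.1] at e₁ e₂
    refine Eq.trans ?_ (intervalIntegral.integral_sub (hi₂.intervalIntegrable _ _)
      (hi₁.intervalIntegrable _ _)).symm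
    simp only [e₁, e₂, Function.comp_apply]
    abel

end Pathwise

section Uniqueness

variable {C : ℝ} {Ω : Type*} [MeasurableSpace Ω] {μ : Measure Ω} [IsProbabilityMeasure μ]
  {W : ℝ≥0 → Ω → E m} {Θ Θ₁ Θ₂ : ℝ → ℝ≥0 → Ω → E m} {κ κ₁ κ₂ : ℝ≥0 → Kernel ℝ (E m)}
  {X P X₁ P₁ X₂ P₂ : ℝ≥0 → ℝ → Ω₀ → E d}

theorem IsLangevinSolution.mem (h : S.IsLangevinSolution μ W Θ κ X P) (hK : S.IsRange Kx Kp)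
    (s : ℝ≥0) {t : ℝ} (ht : t ∈ Icc 0 S.T) (ω : Ω₀) : X s t ω ∈ Kx ∧ P s t ω ∈ Kp :=
  haveI := h.markov s
  hK.mem (κ s) (X s) (P s) (h.state s) (h.adjoint s) t ht ω

/-- Laws of almost surely continuous paths vary weakly continuously, and the coefficients are
bounded and Lipschitz in `a`. Consequently the drift along a path is continuous in `s`, so the
integrals in the equation are genuine and can be subtracted. -/
theorem IsLangevinSolution.continuous_processes (h : S.IsLangevinSolution μ W Θ κ X P)
    (hC : S.Bounds Kx Kp C) (hS : S.Standing) (hK : S.IsRange Kx Kp) {t : ℝ}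
    (ht : t ∈ Icc 0 S.T) (ω : Ω₀) :
    (Continuous fun s => X s t ω) ∧ Continuous fun s => P s t ω := by
  have := h.markov
  have hC0 : 0 ≤ C := zero_le_one.trans hC.one_le
  have hX : ∀ t ∈ Icc 0 S.T, ∀ ω, Continuous fun s => X s t ω := fun t ht ω => by
    refine hC.continuous_state hS hK h.state ?_ ht ω
    filter_upwards [h.measurable, h.law, h.continuous, ae_time_mem (S := S)]
      with t hm hl hc ht x hx z
    exact continuous_integral_law hm hc hl (continuous_of_norm_sub_le hC0 fun a a' =>
      hC.φ_lip_a t ht x hx a a' z) fun a => hC.φ_le t ht x a z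
  refine ⟨hX t ht ω, hC.continuous_adjoint hS hK h.state h.adjoint hX ?_ ht ω⟩
  filter_upwards [h.measurable, h.law, h.continuous, ae_time_mem (S := S)]
    with t hm hl hc ht x hx p hp z
  refine continuous_integral_law hm hc hl (continuous_of_norm_sub_le hC0 fun a a' => ?_)
    fun a => hC.gradxH_le t ht x a p z
  have h3 := hC.gradxH_lip t ht x hx x hx p hp a a' z
  rwa [sub_self, norm_zero, zero_add] at h3

/-- One Picard step for the distance of two solutions with the same noise and initial values. -/
theorem IsLangevinSolution.ae_norm_sub_le (h₁ : S.IsLangevinSolution μ W Θ₁ κ₁ X₁ P₁)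
    (h₂ : S.IsLangevinSolution μ W Θ₂ κ₂ X₂ P₂) (hC : S.Bounds Kx Kp C) (hS : S.Standing)
    (hK : S.IsRange Kx Kp) (h₀ : ∀ᵐ t ∂S.time, Θ₁ t 0 =ᵐ[μ] Θ₂ t 0) {M : ℝ} (hM : 0 ≤ M) {n : ℕ}
    {s₁ : ℝ≥0} (h : ∀ r ≤ s₁, ∀ t ∈ Icc 0 S.T, ∀ ω,
      ‖X₁ r t ω - X₂ r t ω‖ + ‖P₁ r t ω - P₂ r t ω‖ ≤ M * (r : ℝ) ^ n) :
    ∀ᵐ t ∂S.time, ∀ s ≤ s₁, ∀ᵐ ω ∂μ,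
      ‖Θ₁ t s ω - Θ₂ t s ω‖ ≤ C * (M * (s : ℝ) ^ (n + 1) / (n + 1)) * Real.exp (C * s) := by
  filter_upwards [h₀, h₁.continuous, h₂.continuous, h₁.sde, h₂.sde, ae_time_mem (S := S)]
    with t ht₀ hc₁ hc₂ hs₁ hs₂ ht s hs
  have hle := hS.measurable_Z.comap_le
  filter_upwards [ht₀, hc₁, hc₂, hs₁, hs₂] with ω hω₀ hω₁ hω₂ he₁ he₂
  rw [hω₀] at he₁
  exact hC.norm_langevin_path_sub_le hS ht (w := fun s => S.σ • W s ω)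
    (x₁ := fun s => X₁ s t) (p₁ := fun s => P₁ s t) (x₂ := fun s => X₂ s t) (p₂ := fun s => P₂ s t)
    (fun s => ((h₁.state s).measurable t ht).mono hle le_rfl)
    (fun s => ((h₁.adjoint s).measurable t ht).mono hle le_rfl)
    (fun s ω => h₁.mem hK s ht ω) (h₁.continuous_processes hC hS hK ht)
    (fun s => ((h₂.state s).measurable t ht).mono hle le_rfl)
    (fun s => ((h₂.adjoint s).measurable t ht).mono hle le_rfl)
    (fun s ω => h₂.mem hK s ht ω) (h₂.continuous_processes hC hS hK ht)
    hω₁ hω₂ he₁ he₂ hM fun r hr ω => h r (hr.trans hs) t ht ω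

/-- One step leads from the processes to the paths, from the coupled paths to their laws, and from
the laws back to the processes. `Q` does not depend on `M` and `n`, so iteration produces `Qⁿ rⁿ /
n!`. -/
theorem IsLangevinSolution.exists_processes_step (h₁ : S.IsLangevinSolution μ W Θ₁ κ₁ X₁ P₁)
    (h₂ : S.IsLangevinSolution μ W Θ₂ κ₂ X₂ P₂) (hC : S.Bounds Kx Kp C) (hS : S.Standing)
    (hK : S.IsRange Kx Kp) (h₀ : ∀ᵐ t ∂S.time, Θ₁ t 0 =ᵐ[μ] Θ₂ t 0) (s₁ : ℝ≥0) :
    ∃ Q : ℝ, 0 ≤ Q ∧ ∀ (M : ℝ) (n : ℕ), 0 ≤ M → (∀ r ≤ s₁, ∀ t ∈ Icc 0 S.T, ∀ ω,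
      ‖X₁ r t ω - X₂ r t ω‖ + ‖P₁ r t ω - P₂ r t ω‖ ≤ M * (r : ℝ) ^ n) →
      ∀ r ≤ s₁, ∀ t ∈ Icc 0 S.T, ∀ ω,
        ‖X₁ r t ω - X₂ r t ω‖ + ‖P₁ r t ω - P₂ r t ω‖ ≤ Q * M / (n + 1) * (r : ℝ) ^ (n + 1) := by
  have hC0 : 0 ≤ C := zero_le_one.trans hC.one_le
  have hT0 := hS.T_pos.le
  set K := C * S.T * Real.exp (C * S.T) + (C * (C * S.T * Real.exp (C * S.T))
    + (C + C * (C * S.T * Real.exp (C * S.T))) * S.T) * Real.exp (C * S.T)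
  have hK0 : 0 ≤ K := by positivity
  refine ⟨K * C * Real.exp (C * s₁), by positivity, fun M n hM h r hr t ht ω => ?_⟩
  have := h₁.markov r
  have := h₂.markov r
  have hη : 0 ≤ C * (M * (r : ℝ) ^ (n + 1) / (n + 1)) * Real.exp (C * r) := by positivity
  refine (hC.norm_processes_sub_le hS hK (h₁.state r) (h₁.adjoint r) (h₂.state r) (h₂.adjoint r)
    hη ?_ ht ω).trans ?_
  · filter_upwards [h₁.ae_norm_sub_le h₂ hC hS hK h₀ hM h, h₁.law, h₂.law, h₁.measurable,
      h₂.measurable] with t ht hl₁ hl₂ hm₁ hm₂ f B hB hf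
    have hfc := continuous_of_norm_sub_le hC0 hf
    have hi : ∀ {θ : Ω → E m}, Measurable θ → Integrable (fun ω => f (θ ω)) μ := fun hθ =>
      Integrable.of_bound (hfc.stronglyMeasurable.comp_measurable hθ).aestronglyMeasurable B
        (Eventually.of_forall fun ω => hB _)
    rw [← hl₁, ← hl₂, integral_map (hm₁ r).aemeasurable hfc.aestronglyMeasurable,
      integral_map (hm₂ r).aemeasurable hfc.aestronglyMeasurable,
      ← integral_sub (hi (hm₁ r)) (hi (hm₂ r))]
    refine (norm_integral_le_of_norm_le_const ((ht r hr).mono fun ω hω =>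
      (hf _ _).trans (mul_le_mul_of_nonneg_left hω hC0))).trans (by simp)
  · have h1 : Real.exp (C * r) ≤ Real.exp (C * s₁) :=
      Real.exp_le_exp.2 (mul_le_mul_of_nonneg_left (NNReal.coe_le_coe.2 hr) hC0)
    calc K * (C * (M * (r : ℝ) ^ (n + 1) / (n + 1)) * Real.exp (C * r))
        ≤ K * (C * (M * (r : ℝ) ^ (n + 1) / (n + 1)) * Real.exp (C * s₁)) := by gcongr
      _ = _ := by ring

/-- The processes of two solutions with the same noise and initial values coincide. -/
theorem IsLangevinSolution.processes_unique (h₁ : S.IsLangevinSolution μ W Θ₁ κ₁ X₁ P₁)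
    (h₂ : S.IsLangevinSolution μ W Θ₂ κ₂ X₂ P₂) (hC : S.Bounds Kx Kp C) (hS : S.Standing)
    (hK : S.IsRange Kx Kp) (h₀ : ∀ᵐ t ∂S.time, Θ₁ t 0 =ᵐ[μ] Θ₂ t 0) (s : ℝ≥0) {t : ℝ}
    (ht : t ∈ Icc 0 S.T) (ω : Ω₀) : ‖X₁ s t ω - X₂ s t ω‖ + ‖P₁ s t ω - P₂ s t ω‖ ≤ 0 := by
  have hC0 : 0 ≤ C := zero_le_one.trans hC.one_le
  obtain ⟨Q, hQ, hstep⟩ := h₁.exists_processes_step h₂ hC hS hK h₀ s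
  -- The iteration starts from the bound `4 C` that the compact range provides, so no moments of the
  -- solutions are needed.
  have key : ∀ n : ℕ, ∀ r ≤ s, ∀ t ∈ Icc 0 S.T, ∀ ω,
      ‖X₁ r t ω - X₂ r t ω‖ + ‖P₁ r t ω - P₂ r t ω‖
        ≤ 4 * C * Q ^ n / n.factorial * (r : ℝ) ^ n := by
    intro n
    induction n with
    | zero =>
      intro r _ t ht ω
      have hm₁ := h₁.mem hK r ht ω
      have hm₂ := h₂.mem hK r ht ω
      have hx := (norm_sub_le (X₁ r t ω) (X₂ r t ω)).trans
        (add_le_add (hC.x_le _ hm₁.1) (hC.x_le _ hm₂.1))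
      have hp := (norm_sub_le (P₁ r t ω) (P₂ r t ω)).trans
        (add_le_add (hC.p_le _ hm₁.2) (hC.p_le _ hm₂.2))
      simp only [pow_zero, mul_one, Nat.factorial_zero, Nat.cast_one, div_one]
      linarith
    | succ n ih =>
      intro r hr t ht ω
      refine (hstep _ n (by positivity) ih r hr t ht ω).trans (le_of_eq ?_)
      rw [Nat.factorial_succ]
      push_cast
      field_simp
      ring
  have hlim := (FloorSemiring.tendsto_pow_div_factorial_atTop (Q * s)).const_mul (4 * C)
  rw [mul_zero] at hlim
  refine ge_of_tendsto' hlim fun n => (key n s le_rfl t ht ω).trans (le_of_eq ?_)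
  rw [mul_pow]
  ring

/-- Uniqueness in law, and path by path, for the mean-field Langevin system. -/
theorem IsLangevinSolution.law_unique (h₁ : S.IsLangevinSolution μ W Θ₁ κ₁ X₁ P₁)
    (h₂ : S.IsLangevinSolution μ W Θ₂ κ₂ X₂ P₂) (hC : S.Bounds Kx Kp C) (hS : S.Standing)
    (hK : S.IsRange Kx Kp) (h₀ : ∀ᵐ t ∂S.time, Θ₁ t 0 =ᵐ[μ] Θ₂ t 0) :
    ∀ᵐ t ∂S.time, ∀ s, κ₁ s t = κ₂ s t := by
  -- The exceptional set of times `t` may depend on the horizon; countably many horizons `N` cover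
  -- all `s`.
  have key : ∀ N : ℕ, ∀ᵐ t ∂S.time, ∀ s ≤ (N : ℝ≥0), Θ₁ t s =ᵐ[μ] Θ₂ t s := fun N => by
    filter_upwards [h₁.ae_norm_sub_le h₂ hC hS hK h₀ le_rfl (n := 0) (s₁ := N)
      fun r _ t ht ω => by simpa using h₁.processes_unique h₂ hC hS hK h₀ r ht ω] with t ht s hs
    filter_upwards [ht s hs] with ω hω
    rw [zero_mul, zero_div, mul_zero, zero_mul] at hω
    exact sub_eq_zero.1 (norm_le_zero_iff.1 hω)
  filter_upwards [ae_all_iff.2 key, h₁.law, h₂.law] with t ht hl₁ hl₂ s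
  obtain ⟨N, hN⟩ := exists_nat_ge s
  rw [← hl₁, ← hl₂, Measure.map_congr (ht N s hN)]

end Uniqueness

/-! ### Invariance of the minimiser under the mean-field system -/

section Invariance

variable {C : ℝ} {ν : Kernel ℝ (E m)} [IsMarkovKernel ν] {X P : ℝ → Ω₀ → E d}

theorem lintegral_norm_rpow_two_lt_top
    (h : Integrable (fun q : ℝ × E m => ‖q.2‖ ^ 2) (S.controlMeasure ν)) :
    ∫⁻ t, ∫⁻ a, ENNReal.ofReal (‖a‖ ^ (2 : ℝ)) ∂(ν t) ∂S.time < ⊤ := by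
  have h1 := h.lintegral_lt_top
  rw [controlMeasure, Measure.lintegral_compProd (by fun_prop)] at h1
  simpa only [Real.rpow_two] using h1

variable {Ω : Type*} [MeasurableSpace Ω] {μ : Measure Ω} [IsProbabilityMeasure μ]
  {W : ℝ≥0 → Ω → E m} {Θ₀ : ℝ → Ω → E m}

/-- The Gibbs measure of the first order condition gives a stationary solution. -/
theorem Bounds.exists_stationary_solution (hC : S.Bounds Kx Kp C) (hS : S.Standing)
    (hK : S.IsRange Kx Kp) (hXP : S.IsRegularPair ν X P)
    (hν : S.HasDensity ν (gibbsDensity (2 / S.σ ^ 2) (S.potential X P))) (hW : IsBrownian μ W)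
    (hΘ₀ : ∀ᵐ t ∂S.time, Measurable (Θ₀ t) ∧ μ.map (Θ₀ t) = ν t ∧
      IndepFun (Θ₀ t) (fun ω s => W s ω) μ) :
    ∃ Θ, S.IsLangevinSolution μ W Θ (fun _ => ν) (fun _ => X) (fun _ => P) ∧
      ∀ᵐ t ∂S.time, Θ t 0 =ᵐ[μ] Θ₀ t := by
  have key : ∀ᵐ t ∂S.time, ∃ θ : ℝ≥0 → Ω → E m, (∀ s, Measurable (θ s)) ∧
      (∀ᵐ ω ∂μ, Continuous fun s => θ s ω) ∧ (∀ s, μ.map (θ s) = ν t) ∧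
      ∀ᵐ ω ∂μ, ∀ s : ℝ≥0, θ s ω = Θ₀ t ω
        - (∫ r in (0 : ℝ)..s, S.meanGrad (X t) (P t) t (θ r.toNNReal ω)) + S.σ • W s ω := by
    filter_upwards [hΘ₀, hν.ae_eq, ae_time_mem (S := S)] with t h₀ hνt ht
    obtain ⟨θ, hm, hc, he⟩ := exists_langevin_solution (zero_lt_one.trans_le hC.one_le)
      (hC.meanGrad_lip hS hK hXP ht) hW h₀.1 (σ := S.σ)
    exact ⟨θ, hm, hc, hC.map_langevin_eq_gibbs hS hK hXP ht hνt hW h₀.1 h₀.2.1 h₀.2.2 hm hc he, he⟩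
  -- Solutions are chosen separately for each `t`: measurability in `t` is asked of the laws only,
  -- and these form the kernel `ν`. The choice requires a nontrivial filter, which `T > 0` provides.
  have : (ae S.time).NeBot := ae_neBot.2 fun h => by
    have h1 : S.time univ = 0 := by rw [h]; rfl
    rw [time, Measure.restrict_apply_univ, Real.volume_Icc, sub_zero, ENNReal.ofReal_eq_zero] at h1
    exact hS.T_pos.not_ge h1
  obtain ⟨Θ, hΘ⟩ := key.choice
  have hzero : ∀ᵐ t ∂S.time, Θ t 0 =ᵐ[μ] Θ₀ t := hΘ.mono fun t ht => by
    filter_upwards [ht.2.2.2, brownian_ae_zero hW] with ω hω hω₀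
    have h := hω 0
    rwa [hω₀, NNReal.coe_zero, intervalIntegral.integral_same, smul_zero, sub_zero, add_zero] at h
  refine ⟨Θ, ⟨fun _ => inferInstance, hΘ.mono fun t ht => ht.1, hΘ.mono fun t ht => ht.2.2.1,
    hΘ.mono fun t ht => ht.2.1, ?_, fun _ => hXP.isState, fun _ => hXP.isAdjoint⟩, hzero⟩
  filter_upwards [hΘ, hzero] with t ht h₀
  filter_upwards [ht.2.2.2, h₀] with ω hω hω₀ s
  rw [hω₀]
  exact hω s

/-- The stationary solution with frozen processes gives existence, and uniqueness for equal noise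
and initial values transfers its laws to every other solution. -/
theorem Bounds.isInvariant (hC : S.Bounds Kx Kp C) (hS : S.Standing)
    (hK : S.IsRange Kx Kp) (hXP : S.IsRegularPair ν X P)
    (hint : Integrable (fun q : ℝ × E m => ‖q.2‖ ^ 2) (S.controlMeasure ν))
    (hν : S.HasDensity ν (gibbsDensity (2 / S.σ ^ 2) (S.potential X P))) :
    ControlProblem.IsInvariant.{u} S ν := by
  refine ⟨⟨2, one_le_two, lintegral_norm_rpow_two_lt_top hint⟩, ?_⟩
  intro Ω _ μ _ W Θ₀ hW hΘ₀
  obtain ⟨Θ', hΘ', hzero⟩ := hC.exists_stationary_solution hS hK hXP hν hW hΘ₀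
  refine ⟨⟨Θ', fun _ => ν, fun _ => X, fun _ => P, hΘ', hzero⟩, fun Θ κ X' P' hΘ h₀ => ?_⟩
  refine hΘ.law_unique hΘ' hC hS hK ?_
  filter_upwards [h₀, hzero] with t h1 h2
  exact h1.trans h2.symm

end Invariance

end RelaxedControl.ControlProblem

end

theorem mainTheorem6 {d m : ℕ} {𝒵 : Type v} {Ω₀ : Type w}
    [MeasurableSpace 𝒵] [MeasurableSpace Ω₀]
    (S : ControlProblem d m 𝒵 Ω₀) (Kx Kp : Set (E d))
    (hS : S.Standing) (hK : S.IsRange Kx Kp)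
    (hWell : S.AssumptionWell Kx) (hGF : S.AssumptionGF Kx Kp)
    (hV : S.BoundedBelow)
    (ν : Kernel ℝ (E m)) [IsMarkovKernel ν]
    (hopt : S.IsOptimal ν) (hfin : S.Vreg ν < ⊤) :
    (S.controlMeasure ν ≪ S.time.prod volume ∧ S.time.prod volume ≪ S.controlMeasure ν) ∧
    (∃ X P : ℝ → Ω₀ → E d,
      (S.IsState ν X ∧ S.IsAdjoint ν X P) ∧
      (∀ X' P', S.IsState ν X' → S.IsAdjoint ν X' P' →
        ∀ t ∈ Icc 0 S.T, ∀ ω, X' t ω = X t ω ∧ P' t ω = P t ω) ∧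
      S.FirstOrderCondition ν X P) ∧
    ControlProblem.IsInvariant.{u} S ν := by
  have := hS.isProb
  obtain ⟨X, P, hXP⟩ := hS.exists_isRegularPair ν
  have h0 : (0 : ℝ) ∈ Icc 0 S.T := ⟨le_rfl, hS.T_pos.le⟩
  obtain ⟨ω₀⟩ := S.P.nonempty_of_neZero
  -- A value of the adjoint process witnesses that `Kp` is nonempty.
  obtain ⟨C, hC⟩ := hS.exists_full_bounds hWell hGF hK.isCompact_x hK.isCompact_p
    ⟨_, (hXP.mem hK 0 h0 ω₀).2⟩
  obtain ⟨hint, hρ⟩ := hC.ae_eq_gibbs_of_isOptimal hS hK hV hXP hopt hfin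
  have hσ := hS.σ_pos
  have hβ : 0 < 2 / S.σ ^ 2 := by positivity
  refine ⟨hρ.mutually_absolutelyContinuous ((hC.isQuadratic_potential hS hK hXP).gibbsDensity_pos hβ),
    ⟨X, P, ⟨hXP.isState, hXP.isAdjoint⟩, fun X' P' hX' hP' t ht ω => ⟨?_, ?_⟩,
      hC.firstOrderCondition hS hK hXP hρ⟩, hC.isInvariant hS hK hXP hint hρ⟩
  · exact hC.toStandingBounds.state_unique hS ν hX' hXP.isState t ht ω
  · exact hC.toStandingBounds.adjoint_unique hS ν hX' hXP.isState hP' hXP.isAdjoint t ht ω
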